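/- Let $r:\mathbb R\to\mathbb C$ satisfy $r(-k)=\overline{r(k)}$, and let $k_1,\dots,k_N$ ($N\ge 0$) be distinct points with $\operatorname{Im}k_j>0$ and $\gamma_1,\dots,\gamma_N\in\mathbb C$, such that the set of pairs $(k_j,\gamma_j)$ is invariant under $(k,\gamma)\mapsto(-\bar k,\bar\gamma)$. For $\hat x,t\in\mathbb R$ put $\sigma_3=\operatorname{diag}(1,-1)$, $\hat Q=\bigl(\mathrm ik\hat x+\frac{t}{4\mathrm ik}\bigr)\sigma_3$ and $$J(\hat x,t,k)=\mathrm e^{-\hat Q}\begin{pmatrix}1+|r(k)|^2&\overline{r(k)}\\ r(k)&1\end{pmatrix}\mathrm e^{\hat Q},\qquad k\in\mathbb R\setminus\{0\}.$$ The RH problem at $(\hat x,t)$ is to find a $2\times2$ matrix function $\hat M(\hat x,t,k)=(\hat M^{(1)}\ \hat M^{(2)})$ of $k\in\mathbb C\setminus\mathbb R$ such that: $\hat M^{(1)}$ is analytic off $\mathbb R$ except for at most simple poles at the $k_j$, $\hat M^{(2)}$ is analytic off $\mathbb R$ except for at most simple poles at the $\bar k_j$, and $$\operatorname*{Res}_{k=k_j}\hat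 M^{(1)}=\mathrm i\gamma_j\mathrm e^{2\mathrm i(k_j\hat x-\frac t{4k_j})}\hat M^{(2)}(k_j),\qquad \operatorname*{Res}_{k=\bar k_j}\hat M^{(2)}=\mathrm i\bar\gamma_j\mathrm e^{-2\mathrm i(\bar k_j\hat x-\frac t{4\bar k_j})}\hat M^{(1)}(\bar k_j);$$ at every real $k\ne0$ the limits $\hat M_\pm$ from the half-planes $\pm\operatorname{Im}k>0$ exist and $\hat M_+=\hat M_-J$; $\hat M$ is bounded near $k=0$; and $\hat M\to I$ as $k\to\infty$. Let $T\subseteq\mathbb R$ be a set of times (for example $[0,\infty)$ or $\mathbb R$), and suppose that for all $\hat x\in\mathbb R$, $t\in T$ the RH problem has a unique solution $\hat M(\hat x,t,\cdot)$ and that the limits (as $k\to0$, $k\notin\mathbb R$) $$\hat M(\hat x,t,0):=\lim_{k\to0}\hat M(\hat x,t,k),\qquad F(\hat x,t):=\lim_{k\to0}\frac{\mathrm i}{k}\bigl(\hat M(\hat x,t,0)^{-1}\hat M(\hat x,t,k)-I\bigr)$$ exist. Then there are real-valued functions $\alpha,\beta,f_1,f_2$ with $$\hat M(\hat x,t,0)=\begin{pmatrix}\alpha&\beta\\-\beta&\alpha\end{pmatrix},\qquad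 F=\begin{pmatrix}f_1&f_2\\f_2&-f_1\end{pmatrix}\qquad(\hat x\in\mathbb R,\ t\in T).$$ Put $x(\hat x,t)=\hat x+f_1(\hat x,t)$, $\hat u=f_2$, and, where $\alpha^2\neq\beta^2$, $\hat q=\dfrac1{\alpha^2-\beta^2}$, $\hat w=\dfrac{2\alpha\beta}{\alpha^2-\beta^2}$. Then at every $(\hat x,t)\in\mathbb R\times T$ with $\alpha^2\ne\beta^2$ the following derivatives exist (those in $t$ taken within $T$) and $$\text{(a)}\ \ x_{\hat x}=\frac1{\hat q},\qquad \text{(b)}\ \ \hat u_{\hat x}=\frac{\hat w}{\hat q},\qquad \text{(c)}\ \ \hat q_t=\hat u\,\hat q\,\hat w .$$ Moreover, at every $(\hat x,t)\in\mathbb R\times T$, including those with $\alpha^2=\beta^2$, the same equations hold without denominators: $x_{\hat x}=\alpha^2-\beta^2$, $\hat u_{\hat x}=2\alpha\beta$, $(\alpha^2-\beta^2)_t=-2\alpha\beta\,\hat u$. -/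

import Mathlib

open Filter Topology
open scoped ComplexConjugate

/-- A data set `{r(k), k ∈ ℝ; {k_j, γ_j}}` for the Riemann–Hilbert problem: finitely many distinct
points `k_j` in the open upper half-plane with constants `γ_j`, and a reflection coefficient `r`.
The last two fields are the symmetry of the data under `k ↦ -k̄`. -/
structure SPData where
  /-- the reflection coefficient -/
  r : ℝ → ℂ
  /-- the number of points `k_j` -/
  N : ℕ
  /-- the points `k_j` -/
  pole : Fin N → ℂ
  /-- the constants `γ_j` -/
  γ : Fin N → ℂ
  pole_im_pos : ∀ j, 0 < (pole j).im
  pole_injective : Function.Injective pole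
  r_neg : ∀ k : ℝ, r (-k) = conj (r k)
  pole_symm : ∀ j, ∃ l, pole l = -conj (pole j) ∧ γ l = conj (γ j)

namespace SPData

/-- The complex plane without the real axis (the contour). -/
def offReal : Set ℂ := {k | k.im ≠ 0}

/-- The scalar phase `i k x + t / (4 i k)`, so that `Q̂(x,t,k) = phase x t k • σ₃`. -/
noncomputable def phase (x t : ℝ) (k : ℂ) : ℂ :=
  Complex.I * k * x + t / (4 * Complex.I * k)

/-- `e^{θ σ₃}`. -/
noncomputable def expSigma3 (θ : ℂ) : Matrix (Fin 2) (Fin 2) ℂ :=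
  !![Complex.exp θ, 0; 0, Complex.exp (-θ)]

/-- The matrix `J₀(k)`. -/
noncomputable def J₀ (D : SPData) (k : ℝ) : Matrix (Fin 2) (Fin 2) ℂ :=
  !![1 + (‖D.r k‖ : ℂ) ^ 2, conj (D.r k); D.r k, 1]

/-- The jump matrix `J(x,t,k) = e^{-Q̂(x,t,k)} J₀(k) e^{Q̂(x,t,k)}`. -/
noncomputable def jump (D : SPData) (x t : ℝ) (k : ℝ) : Matrix (Fin 2) (Fin 2) ℂ :=
  expSigma3 (-phase x t k) * D.J₀ k * expSigma3 (phase x t k)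

/-- `M` solves the Riemann–Hilbert problem with data `D` at the parameter values `(x, t)`.
Only the values of `M` off the real axis matter, and those of the first (second) column at the
points `k_j` (at their conjugates) do not. -/
structure IsRHSolution (D : SPData) (x t : ℝ) (M : ℂ → Matrix (Fin 2) (Fin 2) ℂ) : Prop where
  /-- The first column is analytic off the real axis except at the points `k_j`. -/
  differentiableOn_col_one : ∀ i,
    DifferentiableOn ℂ (fun k => M k i 0) (offReal \ Set.range D.pole)
  /-- The second column is analytic off the real axis except at the points `k̄_j`. -/
  differentiableOn_col_two : ∀ i,
    DifferentiableOn ℂ (fun k => M k i 1) (offReal \ Set.range fun j => conj (D.pole j))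
  /-- `M` has limiting values `M₊`, `M₋` at the points `k ≠ 0` of the real axis from the upper and
  the lower half-plane, and `M₊ = M₋ J`. (For `t ≠ 0` the matrix `J` has no meaning at `k = 0`.) -/
  jump_rel : ∃ Mplus Mminus : ℝ → Matrix (Fin 2) (Fin 2) ℂ, ∀ k : ℝ, k ≠ 0 →
    Tendsto M (𝓝[{z | 0 < z.im}] (k : ℂ)) (𝓝 (Mplus k)) ∧
    Tendsto M (𝓝[{z | z.im < 0}] (k : ℂ)) (𝓝 (Mminus k)) ∧
    Mplus k = Mminus k * D.jump x t k
  /-- `M` is bounded near the point `0` of the real axis. -/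
  bounded_zero : ∃ C : ℝ, ∀ᶠ k in 𝓝[offReal] (0 : ℂ), ∀ i j, ‖M k i j‖ ≤ C
  /-- The first column has at most a simple pole at `k_j`, with residue
  `i γ_j e^{2i(k_j x - t/(4 k_j))} M⁽²⁾(k_j)`. -/
  residue_col_one : ∀ j i,
    Tendsto (fun k => (k - D.pole j) * M k i 0) (𝓝[≠] D.pole j)
      (𝓝 (Complex.I * D.γ j *
        Complex.exp (2 * Complex.I * (D.pole j * x - t / (4 * D.pole j))) * M (D.pole j) i 1))
  /-- The second column has at most a simple pole at `k̄_j`, with residue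
  `i γ̄_j e^{-2i(k̄_j x - t/(4 k̄_j))} M⁽¹⁾(k̄_j)`. -/
  residue_col_two : ∀ j i,
    Tendsto (fun k => (k - conj (D.pole j)) * M k i 1) (𝓝[≠] conj (D.pole j))
      (𝓝 (Complex.I * conj (D.γ j) *
        Complex.exp (-(2 * Complex.I * (conj (D.pole j) * x - t / (4 * conj (D.pole j))))) *
          M (conj (D.pole j)) i 0))
  /-- `M(k) → I` as `k → ∞`. -/
  normalization : Tendsto M (cocompact ℂ ⊓ 𝓟 offReal) (𝓝 1)

/-- `M` is the unique solution of the Riemann–Hilbert problem at `(x, t)`: every solution agrees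
with it off the real axis and off the points `k_j`, `k̄_j`. -/
def IsUniqueRHSolution (D : SPData) (x t : ℝ) (M : ℂ → Matrix (Fin 2) (Fin 2) ℂ) : Prop :=
  D.IsRHSolution x t M ∧
    ∀ M' : ℂ → Matrix (Fin 2) (Fin 2) ℂ, D.IsRHSolution x t M' →
      ∀ k ∈ offReal, (∀ j, k ≠ D.pole j ∧ k ≠ conj (D.pole j)) → M' k = M k

end SPData

/-- `q̂ = 1 / (α² - β²)`. -/
noncomputable def qHat (α β : ℝ → ℝ → ℝ) (x t : ℝ) : ℝ :=
  1 / (α x t ^ 2 - β x t ^ 2)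

/-- `ŵ = 2αβ / (α² - β²)`. -/
noncomputable def wHat (α β : ℝ → ℝ → ℝ) (x t : ℝ) : ℝ :=
  2 * α x t * β x t / (α x t ^ 2 - β x t ^ 2)

/-!
The equations express how the solution `M` of the Riemann–Hilbert problem changes with the
parameters. The usual derivation differentiates `M` in `x` and `t`; here nothing is known about the
dependence of `M` on the parameters, and the derivatives have to be produced from the problem at
each single pair `(x, t)`.

*Symmetries.* The rows of `M e^{-Q̂ σ₃}` ("waves", `IsWave`) satisfy jump and residue conditions
free of `x` and `t`. The Wronskian of two waves has no jump and no poles, hence extends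
holomorphically to `ℂ \ {0}` (`IsWave.exists_wronskian`). With Liouville's theorem this gives
`det M = 1`, `M(k̄)* = M(k)⁻¹` and `M(-k)ᵀ = M(k)⁻¹` (`IsRHSolution.isWaveMatrix`), and hence the
form of `M₀` and `F`.

*Transfer matrices.* For two solutions `M'`, `M` at different parameters,
`E(k) = M'(k) e^{-δ σ₃} M(k)⁻¹`, where `δ` is the difference of the phases, is holomorphic on
`ℂ \ {0}` as its entries are Wronskians, and is unitary on the real axis
(`IsWaveMatrix.exists_transfer`). If only `x` changes, by `h`, then `δ = i k h` and `E` is entire in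
`k`. If only `t` changes, one normalizes at `k = 0` by passing to `M₀⁻¹ M`; then `δ = i z h` with
`z = 1 / k` and `h = -(t' - t) / 4`, and `E` is entire in `z`. In both cases the
Phragmén–Lindelöf principle gives `|E_ij(z)| ≤ e^{|h| |Im z|}` (`norm_le_exp_of_norm_le_one_on_real`,
`isTransfer_update`), a bound uniform in `h` on the disc `|z| ≤ 1 / |h|`.

*First order in `h`.* Let `N` be the matrix of the base point, normalized at infinity. A row of
`E N e^{i z h σ₃}` tends to a constant at infinity, and its jump over the real axis is controlled by
that of `N`, because `E` is bounded by `1` there. Deforming the circle `|z| = 1 / |h|` to infinity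
(`IsOuter.norm_integral_circle_sub_le`) compares the Taylor coefficients of `E e^{i z h σ₃}` at `0`
with that constant: `E'(0) = -i h E(0) σ₃ + o(h)` (`IsFrame.eventually_norm_deriv_le`) and, if
`N = 1 + P / z + o(1 / z)`, the value `E(0)` up to `o(h)`
(`IsFrame.eventually_norm_apply_zero_sub_le`).

When `x` changes, `E(0) = M₀(x') M₀(x)⁻¹` and `E'(0)` involves `F(x') - F(x)`, so that
`F(x') - F(x) + h σ₃ = h M₀⁻¹ σ₃ M₀ + o(h)`, which are the equations (a) and (b). When `t` changes,
the value of `E` at `k = ∞` is `M₀(t')⁻¹ M₀(t)`, a rotation whose angle is therefore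
`f₂ (t' - t) / 2` to first order; this is (c).
-/

/-! ### Holomorphic extension across the real axis -/

open Complex Set in
open scoped Interval in
/-- **Painlevé's theorem** for the real axis: a function that is continuous on an open set and
holomorphic off the real axis is holomorphic. It is Morera's theorem, with each rectangle cut along
the real axis. -/
theorem differentiableOn_of_differentiableAt_offReal {U : Set ℂ} (hU : IsOpen U) {f : ℂ → ℂ}
    (hc : ContinuousOn f U) (hd : ∀ z ∈ U, z.im ≠ 0 → DifferentiableAt ℂ f z) :
    DifferentiableOn ℂ f U := by
  refine (isConservativeOn_and_continuousOn_iff_isDifferentiableOn hU).1 ⟨?_, hc⟩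
  -- rectangles that do not cross the real axis
  have key : ∀ z w : ℂ, Rectangle z w ⊆ U → (0 ≤ z.im ∧ 0 ≤ w.im ∨ z.im ≤ 0 ∧ w.im ≤ 0) →
      wedgeIntegral z w f + wedgeIntegral w z f = 0 := by
    intro z w hzw h
    rw [wedgeIntegral_add_wedgeIntegral_eq]
    refine integral_boundary_rect_eq_zero_of_continuousOn_of_differentiableOn f z w
      (hc.mono hzw) fun u hu => (hd u (hzw ?_) ?_).differentiableWithinAt
    · exact ⟨Ioo_subset_Icc_self hu.1, Ioo_subset_Icc_self hu.2⟩
    · have h2 := hu.2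
      simp only [mem_preimage, mem_Ioo, min_lt_iff, lt_max_iff] at h2
      intro h0
      rcases h with h | h <;> rcases h2 with ⟨h3 | h3, h4 | h4⟩ <;> linarith
  intro z w hzw
  rw [eq_neg_iff_add_eq_zero]
  by_cases h : 0 ≤ z.im ∧ 0 ≤ w.im ∨ z.im ≤ 0 ∧ w.im ≤ 0
  · exact key z w hzw h
  have h0 : (0 : ℝ) ∈ [[z.im, w.im]] := by
    rw [mem_uIcc]
    by_contra h'
    apply h
    rcases le_total 0 z.im with h1 | h1 <;> rcases le_total 0 w.im with h2 | h2
    · exact Or.inl ⟨h1, h2⟩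
    · exact absurd (Or.inr ⟨h2, h1⟩) h'
    · exact absurd (Or.inl ⟨h1, h2⟩) h'
    · exact Or.inr ⟨h1, h2⟩
  have hsub1 : [[z.im, (0 : ℝ)]] ⊆ [[z.im, w.im]] := uIcc_subset_uIcc left_mem_uIcc h0
  have hsub2 : [[(0 : ℝ), w.im]] ⊆ [[z.im, w.im]] := uIcc_subset_uIcc h0 right_mem_uIcc
  have k1 := key z w.re (fun u hu => hzw ⟨by simpa using hu.1, hsub1 (by simpa using hu.2)⟩)
    (by simpa using le_total 0 z.im)
  have k2 := key z.re w (fun u hu => hzw ⟨by simpa using hu.1, hsub2 (by simpa using hu.2)⟩)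
    (by simpa using le_total 0 w.im)
  rw [wedgeIntegral_add_wedgeIntegral_eq] at k1 k2 ⊢
  have hint : ∀ x : ℝ, x ∈ [[z.re, w.re]] → ∀ a b : ℝ, a ∈ [[z.im, w.im]] → b ∈ [[z.im, w.im]] →
      IntervalIntegrable (fun y : ℝ => f (x + y * I)) MeasureTheory.volume a b := by
    intro x hx a b ha hb
    refine ContinuousOn.intervalIntegrable (hc.comp (by fun_prop) fun y hy => hzw ?_)
    exact ⟨by simpa using hx, by simpa using uIcc_subset_uIcc ha hb hy⟩
  have e1 := intervalIntegral.integral_add_adjacent_intervals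
    (hint w.re right_mem_uIcc z.im 0 left_mem_uIcc h0)
    (hint w.re right_mem_uIcc 0 w.im h0 right_mem_uIcc)
  have e2 := intervalIntegral.integral_add_adjacent_intervals
    (hint z.re left_mem_uIcc z.im 0 left_mem_uIcc h0)
    (hint z.re left_mem_uIcc 0 w.im h0 right_mem_uIcc)
  rw [← e1, ← e2]
  simp only [ofReal_re, ofReal_im, smul_eq_mul] at k1 k2 ⊢
  linear_combination k1 + k2

/-- The real axis has empty interior: every point is a limit of points off the real axis. -/
theorem mem_closure_offReal_inter {O : Set ℂ} (hO : IsOpen O) {z : ℂ} (hz : z ∈ O) :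
    z ∈ closure (O ∩ SPData.offReal) := by
  have h : Dense SPData.offReal := by
    have : SPData.offReal = (Complex.im ⁻¹' {0})ᶜ := by ext; simp [SPData.offReal]
    rw [this, ← interior_eq_empty_iff_dense_compl, Complex.interior_preimage_im]
    simp
  exact h.open_subset_closure_inter hO hz

theorem isOpen_offReal : IsOpen SPData.offReal :=
  isOpen_ne_fun Complex.continuous_im continuous_const

open SPData in
/-- A continuous function on `ℂ \ {0}` with a limit at `0` off the real axis has that limit. -/
theorem tendsto_nhdsNE_of_tendsto_offReal {G : ℂ → ℂ} (hG : ContinuousOn G {0}ᶜ) {c : ℂ}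
    (h : Tendsto G (𝓝[offReal] 0) (𝓝 c)) : Tendsto G (𝓝[≠] 0) (𝓝 c) := by
  rw [(closed_nhds_basis c).tendsto_right_iff]
  rintro V ⟨hV, hVc⟩
  obtain ⟨O, hO, h0, hOV⟩ := mem_nhdsWithin.1 (h hV)
  filter_upwards [inter_mem_nhdsWithin _ (hO.mem_nhds h0)] with z hz
  have hO' : IsOpen (O \ {0}) := hO.sdiff isClosed_singleton
  have hcl := mem_closure_offReal_inter hO' ⟨hz.2, hz.1⟩
  have := mem_closure_iff_nhdsWithin_neBot.1 hcl
  have hGz : Tendsto G (𝓝[(O \ {0}) ∩ offReal] z) (𝓝 (G z)) :=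
    (hG.continuousAt (isOpen_compl_singleton.mem_nhds hz.1)).continuousWithinAt
  refine hVc.mem_of_tendsto hGz ?_
  filter_upwards [self_mem_nhdsWithin] with y hy using hOV ⟨hy.1.1, hy.2⟩

open SPData in
/-- A continuous function on `ℂ \ {0}` with a limit at `∞` off the real axis has that limit. -/
theorem tendsto_cocompact_of_tendsto_offReal {G : ℂ → ℂ} (hG : ContinuousOn G {0}ᶜ) {c : ℂ}
    (h : Tendsto G (cocompact ℂ ⊓ 𝓟 offReal) (𝓝 c)) : Tendsto G (cocompact ℂ) (𝓝 c) := by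
  rw [(closed_nhds_basis c).tendsto_right_iff]
  rintro V ⟨hV, hVc⟩
  have h1 := h hV
  rw [mem_map, mem_inf_principal, mem_cocompact'] at h1
  obtain ⟨K, hK, hKV⟩ := h1
  filter_upwards [hK.compl_mem_cocompact, (isCompact_singleton (x := (0 : ℂ))).compl_mem_cocompact]
    with z hz hz0
  have hO' : IsOpen (Kᶜ \ {0}) := hK.isClosed.isOpen_compl.sdiff isClosed_singleton
  have hcl := mem_closure_offReal_inter hO' ⟨hz, hz0⟩
  have := mem_closure_iff_nhdsWithin_neBot.1 hcl
  have hGz : Tendsto G (𝓝[(Kᶜ \ {0}) ∩ offReal] z) (𝓝 (G z)) :=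
    (hG.continuousAt (isOpen_compl_singleton.mem_nhds hz0)).continuousWithinAt
  refine hVc.mem_of_tendsto hGz ?_
  filter_upwards [self_mem_nhdsWithin] with y hy
  by_contra hyV
  exact hy.1.1 (hKV fun h => hyV (h hy.2))

theorem differentiable_update_of_tendsto {G : ℂ → ℂ} (hG : DifferentiableOn ℂ G {0}ᶜ) {c : ℂ}
    (h : Tendsto G (𝓝[≠] 0) (𝓝 c)) : Differentiable ℂ (Function.update G 0 c) := by
  have h1 : ∀ z : ℂ, z ≠ 0 → DifferentiableAt ℂ (Function.update G 0 c) z := by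
    intro z hz
    refine ((hG z hz).differentiableAt (isOpen_compl_singleton.mem_nhds hz)).congr_of_eventuallyEq ?_
    filter_upwards [isOpen_compl_singleton.mem_nhds hz] with y hy
    exact Function.update_of_ne hy _ _
  intro z
  rcases eq_or_ne z 0 with rfl | hz
  · refine (Complex.analyticAt_of_differentiable_on_punctured_nhds_of_continuousAt ?_
      (continuousAt_update_same.2 h)).differentiableAt
    filter_upwards [self_mem_nhdsWithin] with y hy using h1 y hy
  · exact h1 z hz

open SPData in
/-- A function that is holomorphic off the real axis and off a finite set `S`, does not have poles
on `S`, and has equal one-sided limits at the points `k ≠ 0` of the real axis extends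
holomorphically to `ℂ \ {0}`. -/
theorem exists_differentiableOn_compl_zero {S : Set ℂ} (hS : S.Finite) {g : ℂ → ℂ}
    (hg : DifferentiableOn ℂ g (offReal \ S))
    (hpole : ∀ s ∈ S, s ∈ offReal ∧ Tendsto (fun k => (k - s) * g k) (𝓝[≠] s) (𝓝 0))
    (hreal : ∀ k : ℝ, k ≠ 0 → ∃ y, Tendsto g (𝓝[{z | 0 < z.im}] (k : ℂ)) (𝓝 y) ∧
      Tendsto g (𝓝[{z | z.im < 0}] (k : ℂ)) (𝓝 y)) :
    ∃ G : ℂ → ℂ, DifferentiableOn ℂ G {0}ᶜ ∧ ∀ k ∈ offReal \ S, G k = g k := by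
  set A : Set ℂ := offReal \ S with hA
  have hAo : IsOpen A := isOpen_offReal.sdiff hS.isClosed
  have hgA : ∀ z ∈ A, ContinuousAt g z := fun z hz =>
    ((hg z hz).differentiableAt (hAo.mem_nhds hz)).continuousAt
  have hlim : ∀ z ∈ ({0}ᶜ : Set ℂ), ∃ y, Tendsto g (𝓝[A] z) (𝓝 y) := by
    intro z hz0
    by_cases him : z.im = 0
    · obtain ⟨x, rfl⟩ : ∃ x : ℝ, z = x := ⟨z.re, Complex.ext rfl (by simp [him])⟩
      obtain ⟨y, h1, h2⟩ := hreal x (by rintro rfl; exact hz0 rfl)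
      refine ⟨y, (h1.sup h2).mono_left ?_⟩
      rw [← nhdsWithin_union]
      refine nhdsWithin_mono _ fun w hw => ?_
      rcases lt_or_gt_of_ne (show w.im ≠ 0 from hw.1) with h | h
      · exact Or.inr h
      · exact Or.inl h
    by_cases hzS : z ∈ S
    · have hne : ∀ᶠ w in 𝓝[≠] z, w ∈ A := by
        have h1 : (S \ {z})ᶜ ∈ 𝓝 z := (hS.subset Set.sdiff_subset).isClosed.isOpen_compl.mem_nhds
          (by simp)
        filter_upwards [inter_mem_nhdsWithin _ h1, nhdsWithin_le_nhds (isOpen_offReal.mem_nhds him)]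
          with w hw hw2
        refine ⟨hw2, fun h => hw.2 ⟨h, hw.1⟩⟩
      refine ⟨_, (Complex.tendsto_limUnder_of_differentiable_on_punctured_nhds_of_isLittleO
        (hne.mono fun w hw => (hg w hw).differentiableAt (hAo.mem_nhds hw)) ?_).mono_left
        (nhdsWithin_mono _ fun w hw => ?_)⟩
      · have h1 : Tendsto (fun k => (k - z) * (g k - g z)) (𝓝[≠] z) (𝓝 0) := by
          have h2 : Tendsto (fun k : ℂ => (k - z) * g z) (𝓝[≠] z) (𝓝 0) :=
            (Continuous.tendsto' (by fun_prop) z 0 (by simp)).mono_left nhdsWithin_le_nhds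
          simpa [mul_sub] using (hpole z hzS).2.sub h2
        rw [Asymptotics.isLittleO_iff_tendsto']
        · refine h1.congr fun k => ?_
          rw [div_inv_eq_mul, mul_comm]
        · filter_upwards [self_mem_nhdsWithin] with w hw h
          exact absurd (inv_eq_zero.1 h) (sub_ne_zero.2 hw)
      · rintro rfl; exact hw.2 hzS
    · exact ⟨_, (hgA z ⟨him, hzS⟩).tendsto.mono_left nhdsWithin_le_nhds⟩
  -- `g` is extended by its limits; Painlevé and the removable singularities do the rest
  have hcl : ({0}ᶜ : Set ℂ) ⊆ closure A := fun z _ => by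
    have h1 : Dense offReal := fun z => by
      simpa using mem_closure_offReal_inter isOpen_univ (Set.mem_univ z)
    have h2 : Dense (Sᶜ) := hS.countable.dense_compl ℝ
    have := h1.inter_of_isOpen_left h2 isOpen_offReal
    exact this z
  have hcont := continuousOn_extendFrom hcl hlim
  have heq : ∀ z ∈ A, extendFrom A g z = g z :=
    extendFrom_extends fun z hz => (hgA z hz).continuousWithinAt
  have hdA : ∀ z ∈ A, DifferentiableAt ℂ (extendFrom A g) z := fun z hz =>
    ((hg z hz).differentiableAt (hAo.mem_nhds hz)).congr_of_eventuallyEq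
      (by filter_upwards [hAo.mem_nhds hz] with w hw using heq w hw)
  refine ⟨extendFrom A g, differentiableOn_of_differentiableAt_offReal isOpen_compl_singleton hcont
    fun z hz him => ?_, heq⟩
  by_cases hzS : z ∈ S
  · refine (Complex.analyticAt_of_differentiable_on_punctured_nhds_of_continuousAt ?_
      (hcont.continuousAt (isOpen_compl_singleton.mem_nhds hz))).differentiableAt
    have h1 : (S \ {z})ᶜ ∈ 𝓝 z := (hS.subset Set.sdiff_subset).isClosed.isOpen_compl.mem_nhds
      (by simp)
    filter_upwards [inter_mem_nhdsWithin _ h1, nhdsWithin_le_nhds (isOpen_offReal.mem_nhds him)]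
      with w hw hw2
    exact hdA w ⟨hw2, fun h => hw.2 ⟨h, hw.1⟩⟩
  · exact hdA z ⟨him, hzS⟩

/-! ### Contour deformation off the real axis -/

theorem circleMap_zero_add_pi (ρ θ : ℝ) : circleMap 0 ρ (θ + Real.pi) = -circleMap 0 ρ θ := by
  simp [circleMap, add_mul, Complex.exp_add]

theorem circleMap_zero_exp (s θ : ℝ) :
    circleMap 0 (Real.exp s) θ = Complex.exp (s + θ * Complex.I) := by
  simp [circleMap, Complex.exp_add]

/-- The points of modulus `> R₀` in the closed upper half-plane are limits of such points of the
open upper half-plane. -/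
theorem subset_closure_upper_outer (R₀ : ℝ) :
    {z : ℂ | 0 ≤ z.im ∧ R₀ < ‖z‖} ⊆ closure {z : ℂ | 0 < z.im ∧ R₀ < ‖z‖} := by
  rintro z ⟨h1, h2⟩
  have hc : Tendsto (fun t : ℝ => z + t * Complex.I) (𝓝[>] 0) (𝓝 z) :=
    (Continuous.tendsto' (by fun_prop) 0 z (by simp)).mono_left nhdsWithin_le_nhds
  refine mem_closure_of_tendsto hc ?_
  have h3 := hc.norm.eventually (lt_mem_nhds h2)
  filter_upwards [h3, self_mem_nhdsWithin] with t ht ht0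
  refine ⟨?_, ht⟩
  have : (0 : ℝ) < t := ht0
  simp only [Complex.add_im, Complex.mul_im, Complex.ofReal_re, Complex.I_im, mul_one,
    Complex.ofReal_im, Complex.I_re, mul_zero, add_zero]
  linarith

open Complex Set in
open scoped Interval in
/-- Cauchy's theorem for the upper half of an annulus, in the coordinate `log k`: the integral of
`k` over a semicircle, against the angle, changes with the radius by an integral of the boundary
values `U` over the two segments of the real axis. -/
theorem integral_semicircle_sub {k : ℂ → ℂ} {U : ℝ → ℂ} {R₀ : ℝ}
    (hd : ∀ z : ℂ, 0 < z.im → R₀ < ‖z‖ → DifferentiableAt ℂ k z)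
    (hU : ∀ x : ℝ, R₀ < |x| → Tendsto k (𝓝[{z | 0 < z.im}] (x : ℂ)) (𝓝 (U x)))
    {A B : ℝ} (hA : R₀ < Real.exp A) (hAB : A ≤ B) :
    IntervalIntegrable (fun θ => k (circleMap 0 (Real.exp A) θ)) MeasureTheory.volume 0 Real.pi ∧
    IntervalIntegrable (fun s => U (Real.exp s)) MeasureTheory.volume A B ∧
    IntervalIntegrable (fun s => U (-Real.exp s)) MeasureTheory.volume A B ∧
    (∫ θ in (0)..Real.pi, k (circleMap 0 (Real.exp B) θ)) -
      (∫ θ in (0)..Real.pi, k (circleMap 0 (Real.exp A) θ)) =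
      I * ((∫ s in A..B, U (Real.exp s)) - ∫ s in A..B, U (-Real.exp s)) := by
  set A' : Set ℂ := {z : ℂ | 0 < z.im ∧ R₀ < ‖z‖} with hA'
  set B' : Set ℂ := {z : ℂ | 0 ≤ z.im ∧ R₀ < ‖z‖} with hB'
  have hA'o : IsOpen A' :=
    (isOpen_lt continuous_const continuous_im).inter (isOpen_lt continuous_const continuous_norm)
  have hreal : ∀ x : ℝ, R₀ < |x| → Tendsto k (𝓝[A'] (x : ℂ)) (𝓝 (U x)) := fun x hx =>
    (hU x hx).mono_left (nhdsWithin_mono _ fun z hz => hz.1)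
  have hkc : ∀ z ∈ A', ContinuousAt k z := fun z hz => (hd z hz.1 hz.2).continuousAt
  have hlim : ∀ z ∈ B', ∃ y, Tendsto k (𝓝[A'] z) (𝓝 y) := by
    rintro z ⟨h1, h2⟩
    rcases h1.eq_or_lt with h | h
    · obtain ⟨x, rfl⟩ : ∃ x : ℝ, z = x := ⟨z.re, Complex.ext rfl (by simp [← h])⟩
      exact ⟨_, hreal x (by simpa using h2)⟩
    · exact ⟨_, (hkc z ⟨h, h2⟩).tendsto.mono_left nhdsWithin_le_nhds⟩
  have hcl := subset_closure_upper_outer R₀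
  -- the extension of `k` to the closed half-plane by its boundary values
  set K := extendFrom A' k with hK
  have hKc : ContinuousOn K B' := continuousOn_extendFrom hcl hlim
  have hKA : ∀ z ∈ A', K z = k z :=
    extendFrom_extends fun z hz => (hkc z hz).continuousWithinAt
  have hKU : ∀ x : ℝ, R₀ < |x| → K x = U x := fun x hx =>
    extendFrom_eq (hcl ⟨by simp, by simpa using hx⟩) (hreal x hx)
  have hKd : ∀ z ∈ A', DifferentiableAt ℂ K z := fun z hz =>
    (hd z hz.1 hz.2).congr_of_eventuallyEq
      (by filter_upwards [hA'o.mem_nhds hz] with w hw using hKA w hw)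
  have hpi := Real.pi_pos
  set F : ℂ → ℂ := fun w => K (exp w) with hF
  have hR : ∀ s, A ≤ s → R₀ < Real.exp s := fun s hs => hA.trans_le (Real.exp_le_exp.2 hs)
  have hmem : ∀ w : ℂ, A ≤ w.re → 0 ≤ w.im → w.im ≤ Real.pi → exp w ∈ B' := fun w h1 h2 h3 =>
    ⟨by rw [exp_im]; exact mul_nonneg (Real.exp_pos _).le (Real.sin_nonneg_of_nonneg_of_le_pi h2 h3),
      by rw [norm_exp]; exact hR _ h1⟩
  have hFc : ContinuousOn F ([[A, B]] ×ℂ [[0, Real.pi]]) := by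
    refine hKc.comp (by fun_prop) fun w hw => ?_
    rw [mem_reProdIm, uIcc_of_le hAB, uIcc_of_le hpi.le] at hw
    exact hmem w hw.1.1 hw.2.1 hw.2.2
  have hcauchy := integral_boundary_rect_eq_zero_of_continuousOn_of_differentiableOn F
    (A : ℂ) (B + Real.pi * I) (by simpa using hFc) (by
      intro w hw
      simp only [ofReal_re, add_re, mul_re, I_re, mul_zero, ofReal_im, I_im, mul_one, sub_self,
        add_zero, add_im, mul_im, zero_add, min_eq_left hAB, max_eq_right hAB, min_eq_left hpi.le,
        max_eq_right hpi.le, mem_reProdIm, mem_Ioo] at hw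
      refine ((hKd _ ⟨?_, ?_⟩).comp w differentiableAt_exp).differentiableWithinAt
      · rw [exp_im]
        exact mul_pos (Real.exp_pos _) (Real.sin_pos_of_pos_of_lt_pi hw.2.1 hw.2.2)
      · rw [norm_exp]; exact hR _ hw.1.1.le)
  simp only [ofReal_re, add_re, mul_re, I_re, mul_zero, ofReal_im, I_im, mul_one, sub_self,
    add_zero, add_im, mul_im, zero_add, ofReal_zero, zero_mul, smul_eq_mul] at hcauchy
  -- the four sides of the rectangle
  have hside : ∀ s : ℝ, A ≤ s →
      EqOn (fun y : ℝ => F (s + y * I)) (fun θ => k (circleMap 0 (Real.exp s) θ))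
        (uIoo 0 Real.pi) := by
    intro s hs θ hθ
    rw [uIoo_of_le hpi.le] at hθ
    have hm : circleMap 0 (Real.exp s) θ ∈ A' := by
      refine ⟨?_, ?_⟩
      · rw [circleMap_zero_im]
        exact mul_pos (Real.exp_pos _) (Real.sin_pos_of_pos_of_lt_pi hθ.1 hθ.2)
      · simpa [circleMap_zero_exp, norm_exp] using hR s hs
    simp only [hF, ← circleMap_zero_exp, hKA _ hm]
  have hbot : ∀ s ∈ [[A, B]], F s = U (Real.exp s) := by
    intro s hs
    rw [uIcc_of_le hAB] at hs
    have := hKU (Real.exp s) (by rw [abs_of_pos (Real.exp_pos s)]; exact hR s hs.1)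
    simpa [hF] using this
  have htop : ∀ s ∈ [[A, B]], F (s + Real.pi * I) = U (-Real.exp s) := by
    intro s hs
    rw [uIcc_of_le hAB] at hs
    have := hKU (-Real.exp s) (by rw [abs_neg, abs_of_pos (Real.exp_pos s)]; exact hR s hs.1)
    simpa [hF, exp_add] using this
  rw [intervalIntegral.integral_congr hbot, intervalIntegral.integral_congr htop,
    intervalIntegral.integral_congr_uIoo (hside B hAB),
    intervalIntegral.integral_congr_uIoo (hside A le_rfl)] at hcauchy
  refine ⟨?_, ?_, ?_, ?_⟩
  · refine IntervalIntegrable.congr_uIoo ?_ (hside A le_rfl)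
    refine ContinuousOn.intervalIntegrable (hFc.comp (by fun_prop) fun y hy => ?_)
    exact ⟨by simp, by simpa using hy⟩
  · refine IntervalIntegrable.congr (f := fun s : ℝ => F s)
      (fun s hs => hbot s (uIoc_subset_uIcc hs)) ?_
    refine ContinuousOn.intervalIntegrable (hFc.comp (by fun_prop) fun y hy => ?_)
    exact ⟨by simpa using hy, by simp⟩
  · refine IntervalIntegrable.congr (f := fun s : ℝ => F (s + Real.pi * I))
      (fun s hs => htop s (uIoc_subset_uIcc hs)) ?_
    refine ContinuousOn.intervalIntegrable (hFc.comp (by fun_prop) fun y hy => ?_)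
    exact ⟨by simpa using hy, by simp⟩
  · have hI : I * I = -1 := I_mul_I
    linear_combination (-I) * hcauchy + (∫ θ in (0)..Real.pi, k (circleMap 0 (Real.exp B) θ)) * hI
      - (∫ θ in (0)..Real.pi, k (circleMap 0 (Real.exp A) θ)) * hI

/-- `f` is holomorphic off the real axis outside the disc of radius `R₀`, has one-sided limits at
the points of the real axis there, and tends to `ℓ` at infinity. -/
structure IsOuter (f : ℂ → ℂ) (R₀ : ℝ) (ℓ : ℂ) : Prop where
  differentiableAt : ∀ z : ℂ, z.im ≠ 0 → R₀ < ‖z‖ → DifferentiableAt ℂ f z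
  upper : ∀ x : ℝ, R₀ < |x| → ∃ u, Tendsto f (𝓝[{z | 0 < z.im}] (x : ℂ)) (𝓝 u)
  lower : ∀ x : ℝ, R₀ < |x| → ∃ u, Tendsto f (𝓝[{z | z.im < 0}] (x : ℂ)) (𝓝 u)
  tendsto : Tendsto f (cocompact ℂ ⊓ 𝓟 SPData.offReal) (𝓝 ℓ)

/-- The limiting values of `f` from above and from below at the real points `x` with `|x| ≥ ρ`
differ by at most `ε / |x| ^ p`. -/
def JumpLE (f : ℂ → ℂ) (ρ ε : ℝ) (p : ℕ) : Prop :=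
  ∀ x : ℝ, ρ ≤ |x| → ∀ u l : ℂ, Tendsto f (𝓝[{z | 0 < z.im}] (x : ℂ)) (𝓝 u) →
    Tendsto f (𝓝[{z | z.im < 0}] (x : ℂ)) (𝓝 l) → ‖u - l‖ ≤ ε / |x| ^ p

instance nhdsWithin_upper_neBot (x : ℝ) : (𝓝[{z : ℂ | 0 < z.im}] (x : ℂ)).NeBot := by
  rw [← mem_closure_iff_nhdsWithin_neBot]
  exact closure_mono (fun z hz => hz.1) (subset_closure_upper_outer (-1)
    ⟨by simp, by linarith [norm_nonneg (x : ℂ)]⟩)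

theorem tendsto_neg_upper (x : ℝ) :
    Tendsto (fun z : ℂ => -z) (𝓝[{z | 0 < z.im}] (x : ℂ)) (𝓝[{z | z.im < 0}] ((-x : ℝ) : ℂ)) := by
  refine tendsto_nhdsWithin_iff.2 ⟨(Continuous.tendsto' (by fun_prop) _ _ (by simp)).mono_left
    nhdsWithin_le_nhds, ?_⟩
  filter_upwards [self_mem_nhdsWithin] with z hz
  simpa using hz

theorem tendsto_neg_lower (x : ℝ) :
    Tendsto (fun z : ℂ => -z) (𝓝[{z | z.im < 0}] (x : ℂ)) (𝓝[{z | 0 < z.im}] ((-x : ℝ) : ℂ)) := by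
  refine tendsto_nhdsWithin_iff.2 ⟨(Continuous.tendsto' (by fun_prop) _ _ (by simp)).mono_left
    nhdsWithin_le_nhds, ?_⟩
  filter_upwards [self_mem_nhdsWithin] with z hz
  simpa using hz

instance nhdsWithin_lower_neBot (x : ℝ) : (𝓝[{z : ℂ | z.im < 0}] (x : ℂ)).NeBot := by
  have := (tendsto_neg_upper (-x)).neBot
  simpa using this

open Complex Set in
/-- **Contour deformation to infinity.** The mean of `f` over a circle differs from the value of
`f` at infinity by an integral of the jump of `f` over the real axis outside the circle. -/
theorem IsOuter.norm_integral_circle_sub_le {f : ℂ → ℂ} {R₀ : ℝ} {ℓ : ℂ} (hf : IsOuter f R₀ ℓ)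
    (hR₀ : 0 ≤ R₀) {ρ ε : ℝ} {p : ℕ} (hp : 1 ≤ p) (hρ : R₀ < ρ) (hε : 0 ≤ ε)
    (hj : JumpLE f ρ ε p) :
    IntervalIntegrable (fun θ => f (circleMap 0 ρ θ)) MeasureTheory.volume 0 (2 * Real.pi) ∧
    ‖(∫ θ in (0)..(2 * Real.pi), f (circleMap 0 ρ θ)) - 2 * Real.pi * ℓ‖ ≤ 2 * ε / ρ ^ p := by
  have hρ0 : 0 < ρ := hR₀.trans_lt hρ
  have hpi := Real.pi_pos
  have hu : ∀ x : ℝ, ∃ u, R₀ < |x| → Tendsto f (𝓝[{z | 0 < z.im}] (x : ℂ)) (𝓝 u) := fun x => by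
    by_cases h : R₀ < |x|
    · exact (hf.upper x h).imp fun _ h _ => h
    · exact ⟨0, fun h' => absurd h' h⟩
  have hl : ∀ x : ℝ, ∃ u, R₀ < |x| → Tendsto f (𝓝[{z | z.im < 0}] (x : ℂ)) (𝓝 u) := fun x => by
    by_cases h : R₀ < |x|
    · exact (hf.lower x h).imp fun _ h _ => h
    · exact ⟨0, fun h' => absurd h' h⟩
  choose u hu using hu
  choose l hl using hl
  set g : ℂ → ℂ := fun z => f (-z) with hg
  have hgd : ∀ z : ℂ, 0 < z.im → R₀ < ‖z‖ → DifferentiableAt ℂ g z := fun z h1 h2 =>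
    (hf.differentiableAt (-z) (by simpa using h1.ne') (by simpa using h2)).comp z
      differentiableAt_id.neg
  have hgU : ∀ x : ℝ, R₀ < |x| → Tendsto g (𝓝[{z | 0 < z.im}] (x : ℂ)) (𝓝 (l (-x))) :=
    fun x hx => (hl (-x) (by simpa using hx)).comp (tendsto_neg_upper x)
  have hfd : ∀ z : ℂ, 0 < z.im → R₀ < ‖z‖ → DifferentiableAt ℂ f z := fun z h1 h2 =>
    hf.differentiableAt z h1.ne' h2
  have hsplit : ∀ r : ℝ, (fun θ => f (circleMap 0 r (θ + Real.pi))) =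
      fun θ => g (circleMap 0 r θ) := fun r => by
    ext θ; rw [circleMap_zero_add_pi]
  -- the circle as a union of two semicircles
  have hcirc : ∀ r : ℝ, R₀ < r →
      IntervalIntegrable (fun θ => f (circleMap 0 r θ)) MeasureTheory.volume 0 (2 * Real.pi) ∧
      (∫ θ in (0)..(2 * Real.pi), f (circleMap 0 r θ)) =
        (∫ θ in (0)..Real.pi, f (circleMap 0 r θ)) + ∫ θ in (0)..Real.pi, g (circleMap 0 r θ) := by
    intro r hr
    have hr' : R₀ < Real.exp (Real.log r) := by rwa [Real.exp_log (hR₀.trans_lt hr)]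
    have i1 := (integral_semicircle_sub hfd hu hr' le_rfl).1
    have i2 := (integral_semicircle_sub hgd hgU hr' le_rfl).1
    rw [Real.exp_log (hR₀.trans_lt hr)] at i1 i2
    have i3 : IntervalIntegrable (fun θ => f (circleMap 0 r θ)) MeasureTheory.volume
        Real.pi (2 * Real.pi) := by
      rw [← hsplit] at i2
      have := i2.comp_sub_right Real.pi
      simpa [two_mul] using this
    refine ⟨i1.trans i3, ?_⟩
    rw [← intervalIntegral.integral_add_adjacent_intervals i1 i3, ← hsplit,
      intervalIntegral.integral_comp_add_right (fun θ => f (circleMap 0 r θ))]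
    simp [two_mul]
  refine ⟨(hcirc ρ hρ).1, le_of_forall_pos_le_add fun η hη => ?_⟩
  -- a large circle, on which `f` is close to `ℓ`
  obtain ⟨r, hρr, hr⟩ : ∃ r, ρ ≤ r ∧ ∀ z : ℂ, z.im ≠ 0 → ‖z‖ = r →
      ‖f z - ℓ‖ ≤ η / (2 * Real.pi) := by
    have h1 := (Metric.tendsto_nhds.1 hf.tendsto) (η / (2 * Real.pi)) (by positivity)
    rw [eventually_inf_principal, ← Metric.cobounded_eq_cocompact,
      ← comap_norm_atTop, eventually_comap] at h1
    obtain ⟨r, h2, h3⟩ := (h1.and (eventually_ge_atTop ρ)).exists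
    exact ⟨r, h3, fun z h4 h5 => by simpa [dist_eq_norm] using (h2 z h5 h4).le⟩
  have hr0 : 0 < r := hρ0.trans_le hρr
  have hbig : ‖(∫ θ in (0)..(2 * Real.pi), f (circleMap 0 r θ)) - 2 * Real.pi * ℓ‖ ≤ η := by
    have h1 : (∫ θ in (0)..(2 * Real.pi), f (circleMap 0 r θ)) - 2 * Real.pi * ℓ =
        ∫ θ in (0)..(2 * Real.pi), (f (circleMap 0 r θ) - ℓ) := by
      rw [intervalIntegral.integral_sub (hcirc r (hρ.trans_le hρr)).1 (by simp)]
      simp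
    rw [h1]
    have h2 := intervalIntegral.norm_integral_le_of_norm_le_const_ae (a := 0) (b := 2 * Real.pi)
      (C := η / (2 * Real.pi)) (f := fun θ => f (circleMap 0 r θ) - ℓ) ?_
    · refine h2.trans_eq ?_
      rw [sub_zero, abs_of_pos (by positivity)]
      field_simp
    · filter_upwards [MeasureTheory.Measure.ae_ne MeasureTheory.volume Real.pi,
        MeasureTheory.Measure.ae_ne MeasureTheory.volume (2 * Real.pi)] with θ h3 h4 h5
      rw [uIoc_of_le (by positivity)] at h5
      refine hr _ ?_ (by simp [abs_of_pos hr0])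
      rw [circleMap_zero_im]
      refine mul_ne_zero hr0.ne' ?_
      rcases lt_or_gt_of_ne h3 with h | h
      · exact (Real.sin_pos_of_pos_of_lt_pi h5.1 h).ne'
      · have : 0 < Real.sin (θ - Real.pi) := Real.sin_pos_of_pos_of_lt_pi (by linarith)
          (by have := lt_of_le_of_ne h5.2 h4; linarith)
        rw [Real.sin_sub_pi] at this
        exact (neg_pos.1 this).ne
  -- the two annuli
  have hA : R₀ < Real.exp (Real.log ρ) := by rwa [Real.exp_log hρ0]
  have hAB : Real.log ρ ≤ Real.log r := Real.log_le_log hρ0 hρr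
  obtain ⟨-, j1, j2, e1⟩ := integral_semicircle_sub hfd hu hA hAB
  obtain ⟨-, j3, j4, e2⟩ := integral_semicircle_sub hgd hgU hA hAB
  rw [Real.exp_log hρ0, Real.exp_log hr0] at e1 e2
  simp only [neg_neg] at j4 e2
  set a := Real.log ρ with ha
  set b := Real.log r with hb
  have hp0 : (0 : ℝ) < p := by exact_mod_cast hp
  have hdiff : ∀ x : ℝ, ρ ≤ |x| → ‖u x - l x‖ ≤ ε / |x| ^ p := fun x hx =>
    hj x hx _ _ (hu x (hρ.trans_le hx)) (hl x (hρ.trans_le hx))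
  have hseg : ‖∫ s in a..b, ((u (Real.exp s) - l (Real.exp s)) -
      (u (-Real.exp s) - l (-Real.exp s)))‖ ≤ 2 * ε / ρ ^ p := by
    have hexp : ∀ s : ℝ, HasDerivAt (fun s : ℝ => -(2 * ε / p) * Real.exp (-p * s))
        (2 * ε * Real.exp (-p * s)) s := fun s => by
      have := (((hasDerivAt_id s).const_mul (-(p : ℝ))).exp).const_mul (-(2 * ε / p))
      refine this.congr_deriv ?_
      simp only [id, mul_one]
      field_simp
    have hint : IntervalIntegrable (fun s => 2 * ε * Real.exp (-p * s)) MeasureTheory.volume a b :=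
      Continuous.intervalIntegrable (by fun_prop) _ _
    have h1 : ∫ s in a..b, 2 * ε * Real.exp (-p * s) ≤ 2 * ε / ρ ^ p := by
      rw [intervalIntegral.integral_eq_sub_of_hasDerivAt (fun s _ => hexp s) hint]
      have h2 : Real.exp (-p * a) = (ρ ^ p)⁻¹ := by
        rw [neg_mul, Real.exp_neg, ← Real.exp_log (pow_pos hρ0 p), Real.log_pow]
      have h3 : 0 ≤ 2 * ε / p * Real.exp (-p * b) := by positivity
      have h4 : 2 * ε / p * (ρ ^ p)⁻¹ ≤ 2 * ε * (ρ ^ p)⁻¹ := by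
        refine mul_le_mul_of_nonneg_right (div_le_self (by positivity) ?_) (by positivity)
        exact_mod_cast hp
      rw [h2, div_eq_mul_inv (2 * ε) (ρ ^ p)]
      linarith
    refine le_trans ?_ h1
    refine intervalIntegral.norm_integral_le_of_norm_le hAB ?_ hint
    refine Eventually.of_forall fun s hs => ?_
    have hsρ : ρ ≤ Real.exp s := by
      rw [← Real.exp_log hρ0]; exact Real.exp_le_exp.2 hs.1.le
    have hpow : Real.exp (-p * s) = (Real.exp s ^ p)⁻¹ := by
      rw [neg_mul, Real.exp_neg, Real.exp_nat_mul]
    have h2 := hdiff (Real.exp s) (by rwa [abs_of_pos (Real.exp_pos s)])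
    have h3 := hdiff (-Real.exp s) (by rwa [abs_neg, abs_of_pos (Real.exp_pos s)])
    rw [abs_neg] at h3
    rw [abs_of_pos (Real.exp_pos s)] at h2 h3
    refine (norm_sub_le _ _).trans ?_
    rw [hpow, mul_assoc, ← div_eq_mul_inv]
    linarith
  have hkey : (∫ θ in (0)..(2 * Real.pi), f (circleMap 0 ρ θ)) =
      (∫ θ in (0)..(2 * Real.pi), f (circleMap 0 r θ)) -
        I * ∫ s in a..b, ((u (Real.exp s) - l (Real.exp s)) -
          (u (-Real.exp s) - l (-Real.exp s))) := by
    rw [(hcirc ρ hρ).2, (hcirc r (hρ.trans_le hρr)).2,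
      intervalIntegral.integral_sub (j1.sub j4) (j2.sub j3),
      intervalIntegral.integral_sub j1 j4, intervalIntegral.integral_sub j2 j3]
    linear_combination -e1 - e2
  rw [hkey, sub_right_comm]
  refine (norm_sub_le _ _).trans ?_
  rw [norm_mul, norm_I, one_mul]
  linarith

/-! ### The Phragmén–Lindelöf principle and mean values -/

open Complex in
/-- **Phragmén–Lindelöf** for an entire function of exponential type `a`, bounded by `1` on the real
axis. -/
theorem norm_le_exp_of_norm_le_one_on_real {G : ℂ → ℂ} (hG : Differentiable ℂ G) {a C R : ℝ}
    (hreal : ∀ x : ℝ, ‖G x‖ ≤ 1)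
    (hbd : ∀ z : ℂ, z.im ≠ 0 → R ≤ ‖z‖ → ‖G z‖ ≤ C * Real.exp (a * |z.im|)) (z : ℂ) :
    ‖G z‖ ≤ Real.exp (a * |z.im|) := by
  -- the upper half-plane, rotated onto the right half-plane
  have upper : ∀ H : ℂ → ℂ, Differentiable ℂ H → (∀ x : ℝ, ‖H x‖ ≤ 1) →
      (∀ z : ℂ, z.im ≠ 0 → R ≤ ‖z‖ → ‖H z‖ ≤ C * Real.exp (a * |z.im|)) →
      ∀ z : ℂ, 0 ≤ z.im → ‖H z‖ ≤ Real.exp (a * |z.im|) := by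
    intro H hH hr hb z hz
    set f : ℂ → ℂ := fun w => H (I * w) * exp (-a * w) with hf
    have hnorm : ∀ w : ℂ, ‖f w‖ = ‖H (I * w)‖ * Real.exp (-(a * w.re)) := fun w => by
      simp [hf, norm_exp]
    have hfb : ∀ w : ℂ, 0 < w.re → R ≤ ‖w‖ → ‖f w‖ ≤ C := by
      intro w hw hwR
      have h1 := hb (I * w) (by simpa using hw.ne') (by simpa using hwR)
      simp only [mul_im, I_re, zero_mul, I_im, one_mul, zero_add, abs_of_pos hw] at h1
      calc ‖f w‖ = ‖H (I * w)‖ * Real.exp (-(a * w.re)) := hnorm w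
        _ ≤ C * Real.exp (a * w.re) * Real.exp (-(a * w.re)) := by gcongr
        _ = C := by rw [mul_assoc, ← Real.exp_add]; simp
    have hfd : Differentiable ℂ f := by
      have : Differentiable ℂ fun w : ℂ => H (I * w) := hH.comp (by fun_prop)
      exact this.mul (by fun_prop)
    have key := PhragmenLindelof.right_half_plane_of_bounded_on_real (f := f) (C := 1)
      hfd.diffContOnCl ⟨1, by norm_num, 0, ?_⟩ ⟨C, ?_⟩ ?_ (z := -I * z) (by simpa using hz)
    · rw [hnorm] at key
      have h1 : I * (-I * z) = z := by rw [← mul_assoc]; simp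
      have h2 : (-I * z).re = z.im := by simp
      rw [h1, h2, Real.exp_neg, ← div_eq_mul_inv, div_le_one (Real.exp_pos _)] at key
      rwa [abs_of_nonneg hz]
    · simp only [zero_mul, Real.exp_zero]
      refine Asymptotics.IsBigO.of_bound C ?_
      rw [eventually_inf_principal]
      have h1 : ∀ᶠ w : ℂ in Bornology.cobounded ℂ, R ≤ ‖w‖ :=
        tendsto_norm_cobounded_atTop.eventually_ge_atTop R
      filter_upwards [h1] with w h2 h3
      simpa using hfb w h3 h2
    · rw [eventually_map]
      filter_upwards [eventually_ge_atTop R, eventually_gt_atTop 0] with x hx hx0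
      exact hfb x (by simpa using hx0) (by simpa [abs_of_pos hx0] using hx)
    · intro x
      rw [hnorm]
      have h1 : I * (x * I) = ((-x : ℝ) : ℂ) := by
        rw [mul_comm, mul_assoc, I_mul_I]; simp
      rw [h1]
      simpa using hr (-x)
  rcases le_total 0 z.im with h | h
  · exact upper G hG hreal hbd z h
  · have := upper (fun z => G (-z)) (hG.comp differentiable_neg)
      (fun x => by simpa using hreal (-x))
      (fun z h1 h2 => by simpa using hbd (-z) (by simpa using h1) (by simpa using h2)) (-z)
      (by simpa using h)
    simpa using this

open Complex Set in
/-- An entire function that is close, on a circle, to a function with a small jump across the real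
axis is at the centre close to the value of that function at infinity. -/
theorem norm_apply_zero_sub_le {w k : ℂ → ℂ} {R₀ ρ ε δ : ℝ} {ℓ : ℂ} {p : ℕ}
    (hw : Differentiable ℂ w) (hk : IsOuter k R₀ ℓ) (hR₀ : 0 ≤ R₀) (hp : 1 ≤ p) (hρ : R₀ < ρ)
    (hε : 0 ≤ ε) (hj : JumpLE k ρ ε p)
    (hδ : ∀ z : ℂ, z.im ≠ 0 → ‖z‖ = ρ → ‖w z - k z‖ ≤ δ) :
    ‖w 0 - ℓ‖ ≤ δ + ε / ρ ^ p := by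
  have hρ0 : 0 < ρ := hR₀.trans_lt hρ
  have hpi := Real.pi_gt_three
  obtain ⟨hint, hle⟩ := hk.norm_integral_circle_sub_le hR₀ hp hρ hε hj
  have hwint : IntervalIntegrable (fun θ => w (circleMap 0 ρ θ)) MeasureTheory.volume
      0 (2 * Real.pi) :=
    (hw.continuous.comp (continuous_circleMap 0 ρ)).intervalIntegrable _ _
  have hmean : (∫ θ in (0)..(2 * Real.pi), w (circleMap 0 ρ θ)) = 2 * Real.pi * w 0 := by
    have h1 := DiffContOnCl.circleAverage (c := 0) (R := ρ) (f := w) hw.diffContOnCl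
    rw [Real.circleAverage_def] at h1
    rw [← h1, Complex.real_smul]
    push_cast
    field_simp
  have hdiff : ‖∫ θ in (0)..(2 * Real.pi), (w (circleMap 0 ρ θ) - k (circleMap 0 ρ θ))‖ ≤
      δ * (2 * Real.pi) := by
    have h2 := intervalIntegral.norm_integral_le_of_norm_le_const_ae (a := 0) (b := 2 * Real.pi)
      (C := δ) (f := fun θ => w (circleMap 0 ρ θ) - k (circleMap 0 ρ θ)) ?_
    · rwa [sub_zero, abs_of_pos (by positivity)] at h2
    · filter_upwards [MeasureTheory.Measure.ae_ne MeasureTheory.volume Real.pi,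
        MeasureTheory.Measure.ae_ne MeasureTheory.volume (2 * Real.pi)] with θ h3 h4 h5
      rw [uIoc_of_le (by positivity)] at h5
      refine hδ _ ?_ (by simp [abs_of_pos hρ0])
      rw [circleMap_zero_im]
      refine mul_ne_zero hρ0.ne' ?_
      rcases lt_or_gt_of_ne h3 with h | h
      · exact (Real.sin_pos_of_pos_of_lt_pi h5.1 h).ne'
      · have : 0 < Real.sin (θ - Real.pi) := Real.sin_pos_of_pos_of_lt_pi (by linarith)
          (by have := lt_of_le_of_ne h5.2 h4; linarith)
        rw [Real.sin_sub_pi] at this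
        exact (neg_pos.1 this).ne
  rw [intervalIntegral.integral_sub hwint hint, hmean] at hdiff
  have h1 : ‖2 * Real.pi * (w 0 - ℓ)‖ ≤ δ * (2 * Real.pi) + 2 * ε / ρ ^ p := by
    refine le_trans ?_ (add_le_add hdiff hle)
    refine le_trans (le_of_eq ?_) (norm_add_le _ _)
    congr 1; ring
  rw [norm_mul, norm_mul, Complex.norm_ofNat, Complex.norm_real, Real.norm_eq_abs,
    abs_of_pos Real.pi_pos] at h1
  have h2 : 0 ≤ ε / ρ ^ p := by positivity
  rw [mul_div_assoc] at h1
  nlinarith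

theorem IsOuter.mul_add {a g h : ℂ → ℂ} {R₀ : ℝ} {ℓ γ η : ℂ} (ha : IsOuter a R₀ ℓ) (hR₀ : 0 ≤ R₀)
    (hg : ∀ z ≠ 0, DifferentiableAt ℂ g z) (hh : ∀ z ≠ 0, DifferentiableAt ℂ h z)
    (hgl : Tendsto g (cocompact ℂ) (𝓝 γ)) (hhl : Tendsto h (cocompact ℂ) (𝓝 η)) :
    IsOuter (fun z => a z * g z + h z) R₀ (ℓ * γ + η) := by
  have h0 : ∀ x : ℝ, R₀ < |x| → (x : ℂ) ≠ 0 := fun x hx h => by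
    simp only [Complex.ofReal_eq_zero] at h
    rw [h, abs_zero] at hx
    linarith
  refine ⟨fun z h1 h2 => ?_, fun x hx => ?_, fun x hx => ?_, ?_⟩
  · have hz : z ≠ 0 := by rintro rfl; simp at h1
    exact ((ha.differentiableAt z h1 h2).mul (hg z hz)).add (hh z hz)
  · obtain ⟨u, hu⟩ := ha.upper x hx
    exact ⟨_, (hu.mul ((hg _ (h0 x hx)).continuousAt.tendsto.mono_left nhdsWithin_le_nhds)).add
      ((hh _ (h0 x hx)).continuousAt.tendsto.mono_left nhdsWithin_le_nhds)⟩
  · obtain ⟨u, hu⟩ := ha.lower x hx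
    exact ⟨_, (hu.mul ((hg _ (h0 x hx)).continuousAt.tendsto.mono_left nhdsWithin_le_nhds)).add
      ((hh _ (h0 x hx)).continuousAt.tendsto.mono_left nhdsWithin_le_nhds)⟩
  · exact (ha.tendsto.mul (hgl.mono_left inf_le_left)).add (hhl.mono_left inf_le_left)

theorem IsOuter.jumpLE_mul_add {a g h : ℂ → ℂ} {R₀ ρ ε C : ℝ} {ℓ : ℂ} {p q r : ℕ}
    (ha : IsOuter a R₀ ℓ) (hR₀ : 0 ≤ R₀) (hρ : R₀ < ρ) (hε : 0 ≤ ε) (hr : p + q = r)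
    (hg : ∀ z ≠ 0, DifferentiableAt ℂ g z) (hh : ∀ z ≠ 0, DifferentiableAt ℂ h z)
    (hj : JumpLE a ρ ε p) (hgC : ∀ x : ℝ, ρ ≤ |x| → ‖g x‖ ≤ C / |x| ^ q) :
    JumpLE (fun z => a z * g z + h z) ρ (ε * C) r := by
  intro x hx u l hu hl
  have h0 : (x : ℂ) ≠ 0 := fun h => by
    simp only [Complex.ofReal_eq_zero] at h
    rw [h, abs_zero] at hx
    linarith
  obtain ⟨u', hu'⟩ := ha.upper x (hρ.trans_le hx)
  obtain ⟨l', hl'⟩ := ha.lower x (hρ.trans_le hx)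
  have e1 := tendsto_nhds_unique hu ((hu'.mul ((hg _ h0).continuousAt.tendsto.mono_left
    nhdsWithin_le_nhds)).add ((hh _ h0).continuousAt.tendsto.mono_left nhdsWithin_le_nhds))
  have e2 := tendsto_nhds_unique hl ((hl'.mul ((hg _ h0).continuousAt.tendsto.mono_left
    nhdsWithin_le_nhds)).add ((hh _ h0).continuousAt.tendsto.mono_left nhdsWithin_le_nhds))
  have e3 : u - l = (u' - l') * g x := by rw [e1, e2]; ring
  have hx0 : 0 < |x| := (hR₀.trans_lt hρ).trans_le hx
  rw [e3, norm_mul, ← hr, pow_add, ← div_mul_div_comm]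
  exact mul_le_mul (hj x hx u' l' hu' hl') (hgC x hx) (norm_nonneg _) (by positivity)

/-- A function within `η / |z| ^ p` of a continuous function has a jump of at most
`2 η / |z| ^ p`. -/
theorem jumpLE_of_norm_sub_mul_pow_le {f g : ℂ → ℂ} {R ρ η : ℝ} {p : ℕ} (hR : 0 ≤ R) (hρ : R < ρ)
    (hg : ∀ z ≠ 0, ContinuousAt g z)
    (h : ∀ z : ℂ, z.im ≠ 0 → R ≤ ‖z‖ → ‖(f z - g z) * z ^ p‖ ≤ η) : JumpLE f ρ (2 * η) p := by
  intro x hx u l hu hl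
  have hx0 : 0 < |x| := (hR.trans_lt hρ).trans_le hx
  have h0 : (x : ℂ) ≠ 0 := by simpa using hx0
  have key : ∀ (s : Set ℂ) (v : ℂ), (∀ z ∈ s, z.im ≠ 0) → (𝓝[s] (x : ℂ)).NeBot →
      Tendsto f (𝓝[s] (x : ℂ)) (𝓝 v) → ‖v - g x‖ ≤ η / |x| ^ p := by
    intro s v hs hne hv
    have h1 : Tendsto (fun z => ‖(f z - g z) * z ^ p‖) (𝓝[s] (x : ℂ))
        (𝓝 ‖(v - g x) * (x : ℂ) ^ p‖) :=
      ((hv.sub ((hg _ h0).tendsto.mono_left nhdsWithin_le_nhds)).mul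
        (((continuous_pow p).tendsto (x : ℂ)).mono_left nhdsWithin_le_nhds)).norm
    have h2 : ∀ᶠ z in 𝓝[s] (x : ℂ), ‖(f z - g z) * z ^ p‖ ≤ η := by
      have h3 : ∀ᶠ z in 𝓝[s] (x : ℂ), R < ‖z‖ :=
        (continuous_norm.tendsto (x : ℂ)).mono_left nhdsWithin_le_nhds |>.eventually
          (lt_mem_nhds (by simpa using hρ.trans_le hx))
      filter_upwards [h3, self_mem_nhdsWithin] with z hz hzs using h z (hs z hzs) hz.le
    have h4 := le_of_tendsto h1 h2
    rw [norm_mul, norm_pow, Complex.norm_real, Real.norm_eq_abs] at h4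
    rwa [le_div_iff₀ (by positivity)]
  have k1 := key _ u (fun z hz => (ne_of_gt hz : z.im ≠ 0)) (nhdsWithin_upper_neBot x) hu
  have k2 := key _ l (fun z hz => (ne_of_lt hz : z.im ≠ 0)) (nhdsWithin_lower_neBot x) hl
  calc ‖u - l‖ = ‖(u - g x) - (l - g x)‖ := by congr 1; ring
    _ ≤ η / |x| ^ p + η / |x| ^ p := (norm_sub_le _ _).trans (add_le_add k1 k2)
    _ = 2 * η / |x| ^ p := by ring

theorem exists_forall_of_eventually_offReal {P : ℂ → Prop}
    (h : ∀ᶠ z in cocompact ℂ ⊓ 𝓟 SPData.offReal, P z) :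
    ∃ R > 0, ∀ z : ℂ, z.im ≠ 0 → R ≤ ‖z‖ → P z := by
  rw [eventually_inf_principal, ← Metric.cobounded_eq_cocompact,
    ← comap_norm_atTop, eventually_comap] at h
  obtain ⟨R, h⟩ := eventually_atTop.1 h
  exact ⟨max R 1, by positivity, fun z h1 h2 => h ‖z‖ ((le_max_left _ _).trans h2) z rfl h1⟩

/-! ### Transfer rows and their first-order behaviour -/

/-- A unimodular matrix function off the real axis, outside the disc of radius `R₀`, that tends to
the identity at infinity and has one-sided limits at the real axis. -/
structure IsFrame (N : ℂ → Matrix (Fin 2) (Fin 2) ℂ) (R₀ : ℝ) : Prop where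
  nonneg : 0 ≤ R₀
  outer : ∀ i j, IsOuter (fun z => N z i j) R₀ ((1 : Matrix (Fin 2) (Fin 2) ℂ) i j)
  det : ∀ z : ℂ, z.im ≠ 0 → R₀ < ‖z‖ → N z 0 0 * N z 1 1 - N z 0 1 * N z 1 0 = 1

/-- `(E₀, E₁)` is an entire row of exponential type `|h|` such that the row
`(E₀, E₁) N(z) e^{i z h σ₃}` tends to `(ℓ₀, ℓ₁)` at infinity. The rows of the matrix
`N'(z) e^{-i z h σ₃} N(z)⁻¹`, where `N'` also is normalized at infinity, are of this kind. -/
structure IsTransfer (N : ℂ → Matrix (Fin 2) (Fin 2) ℂ) (h : ℝ) (E₀ E₁ : ℂ → ℂ) (ℓ₀ ℓ₁ : ℂ) :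
    Prop where
  diff₀ : Differentiable ℂ E₀
  diff₁ : Differentiable ℂ E₁
  bound₀ : ∀ z, ‖E₀ z‖ ≤ Real.exp (|h| * |z.im|)
  bound₁ : ∀ z, ‖E₁ z‖ ≤ Real.exp (|h| * |z.im|)
  lim₀ : Tendsto (fun z => (E₀ z * N z 0 0 + E₁ z * N z 1 0) * Complex.exp (Complex.I * z * h))
    (cocompact ℂ ⊓ 𝓟 SPData.offReal) (𝓝 ℓ₀)
  lim₁ : Tendsto (fun z => (E₀ z * N z 0 1 + E₁ z * N z 1 1) * Complex.exp (-(Complex.I * z * h)))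
    (cocompact ℂ ⊓ 𝓟 SPData.offReal) (𝓝 ℓ₁)

/-- The matrix function with rows and columns interchanged. -/
def flipFrame (N : ℂ → Matrix (Fin 2) (Fin 2) ℂ) : ℂ → Matrix (Fin 2) (Fin 2) ℂ :=
  fun z => Matrix.of fun i j => N z i.rev j.rev

theorem one_rev_rev (i j : Fin 2) :
    (1 : Matrix (Fin 2) (Fin 2) ℂ) i.rev j.rev = (1 : Matrix (Fin 2) (Fin 2) ℂ) i j := by
  simp [Matrix.one_apply]

theorem IsFrame.flip {N : ℂ → Matrix (Fin 2) (Fin 2) ℂ} {R₀ : ℝ} (hN : IsFrame N R₀) :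
    IsFrame (flipFrame N) R₀ := by
  refine ⟨hN.nonneg, fun i j => ?_, fun z h1 h2 => ?_⟩
  · rw [← one_rev_rev]; exact hN.outer i.rev j.rev
  · have := hN.det z h1 h2
    simp only [flipFrame, Matrix.of_apply, Fin.rev_zero, Fin.reduceRev, Fin.reduceLast]
    linear_combination this

theorem IsTransfer.flip {N : ℂ → Matrix (Fin 2) (Fin 2) ℂ} {h : ℝ} {E₀ E₁ : ℂ → ℂ} {ℓ₀ ℓ₁ : ℂ}
    (hE : IsTransfer N h E₀ E₁ ℓ₀ ℓ₁) : IsTransfer (flipFrame N) (-h) E₁ E₀ ℓ₁ ℓ₀ := by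
  refine ⟨hE.diff₁, hE.diff₀, by simpa using hE.bound₁, by simpa using hE.bound₀, ?_, ?_⟩
  · refine hE.lim₁.congr fun z => ?_
    simp only [flipFrame, Matrix.of_apply, Fin.rev_zero, Fin.reduceRev, Fin.reduceLast]
    push_cast
    rw [mul_neg]; ring
  · refine hE.lim₀.congr fun z => ?_
    simp only [flipFrame, Matrix.of_apply, Fin.rev_zero, Fin.reduceRev, Fin.reduceLast]
    push_cast
    rw [mul_neg, neg_neg]; ring

/-- The first entry of the row `(E₀, E₁) N(z) e^{i z h σ₃}`. -/
noncomputable def outerRow (N : ℂ → Matrix (Fin 2) (Fin 2) ℂ) (h : ℝ) (E₀ E₁ : ℂ → ℂ) (z : ℂ) : ℂ :=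
  (E₀ z * N z 0 0 + E₁ z * N z 1 0) * Complex.exp (Complex.I * z * h)

theorem outerRow_flip (N : ℂ → Matrix (Fin 2) (Fin 2) ℂ) (h : ℝ) (E₀ E₁ : ℂ → ℂ) (z : ℂ) :
    outerRow (flipFrame N) (-h) E₁ E₀ z =
      (E₀ z * N z 0 1 + E₁ z * N z 1 1) * Complex.exp (-(Complex.I * z * h)) := by
  simp only [outerRow, flipFrame, Matrix.of_apply, Fin.rev_zero, Fin.reduceRev, Fin.reduceLast]
  push_cast
  rw [mul_neg]; ring

section

variable {N : ℂ → Matrix (Fin 2) (Fin 2) ℂ} {R₀ h : ℝ} {E₀ E₁ : ℂ → ℂ} {ℓ₀ ℓ₁ : ℂ}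

theorem tendsto_entire_row {s : Set ℂ} {y n₀ n₁ : ℂ} (h₀ : Differentiable ℂ E₀)
    (h₁ : Differentiable ℂ E₁) (t₀ : Tendsto (fun z => N z 0 0) (𝓝[s] y) (𝓝 n₀))
    (t₁ : Tendsto (fun z => N z 1 0) (𝓝[s] y) (𝓝 n₁)) :
    Tendsto (outerRow N h E₀ E₁) (𝓝[s] y)
      (𝓝 ((E₀ y * n₀ + E₁ y * n₁) * Complex.exp (Complex.I * y * h))) := by
  have c : Continuous fun z : ℂ => Complex.exp (Complex.I * z * h) := by fun_prop
  exact ((((h₀.continuous.tendsto y).mono_left nhdsWithin_le_nhds).mul t₀).add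
    (((h₁.continuous.tendsto y).mono_left nhdsWithin_le_nhds).mul t₁)).mul
    ((c.tendsto y).mono_left nhdsWithin_le_nhds)

theorem IsTransfer.isOuter (hE : IsTransfer N h E₀ E₁ ℓ₀ ℓ₁) (hN : IsFrame N R₀) :
    IsOuter (outerRow N h E₀ E₁) R₀ ℓ₀ := by
  refine ⟨fun z h1 h2 => ?_, fun x hx => ?_, fun x hx => ?_, hE.lim₀⟩
  · have d1 := (hN.outer 0 0).differentiableAt z h1 h2
    have d2 := (hN.outer 1 0).differentiableAt z h1 h2
    exact (((hE.diff₀ z).mul d1).add ((hE.diff₁ z).mul d2)).mul (by fun_prop)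
  · obtain ⟨u, hu⟩ := (hN.outer 0 0).upper x hx
    obtain ⟨v, hv⟩ := (hN.outer 1 0).upper x hx
    exact ⟨_, tendsto_entire_row hE.diff₀ hE.diff₁ hu hv⟩
  · obtain ⟨u, hu⟩ := (hN.outer 0 0).lower x hx
    obtain ⟨v, hv⟩ := (hN.outer 1 0).lower x hx
    exact ⟨_, tendsto_entire_row hE.diff₀ hE.diff₁ hu hv⟩

/-- The jump of `(E₀, E₁) N e^{i z h σ₃}` is bounded by that of `N`, uniformly in `h` and `E`,
because `E` is bounded by `1` on the real axis. -/
theorem IsTransfer.jumpLE (hE : IsTransfer N h E₀ E₁ ℓ₀ ℓ₁) (hN : IsFrame N R₀) {ρ ε : ℝ} {p : ℕ}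
    (hρ : R₀ < ρ) (h0 : JumpLE (fun z => N z 0 0) ρ ε p) (h1 : JumpLE (fun z => N z 1 0) ρ ε p) :
    JumpLE (outerRow N h E₀ E₁) ρ (2 * ε) p := by
  intro x hx u l hu hl
  obtain ⟨u0, hu0⟩ := (hN.outer 0 0).upper x (hρ.trans_le hx)
  obtain ⟨u1, hu1⟩ := (hN.outer 1 0).upper x (hρ.trans_le hx)
  obtain ⟨l0, hl0⟩ := (hN.outer 0 0).lower x (hρ.trans_le hx)
  obtain ⟨l1, hl1⟩ := (hN.outer 1 0).lower x (hρ.trans_le hx)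
  have e1 := tendsto_nhds_unique hu (tendsto_entire_row hE.diff₀ hE.diff₁ hu0 hu1)
  have e2 := tendsto_nhds_unique hl (tendsto_entire_row hE.diff₀ hE.diff₁ hl0 hl1)
  have e3 : u - l = (E₀ x * (u0 - l0) + E₁ x * (u1 - l1)) * Complex.exp (Complex.I * x * h) := by
    rw [e1, e2]; ring
  have b0 := hE.bound₀ x
  have b1 := hE.bound₁ x
  simp only [Complex.ofReal_im, abs_zero, mul_zero, Real.exp_zero] at b0 b1
  have j0 := h0 x hx u0 l0 hu0 hl0
  have j1 := h1 x hx u1 l1 hu1 hl1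
  have e4 : ‖Complex.exp (Complex.I * x * h)‖ = 1 := by simp [Complex.norm_exp]
  rw [e3, norm_mul, e4, mul_one]
  refine (norm_add_le _ _).trans ?_
  rw [norm_mul, norm_mul]
  have k0 : ‖E₀ x‖ * ‖u0 - l0‖ ≤ ‖u0 - l0‖ := mul_le_of_le_one_left (norm_nonneg _) b0
  have k1 : ‖E₁ x‖ * ‖u1 - l1‖ ≤ ‖u1 - l1‖ := mul_le_of_le_one_left (norm_nonneg _) b1
  rw [mul_div_assoc]
  linarith

theorem exp_one_le_three : Real.exp 1 ≤ 3 := by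
  have := Real.exp_one_lt_d9
  linarith

theorem norm_exp_I_mul_le {z : ℂ} (hz : |h| * ‖z‖ ≤ 1) :
    ‖Complex.exp (Complex.I * z * h)‖ ≤ 3 ∧ ‖Complex.exp (-(Complex.I * z * h))‖ ≤ 3 := by
  have h1 : |z.im * h| ≤ 1 := by
    rw [abs_mul, mul_comm]
    exact (mul_le_mul_of_nonneg_left (Complex.abs_im_le_norm z) (abs_nonneg h)).trans hz
  obtain ⟨h2, h3⟩ := abs_le.1 h1
  constructor <;> rw [Complex.norm_exp] <;>
    exact (Real.exp_le_exp.2 (by simp; linarith)).trans exp_one_le_three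

/-- On the disc `|z| ≤ 1 / |h|` the entire row is bounded independently of `h`. -/
theorem IsTransfer.norm_le (hE : IsTransfer N h E₀ E₁ ℓ₀ ℓ₁) {z : ℂ} (hz : |h| * ‖z‖ ≤ 1) :
    ‖E₀ z‖ ≤ 3 ∧ ‖E₁ z‖ ≤ 3 := by
  have h1 : |h| * |z.im| ≤ 1 :=
    (mul_le_mul_of_nonneg_left (Complex.abs_im_le_norm z) (abs_nonneg h)).trans hz
  have h2 := (Real.exp_le_exp.2 h1).trans exp_one_le_three
  exact ⟨(hE.bound₀ z).trans h2, (hE.bound₁ z).trans h2⟩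

theorem IsTransfer.norm_outerRow_le (hE : IsTransfer N h E₀ E₁ ℓ₀ ℓ₁) {z : ℂ} (hz : |h| * ‖z‖ ≤ 1)
    (hN : ∀ i j, ‖N z i j - (1 : Matrix (Fin 2) (Fin 2) ℂ) i j‖ ≤ 1) :
    ‖outerRow N h E₀ E₁ z‖ ≤ 27 := by
  obtain ⟨b0, b1⟩ := hE.norm_le hz
  have n0 : ‖N z 0 0‖ ≤ 2 := by
    have h1 := hN 0 0
    have h2 := norm_le_norm_sub_add (N z 0 0) 1
    simp only [Matrix.one_apply_eq] at h1
    rw [norm_one] at h2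
    linarith
  have n1 : ‖N z 1 0‖ ≤ 1 := by simpa using hN 1 0
  have e := (norm_exp_I_mul_le hz).1
  rw [outerRow, norm_mul]
  have : ‖E₀ z * N z 0 0 + E₁ z * N z 1 0‖ ≤ 9 := by
    refine (norm_add_le _ _).trans ?_
    rw [norm_mul, norm_mul]
    have := mul_le_mul b0 n0 (norm_nonneg _) (by norm_num)
    have := mul_le_mul b1 n1 (norm_nonneg _) (by norm_num)
    linarith
  calc _ ≤ (9 : ℝ) * 3 := mul_le_mul this e (norm_nonneg _) (by norm_num)
    _ = 27 := by norm_num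

/-- Recovering the entire row from the row that is normalized at infinity; `det N = 1`. -/
theorem entire_eq_outerRow (hN : IsFrame N R₀) {z : ℂ} (h1 : z.im ≠ 0) (h2 : R₀ < ‖z‖) :
    E₀ z * Complex.exp (Complex.I * z * h) = outerRow N h E₀ E₁ z * N z 1 1 -
      outerRow (flipFrame N) (-h) E₁ E₀ z * Complex.exp (Complex.I * z * h) ^ 2 * N z 1 0 := by
  have hdet := hN.det z h1 h2
  rw [outerRow_flip, outerRow, Complex.exp_neg]
  have := Complex.exp_ne_zero (Complex.I * z * h)
  field_simp
  linear_combination (-(E₀ z)) * hdet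

/-- If `N` is within `η` of the identity, the entire function `E₀ e^{i z h}` is close to the first
entry of the normalized row. -/
theorem IsTransfer.norm_entire_sub_outerRow_le (hE : IsTransfer N h E₀ E₁ ℓ₀ ℓ₁)
    (hN : IsFrame N R₀) {z : ℂ} (h1 : z.im ≠ 0) (h2 : R₀ < ‖z‖) (hz : |h| * ‖z‖ ≤ 1) {η : ℝ}
    (hη : η ≤ 1) (hNη : ∀ i j, ‖N z i j - (1 : Matrix (Fin 2) (Fin 2) ℂ) i j‖ ≤ η) :
    ‖E₀ z * Complex.exp (Complex.I * z * h) - outerRow N h E₀ E₁ z‖ ≤ 270 * η := by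
  have a0 := hE.norm_outerRow_le hz fun i j => (hNη i j).trans hη
  have a1 := hE.flip.norm_outerRow_le (z := z) (by simpa using hz) fun i j => by
    rw [← one_rev_rev]; exact (hNη i.rev j.rev).trans hη
  have e := (norm_exp_I_mul_le hz).1
  rw [entire_eq_outerRow hN h1 h2]
  have n1 : ‖N z 1 1 - 1‖ ≤ η := by simpa using hNη 1 1
  have n2 : ‖N z 1 0‖ ≤ η := by simpa using hNη 1 0
  have hη0 : 0 ≤ η := (norm_nonneg _).trans n2
  have e2 : ‖Complex.exp (Complex.I * z * h) ^ 2‖ ≤ 9 := by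
    rw [norm_pow]
    calc _ ≤ (3 : ℝ) ^ 2 := pow_le_pow_left₀ (norm_nonneg _) e 2
      _ = 9 := by norm_num
  have k1 : ‖outerRow N h E₀ E₁ z * (N z 1 1 - 1)‖ ≤ 27 * η := by
    rw [norm_mul]; exact mul_le_mul a0 n1 (norm_nonneg _) (by norm_num)
  have k2 : ‖outerRow (flipFrame N) (-h) E₁ E₀ z * Complex.exp (Complex.I * z * h) ^ 2 * N z 1 0‖
      ≤ 27 * 9 * η := by
    rw [norm_mul, norm_mul]
    exact mul_le_mul (mul_le_mul a1 e2 (norm_nonneg _) (by norm_num)) n2 (norm_nonneg _)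
      (by norm_num)
  calc _ = ‖outerRow N h E₀ E₁ z * (N z 1 1 - 1) -
      outerRow (flipFrame N) (-h) E₁ E₀ z * Complex.exp (Complex.I * z * h) ^ 2 * N z 1 0‖ := by
        congr 1; ring
    _ ≤ 270 * η := (norm_sub_le _ _).trans (by linarith)

end

theorem tendsto_abs_inv_atTop : Tendsto (fun h : ℝ => |h|⁻¹) (𝓝[≠] 0) atTop :=
  tendsto_inv_nhdsGT_zero.comp (tendsto_nhdsWithin_iff.2
    ⟨(Continuous.tendsto' (by fun_prop) 0 0 (by simp)).mono_left nhdsWithin_le_nhds, by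
      filter_upwards [self_mem_nhdsWithin] with h hh
      simpa using hh⟩)

theorem tendsto_inv_cocompact : Tendsto (fun z : ℂ => z⁻¹) (cocompact ℂ) (𝓝 0) := by
  rw [← Metric.cobounded_eq_cocompact]
  exact tendsto_inv₀_cobounded

theorem IsFrame.exists_norm_sub_le {N : ℂ → Matrix (Fin 2) (Fin 2) ℂ} {R₀ : ℝ} (hN : IsFrame N R₀)
    {η : ℝ} (hη : 0 < η) : ∃ R > R₀, ∀ z : ℂ, z.im ≠ 0 → R ≤ ‖z‖ →
      ∀ i j, ‖N z i j - (1 : Matrix (Fin 2) (Fin 2) ℂ) i j‖ ≤ η := by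
  have h1 : ∀ᶠ z in cocompact ℂ ⊓ 𝓟 SPData.offReal, ∀ i j,
      ‖N z i j - (1 : Matrix (Fin 2) (Fin 2) ℂ) i j‖ ≤ η := by
    rw [eventually_all]; intro i; rw [eventually_all]; intro j
    filter_upwards [Metric.tendsto_nhds.1 (hN.outer i j).tendsto η hη] with z hz
    simpa [dist_eq_norm] using hz.le
  obtain ⟨R, -, hR⟩ := exists_forall_of_eventually_offReal h1
  exact ⟨max R (R₀ + 1), lt_of_lt_of_le (by linarith) (le_max_right _ _),
    fun z h1 h2 => hR z h1 ((le_max_left _ _).trans h2)⟩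

/-- To first order in `h`, the entire row is a multiple of `e^{-i z h σ₃}` near `z = 0`. -/
theorem IsFrame.eventually_norm_deriv_le {N : ℂ → Matrix (Fin 2) (Fin 2) ℂ} {R₀ : ℝ}
    (hN : IsFrame N R₀) {ε : ℝ} (hε : 0 < ε) : ∀ᶠ h : ℝ in 𝓝[≠] 0, ∀ (E₀ E₁ : ℂ → ℂ) (ℓ₀ ℓ₁ : ℂ),
      IsTransfer N h E₀ E₁ ℓ₀ ℓ₁ → ‖deriv E₀ 0 + Complex.I * h * E₀ 0‖ ≤ ε * |h| := by
  -- `274 = 270 + 4`, for the distance to the normalized row and for its jump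
  set η := min 1 (ε / 274) with hη
  have hη0 : 0 < η := by positivity
  obtain ⟨R, hR, hRη⟩ := hN.exists_norm_sub_le hη0
  filter_upwards [tendsto_abs_inv_atTop.eventually_gt_atTop R, self_mem_nhdsWithin]
    with h hρ hh E₀ E₁ ℓ₀ ℓ₁ hE
  have hh0 : 0 < |h| := abs_pos.2 hh
  -- the largest circle on which the entire row is bounded independently of `h`
  set ρ := |h|⁻¹ with hρd
  have hρ0 : 0 < ρ := inv_pos.2 hh0
  have hR0 : 0 ≤ R := hN.nonneg.trans hR.le
  set w : ℂ → ℂ := fun z => E₀ z * Complex.exp (Complex.I * z * h) with hw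
  have hwd : Differentiable ℂ w := hE.diff₀.mul (by fun_prop)
  have hW : Differentiable ℂ (dslope w 0) := by
    rw [← differentiableOn_univ, Complex.differentiableOn_dslope Filter.univ_mem]
    exact hwd.differentiableOn
  have hinv : ∀ z : ℂ, z ≠ 0 → DifferentiableAt ℂ (fun z : ℂ => z⁻¹) z := fun z hz =>
    differentiableAt_inv hz
  have hcinv : ∀ z : ℂ, z ≠ 0 → DifferentiableAt ℂ (fun z : ℂ => -(w 0) * z⁻¹) z := fun z hz =>
    (hinv z hz).const_mul _
  -- the derivative of `w` at `0` is the value there of the entire function `(w - w 0) / z`, which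
  -- is compared with `(outerRow - w 0) / z`
  have hj : ∀ i j, JumpLE (fun z => N z i j) ρ (2 * η) 0 := fun i j =>
    jumpLE_of_norm_sub_mul_pow_le hR0 hρ (g := fun _ => (1 : Matrix (Fin 2) (Fin 2) ℂ) i j)
      (fun _ _ => continuousAt_const) fun z h1 h2 => by simpa using hRη z h1 h2 i j
  have ha := hE.isOuter hN
  have hja := hE.jumpLE hN (hR.trans hρ) (hj 0 0) (hj 1 0)
  have hk := ha.mul_add hN.nonneg hinv hcinv tendsto_inv_cocompact
    (tendsto_inv_cocompact.const_mul (-(w 0)))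
  have hjk := ha.jumpLE_mul_add (C := 1) (q := 1) hN.nonneg (hR.trans hρ) (by positivity)
    (zero_add 1) hinv hcinv hja fun x _ => by simp
  have key := norm_apply_zero_sub_le (δ := 270 * η / ρ) hW hk hN.nonneg le_rfl (hR.trans hρ)
    (by positivity) hjk ?_
  · rw [dslope_same] at key
    have hd : deriv w 0 = deriv E₀ 0 + Complex.I * h * E₀ 0 := by
      have h1 : HasDerivAt (fun z : ℂ => Complex.exp (Complex.I * z * h))
          (Complex.exp (Complex.I * 0 * h) * (Complex.I * 1 * h)) 0 :=
        (((hasDerivAt_id (0 : ℂ)).const_mul Complex.I).mul_const (h : ℂ)).cexp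
      have h2 := ((hE.diff₀ 0).hasDerivAt.mul h1).deriv
      rw [show w = E₀ * fun z : ℂ => Complex.exp (Complex.I * z * h) from rfl, h2]
      simp; ring
    rw [hd] at key
    simp only [mul_zero, add_zero, sub_zero, pow_one, mul_one] at key
    refine key.trans ?_
    rw [hρd, div_inv_eq_mul, div_inv_eq_mul, ← add_mul]
    refine mul_le_mul_of_nonneg_right ?_ hh0.le
    have := min_le_right 1 (ε / 274)
    rw [← hη] at this
    linarith
  · intro z h1 h2
    have hz : z ≠ 0 := by rintro rfl; simp at h1
    rw [dslope_of_ne _ hz, slope_def_field]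
    have h3 := hE.norm_entire_sub_outerRow_le hN h1 ((hR.trans hρ).trans_eq h2.symm)
      (by rw [h2, hρd, mul_inv_cancel₀ hh0.ne']) (min_le_left _ _)
      (hRη z h1 (hρ.le.trans_eq h2.symm))
    have h4 : (w z - w 0) / (z - 0) - (outerRow N h E₀ E₁ z * z⁻¹ + -(w 0) * z⁻¹) =
        (w z - outerRow N h E₀ E₁ z) / z := by
      rw [sub_zero]; field_simp; ring
    rw [h4, norm_div, h2]
    gcongr

/-- `N` has the asymptotic expansion `I + P / z + o(1 / z)` at infinity. -/
def HasExpansion (N : ℂ → Matrix (Fin 2) (Fin 2) ℂ) (P : Matrix (Fin 2) (Fin 2) ℂ) : Prop :=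
  ∀ i j, Tendsto (fun z => z * (N z i j - (1 : Matrix (Fin 2) (Fin 2) ℂ) i j))
    (cocompact ℂ ⊓ 𝓟 SPData.offReal) (𝓝 (P i j))

theorem HasExpansion.flip {N : ℂ → Matrix (Fin 2) (Fin 2) ℂ} {P : Matrix (Fin 2) (Fin 2) ℂ}
    (hP : HasExpansion N P) : HasExpansion (flipFrame N) (Matrix.of fun i j => P i.rev j.rev) := by
  intro i j
  rw [← one_rev_rev]
  exact hP i.rev j.rev

theorem HasExpansion.exists_norm_sub_le {N : ℂ → Matrix (Fin 2) (Fin 2) ℂ}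
    {P : Matrix (Fin 2) (Fin 2) ℂ} (hP : HasExpansion N P) (R₀ : ℝ) {η : ℝ} (hη : 0 < η) :
    ∃ R > R₀, 1 ≤ R ∧ ∀ z : ℂ, z.im ≠ 0 → R ≤ ‖z‖ →
      ∀ i j, ‖z * (N z i j - (1 : Matrix (Fin 2) (Fin 2) ℂ) i j) - P i j‖ ≤ η := by
  have h1 : ∀ᶠ z in cocompact ℂ ⊓ 𝓟 SPData.offReal, ∀ i j,
      ‖z * (N z i j - (1 : Matrix (Fin 2) (Fin 2) ℂ) i j) - P i j‖ ≤ η := by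
    rw [eventually_all]; intro i; rw [eventually_all]; intro j
    filter_upwards [Metric.tendsto_nhds.1 (hP i j) η hη] with z hz
    simpa [dist_eq_norm] using hz.le
  obtain ⟨R, -, hR⟩ := exists_forall_of_eventually_offReal h1
  exact ⟨max R (max (R₀ + 1) 1), lt_of_lt_of_le (by linarith)
    ((le_max_left (R₀ + 1) 1).trans (le_max_right _ _)), (le_max_right _ _).trans (le_max_right _ _),
    fun z h1 h2 => hR z h1 ((le_max_left _ _).trans h2)⟩

theorem HasExpansion.exists_norm_mul_le {N : ℂ → Matrix (Fin 2) (Fin 2) ℂ}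
    {P : Matrix (Fin 2) (Fin 2) ℂ} (hP : HasExpansion N P) (R₀ : ℝ) :
    ∃ B > 0, ∃ R > R₀, 1 ≤ R ∧ ∀ z : ℂ, z.im ≠ 0 → R ≤ ‖z‖ →
      ∀ i j, ‖N z i j - (1 : Matrix (Fin 2) (Fin 2) ℂ) i j‖ ≤ B / ‖z‖ := by
  obtain ⟨R, h1, h2, h3⟩ := hP.exists_norm_sub_le R₀ one_pos
  refine ⟨1 + ∑ i, ∑ j, ‖P i j‖, by positivity, R, h1, h2, fun z hz hzR i j => ?_⟩
  have hz0 : 0 < ‖z‖ := by linarith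
  rw [le_div_iff₀ hz0, mul_comm, ← norm_mul]
  have h4 := h3 z hz hzR i j
  have h5 : ‖P i j‖ ≤ ∑ i, ∑ j, ‖P i j‖ :=
    (Finset.single_le_sum (f := fun j => ‖P i j‖) (fun _ _ => norm_nonneg _)
      (Finset.mem_univ j)).trans
    (Finset.single_le_sum (f := fun i => ∑ j, ‖P i j‖)
      (fun _ _ => Finset.sum_nonneg fun _ _ => norm_nonneg _) (Finset.mem_univ i))
  have h6 := norm_le_norm_sub_add (z * (N z i j - (1 : Matrix (Fin 2) (Fin 2) ℂ) i j)) (P i j)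
  linarith

/-- If `N = I + O(1 / z)`, the entire row at `z = 0` differs from its normalization at infinity by
`O(h)`. -/
theorem IsFrame.exists_norm_apply_zero_sub_le {N : ℂ → Matrix (Fin 2) (Fin 2) ℂ} {R₀ : ℝ}
    (hN : IsFrame N R₀) {P : Matrix (Fin 2) (Fin 2) ℂ} (hP : HasExpansion N P) :
    ∃ C, ∀ᶠ h : ℝ in 𝓝[≠] 0, ∀ (E₀ E₁ : ℂ → ℂ) (ℓ₀ ℓ₁ : ℂ),
      IsTransfer N h E₀ E₁ ℓ₀ ℓ₁ → ‖E₀ 0 - ℓ₀‖ ≤ C * |h| := by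
  obtain ⟨B, hB, R, hR, hR1, hRB⟩ := hP.exists_norm_mul_le R₀
  refine ⟨274 * B, ?_⟩
  filter_upwards [tendsto_abs_inv_atTop.eventually_gt_atTop R,
    tendsto_abs_inv_atTop.eventually_gt_atTop B, self_mem_nhdsWithin]
    with h hρ hρB hh E₀ E₁ ℓ₀ ℓ₁ hE
  have hh0 : 0 < |h| := abs_pos.2 hh
  set ρ := |h|⁻¹ with hρd
  have hρ0 : 0 < ρ := inv_pos.2 hh0
  have hj : ∀ i j, JumpLE (fun z => N z i j) ρ (2 * B) 1 := fun i j =>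
    jumpLE_of_norm_sub_mul_pow_le (hN.nonneg.trans hR.le) hρ
      (g := fun _ => (1 : Matrix (Fin 2) (Fin 2) ℂ) i j)
      (fun _ _ => continuousAt_const) fun z h1 h2 => by
        rw [pow_one, norm_mul, ← le_div_iff₀ (by linarith)]
        exact hRB z h1 h2 i j
  have hja := hE.jumpLE hN (hR.trans hρ) (hj 0 0) (hj 1 0)
  have key := norm_apply_zero_sub_le (w := fun z => E₀ z * Complex.exp (Complex.I * z * h))
    (δ := 270 * (B / ρ)) (hE.diff₀.mul (by fun_prop)) (hE.isOuter hN) hN.nonneg le_rfl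
    (hR.trans hρ) (by positivity) hja ?_
  · simp only [mul_zero, zero_mul, Complex.exp_zero, mul_one, pow_one] at key
    refine key.trans (le_of_eq ?_)
    rw [hρd]; field_simp; ring
  · intro z h1 h2
    refine hE.norm_entire_sub_outerRow_le hN h1 ((hR.trans hρ).trans_eq h2.symm)
      (by rw [h2, hρd, mul_inv_cancel₀ hh0.ne']) ?_ fun i j => ?_
    · rw [div_le_one hρ0]; exact hρB.le
    · rw [← h2]; exact hRB z h1 (hρ.le.trans_eq h2.symm) i j

/-- If `N = I + P / z + o(1 / z)`, the entire row at `z = 0` is determined to first order in `h` by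
`P` and the normalization at infinity. -/
theorem IsFrame.eventually_norm_apply_zero_sub_le {N : ℂ → Matrix (Fin 2) (Fin 2) ℂ} {R₀ : ℝ}
    (hN : IsFrame N R₀) {P : Matrix (Fin 2) (Fin 2) ℂ} (hP : HasExpansion N P) {ε : ℝ}
    (hε : 0 < ε) (ℓ₀ ℓ₁ : ℂ) : ∀ᶠ h : ℝ in 𝓝[≠] 0, ∀ E₀ E₁ : ℂ → ℂ,
      IsTransfer N h E₀ E₁ ℓ₀ ℓ₁ →
        ‖E₀ 0 - ℓ₀ + 2 * Complex.I * h * P 1 0 * ℓ₁‖ ≤ ε * |h| := by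
  set A := 365 + 4 * (1 + ‖P 1 1‖) + ‖P 1 0‖ with hA
  have hA0 : 0 < A := by positivity
  set η := ε / A with hηd
  have hη : 0 < η := by positivity
  obtain ⟨R, hR, hR1, hRη⟩ := hP.exists_norm_sub_le R₀ hη
  obtain ⟨B, hB, R', hR', -, hRB⟩ := hP.exists_norm_mul_le R₀
  obtain ⟨C, hC⟩ := hN.flip.exists_norm_apply_zero_sub_le hP.flip
  -- `E₁` is the first entry of the flipped row, which goes with the parameter `-h`
  have hneg : Tendsto (fun h : ℝ => -h) (𝓝[≠] 0) (𝓝[≠] 0) :=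
    tendsto_nhdsWithin_iff.2
      ⟨(Continuous.tendsto' (by fun_prop) 0 0 (by simp)).mono_left nhdsWithin_le_nhds, by
        filter_upwards [self_mem_nhdsWithin] with h hh
        simpa using hh⟩
  have hX := hneg.eventually (hN.flip.eventually_norm_deriv_le hη)
  have hC' := hneg.eventually hC
  filter_upwards [tendsto_abs_inv_atTop.eventually_gt_atTop R,
    tendsto_abs_inv_atTop.eventually_gt_atTop R',
    tendsto_abs_inv_atTop.eventually_gt_atTop B,
    tendsto_abs_inv_atTop.eventually_gt_atTop (‖P 1 0‖ * 2430 * B / η),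
    tendsto_abs_inv_atTop.eventually_gt_atTop (2 * ‖P 1 0‖ * C / η), hX, hC',
    self_mem_nhdsWithin] with h hρ hρ' hρB hρ2 hρ3 hX hC hh E₀ E₁ hE
  have hh0 : 0 < |h| := abs_pos.2 hh
  set ρ := |h|⁻¹ with hρd
  have hρ0 : 0 < ρ := inv_pos.2 hh0
  have hhρ : |h| = 1 / ρ := by rw [hρd]; simp
  have hR0 : 0 ≤ R := by linarith
  specialize hX E₁ E₀ ℓ₁ ℓ₀ hE.flip
  specialize hC E₁ E₀ ℓ₁ ℓ₀ hE.flip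
  rw [abs_neg] at hX hC
  set V : ℂ → ℂ := fun z => E₁ z * Complex.exp (Complex.I * z * h) with hV
  have hVd : Differentiable ℂ V := hE.diff₁.mul (by fun_prop)
  have hW : Differentiable ℂ (dslope V 0) := by
    rw [← differentiableOn_univ, Complex.differentiableOn_dslope Filter.univ_mem]
    exact hVd.differentiableOn
  -- With `(a, b)` the normalized row, `E₀ e^{i z h}` differs on the circle from `a (1 + P 1 1 / z)`
  -- by a term that is only `O(h)`, to first order `-(P 1 0 / z) b e^{2 i z h}`. It is
  -- cancelled by `P 1 0 (V - V 0) / z`, up to a multiple of `1 / z`, as `V` is close to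
  -- `b e^{2 i z h}`.
  set w : ℂ → ℂ := fun z => E₀ z * Complex.exp (Complex.I * z * h) + P 1 0 * dslope V 0 z with hw
  have hwd : Differentiable ℂ w := (hE.diff₀.mul (by fun_prop)).add (hW.const_mul _)
  have hinv : ∀ z : ℂ, z ≠ 0 → DifferentiableAt ℂ (fun z : ℂ => 1 + P 1 1 * z⁻¹) z := fun z hz =>
    ((differentiableAt_inv hz).const_mul _).const_add _
  have hcinv : ∀ z : ℂ, z ≠ 0 → DifferentiableAt ℂ (fun z : ℂ => -(P 1 0 * V 0) * z⁻¹) z :=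
    fun z hz => (differentiableAt_inv hz).const_mul _
  have hj : ∀ i j, JumpLE (fun z => N z i j) ρ (2 * η) 1 := fun i j =>
    jumpLE_of_norm_sub_mul_pow_le hR0 hρ
      (g := fun z => (1 : Matrix (Fin 2) (Fin 2) ℂ) i j + P i j * z⁻¹)
      (fun z hz => continuousAt_const.add (continuousAt_const.mul (continuousAt_inv₀ hz)))
      fun z h1 h2 => by
        have hz : z ≠ 0 := by rintro rfl; simp at h1
        refine le_trans (le_of_eq ?_) (hRη z h1 h2 i j)
        congr 1
        field_simp
        ring
  have ha := hE.isOuter hN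
  have hja := hE.jumpLE hN (hR.trans hρ) (hj 0 0) (hj 1 0)
  have hk := ha.mul_add hN.nonneg hinv hcinv
    ((tendsto_inv_cocompact.const_mul (P 1 1)).const_add 1)
    (tendsto_inv_cocompact.const_mul (-(P 1 0 * V 0)))
  have hjk := ha.jumpLE_mul_add (C := 1 + ‖P 1 1‖) (q := 0) hN.nonneg (hR.trans hρ) (by positivity)
    (add_zero 1) hinv hcinv hja fun x hx => by
      have hx1 : (1 : ℝ) ≤ |x| := by linarith
      rw [pow_zero, div_one]
      refine (norm_add_le _ _).trans ?_
      rw [norm_one, norm_mul, norm_inv, Complex.norm_real, Real.norm_eq_abs]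
      gcongr
      exact mul_le_of_le_one_right (norm_nonneg _) (inv_le_one_of_one_le₀ hx1)
  have key := norm_apply_zero_sub_le (δ := 271 * η / ρ) hwd hk hN.nonneg le_rfl (hR.trans hρ)
    (by positivity) hjk ?_
  · have hVder : deriv V 0 = deriv E₁ 0 + Complex.I * h * E₁ 0 := by
      have h1 : HasDerivAt (fun z : ℂ => Complex.exp (Complex.I * z * h))
          (Complex.exp (Complex.I * 0 * h) * (Complex.I * 1 * h)) 0 :=
        (((hasDerivAt_id (0 : ℂ)).const_mul Complex.I).mul_const (h : ℂ)).cexp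
      have h2 := ((hE.diff₁ 0).hasDerivAt.mul h1).deriv
      rw [show V = E₁ * fun z : ℂ => Complex.exp (Complex.I * z * h) from rfl, h2]
      simp; ring
    have hw0 : w 0 = E₀ 0 + P 1 0 * (deriv E₁ 0 + Complex.I * h * E₁ 0) := by
      simp [hw, dslope_same, hVder]
    rw [hw0] at key
    simp only [mul_zero, add_zero, mul_one, pow_one] at key
    -- the correction at `0` is `V' 0`, to first order `2 i h ℓ₁`
    have e1 : E₀ 0 - ℓ₀ + 2 * Complex.I * h * P 1 0 * ℓ₁ =
        (E₀ 0 + P 1 0 * (deriv E₁ 0 + Complex.I * h * E₁ 0) - ℓ₀) -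
        P 1 0 * (deriv E₁ 0 + Complex.I * ((-h : ℝ) : ℂ) * E₁ 0) -
        P 1 0 * (2 * Complex.I * h * (E₁ 0 - ℓ₁)) := by
      push_cast; ring
    have k2 : ‖P 1 0 * (deriv E₁ 0 + Complex.I * ((-h : ℝ) : ℂ) * E₁ 0)‖ ≤
        ‖P 1 0‖ * (η * |h|) := by
      rw [norm_mul]; gcongr
    have k3 : ‖P 1 0 * (2 * Complex.I * h * (E₁ 0 - ℓ₁))‖ ≤ η * |h| := by
      have h1 : ‖P 1 0 * (2 * Complex.I * h * (E₁ 0 - ℓ₁))‖ ≤ ‖P 1 0‖ * (2 * |h| * (C * |h|)) := by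
        rw [norm_mul, norm_mul, norm_mul, norm_mul, Complex.norm_I, Complex.norm_real,
          Complex.norm_ofNat, mul_one, Real.norm_eq_abs]
        gcongr
      have h2 : 2 * ‖P 1 0‖ * C * |h| ≤ η := by
        rw [div_lt_iff₀ hη] at hρ3
        rw [hhρ, mul_one_div, div_le_iff₀ hρ0]
        linarith
      nlinarith
    rw [e1]
    refine (norm_sub_le _ _).trans (le_trans (add_le_add_left (norm_sub_le _ _) _) ?_)
    have h5 : 271 * η / ρ + 2 * (2 * η) * (1 + ‖P 1 1‖) / ρ =
        (271 + 4 * (1 + ‖P 1 1‖)) * η * |h| := by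
      rw [hhρ]; ring
    have h6 : ε = A * η := by rw [hηd]; field_simp
    have h7 : 0 ≤ η * |h| := by positivity
    rw [h6, hA]
    linarith
  · intro z h1 h2
    have hz : z ≠ 0 := by rintro rfl; simp at h1
    have hzR : R₀ < ‖z‖ := (hR.trans hρ).trans_eq h2.symm
    have hzh : |h| * ‖z‖ ≤ 1 := by rw [h2, hρd, mul_inv_cancel₀ hh0.ne']
    have hzB : ∀ i j, ‖N z i j - (1 : Matrix (Fin 2) (Fin 2) ℂ) i j‖ ≤ B / ρ := fun i j => by
      rw [← h2]; exact hRB z h1 (hρ'.le.trans_eq h2.symm) i j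
    have hB1 : B / ρ ≤ 1 := by rw [div_le_one hρ0]; exact hρB.le
    have hexp := hRη z h1 (hρ.le.trans_eq h2.symm)
    have a0 := hE.norm_outerRow_le hzh fun i j => (hzB i j).trans hB1
    have a1 := hE.flip.norm_outerRow_le (z := z) (by simpa using hzh) fun i j => by
      rw [← one_rev_rev]; exact (hzB i.rev j.rev).trans hB1
    have e := (norm_exp_I_mul_le hzh).1
    have e2 : ‖Complex.exp (Complex.I * z * h) ^ 2‖ ≤ 9 := by
      rw [norm_pow]
      calc _ ≤ (3 : ℝ) ^ 2 := pow_le_pow_left₀ (norm_nonneg _) e 2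
        _ = 9 := by norm_num
    have hv := hE.flip.norm_entire_sub_outerRow_le hN.flip h1 hzR (by simpa using hzh) hB1
      fun i j => by rw [← one_rev_rev]; exact hzB i.rev j.rev
    set a := outerRow N h E₀ E₁ z with had
    set b := outerRow (flipFrame N) (-h) E₁ E₀ z with hbd
    set X := Complex.exp (Complex.I * z * h) with hXd
    have hXn : Complex.exp (Complex.I * z * ((-h : ℝ) : ℂ)) = X⁻¹ := by
      rw [hXd, ← Complex.exp_neg]; push_cast; congr 1; ring
    rw [hXn] at hv
    have hX0 : X ≠ 0 := Complex.exp_ne_zero _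
    have hid := entire_eq_outerRow (E₀ := E₀) (E₁ := E₁) (h := h) hN h1 hzR
    rw [← had, ← hbd, ← hXd] at hid
    have n1 : ‖z * (N z 1 1 - 1) - P 1 1‖ ≤ η := by simpa using hexp 1 1
    have n2 : ‖z * N z 1 0 - P 1 0‖ ≤ η := by simpa using hexp 1 0
    have hsplit : w z - (a * (1 + P 1 1 * z⁻¹) + -(P 1 0 * V 0) * z⁻¹) =
        (a * (z * (N z 1 1 - 1) - P 1 1) - b * X ^ 2 * (z * N z 1 0 - P 1 0) +
          P 1 0 * (X ^ 2 * (E₁ z * X⁻¹ - b))) / z := by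
      have hds : dslope V 0 z = (E₁ z * X - V 0) / z := by
        rw [dslope_of_ne _ hz, slope_def_field, sub_zero]
      simp only [hw]
      rw [← hXd, hid, hds]
      field_simp
      ring
    rw [hsplit, norm_div, h2]
    refine div_le_div_of_nonneg_right ?_ hρ0.le
    have m1 : ‖a * (z * (N z 1 1 - 1) - P 1 1)‖ ≤ 27 * η := by
      rw [norm_mul]; exact mul_le_mul a0 n1 (norm_nonneg _) (by norm_num)
    have m2 : ‖b * X ^ 2 * (z * N z 1 0 - P 1 0)‖ ≤ 27 * 9 * η := by
      rw [norm_mul, norm_mul]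
      exact mul_le_mul (mul_le_mul a1 e2 (norm_nonneg _) (by norm_num)) n2 (norm_nonneg _)
        (by norm_num)
    have m3 : ‖P 1 0 * (X ^ 2 * (E₁ z * X⁻¹ - b))‖ ≤ η := by
      have h5 : ‖P 1 0 * (X ^ 2 * (E₁ z * X⁻¹ - b))‖ ≤ ‖P 1 0‖ * (9 * (270 * (B / ρ))) := by
        rw [norm_mul, norm_mul]; gcongr
      have h6 : ‖P 1 0‖ * 2430 * B / ρ ≤ η := by
        rw [div_lt_iff₀ hη] at hρ2
        rw [div_le_iff₀ hρ0]
        linarith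
      refine h5.trans (le_trans (le_of_eq ?_) h6)
      ring
    refine (norm_add_le _ _).trans ?_
    have := norm_sub_le (a * (z * (N z 1 1 - 1) - P 1 1)) (b * X ^ 2 * (z * N z 1 0 - P 1 0))
    linarith

/-! ### Waves and their Wronskians -/

namespace SPData

variable {D : SPData}

/-- The exceptional points `k_j`, `k̄_j`. -/
def poles (D : SPData) : Set ℂ := Set.range D.pole ∪ Set.range fun j => conj (D.pole j)

theorem finite_poles (D : SPData) : D.poles.Finite :=
  (Set.finite_range _).union (Set.finite_range _)

theorem conj_mem_poles {k : ℂ} : conj k ∈ D.poles ↔ k ∈ D.poles := by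
  simp only [poles, Set.mem_union, Set.mem_range]
  constructor
  · rintro (⟨j, hj⟩ | ⟨j, hj⟩)
    · exact Or.inr ⟨j, by rw [hj, Complex.conj_conj]⟩
    · exact Or.inl ⟨j, (starRingEnd ℂ).injective hj⟩
  · rintro (⟨j, rfl⟩ | ⟨j, rfl⟩)
    · exact Or.inr ⟨j, rfl⟩
    · exact Or.inl ⟨j, by simp⟩

theorem conj_pole_ne_pole (i j : Fin D.N) : conj (D.pole i) ≠ D.pole j := fun h => by
  have h1 := D.pole_im_pos i
  have h2 := D.pole_im_pos j
  rw [← h, Complex.conj_im] at h2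
  linarith

theorem poles_subset_offReal : D.poles ⊆ offReal := by
  rintro k (⟨j, rfl⟩ | ⟨j, rfl⟩)
  · exact (D.pole_im_pos j).ne'
  · simpa [offReal] using (D.pole_im_pos j).ne'

/-- A row of `M e^{-Q̂ σ₃}`, for `M` a solution of the Riemann–Hilbert problem: its jump on the real
axis and its residue conditions do not involve `x` and `t`. Nothing is required at `k = 0` and at
infinity. -/
structure IsWave (D : SPData) (f g : ℂ → ℂ) : Prop where
  diff_fst : DifferentiableOn ℂ f (offReal \ Set.range D.pole)
  diff_snd : DifferentiableOn ℂ g (offReal \ Set.range fun j => conj (D.pole j))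
  jump : ∀ k : ℝ, k ≠ 0 → ∃ u v u' v' : ℂ,
    Tendsto f (𝓝[{z | 0 < z.im}] (k : ℂ)) (𝓝 u) ∧ Tendsto g (𝓝[{z | 0 < z.im}] (k : ℂ)) (𝓝 v) ∧
    Tendsto f (𝓝[{z | z.im < 0}] (k : ℂ)) (𝓝 u') ∧ Tendsto g (𝓝[{z | z.im < 0}] (k : ℂ)) (𝓝 v') ∧
    u = u' * (1 + conj (D.r k) * D.r k) + v' * D.r k ∧ v = u' * conj (D.r k) + v'
  res_fst : ∀ j, Tendsto (fun k => (k - D.pole j) * f k) (𝓝[≠] D.pole j)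
    (𝓝 (Complex.I * D.γ j * g (D.pole j)))
  res_snd : ∀ j, Tendsto (fun k => (k - conj (D.pole j)) * g k) (𝓝[≠] conj (D.pole j))
    (𝓝 (Complex.I * conj (D.γ j) * f (conj (D.pole j))))

theorem IsWave.differentiableAt_fst {f g : ℂ → ℂ} (h : IsWave D f g) {k : ℂ} (hk : k.im ≠ 0)
    (hp : k ∉ Set.range D.pole) : DifferentiableAt ℂ f k :=
  (h.diff_fst k ⟨hk, hp⟩).differentiableAt
    ((isOpen_offReal.sdiff (Set.finite_range _).isClosed).mem_nhds ⟨hk, hp⟩)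

theorem IsWave.differentiableAt_snd {f g : ℂ → ℂ} (h : IsWave D f g) {k : ℂ} (hk : k.im ≠ 0)
    (hp : k ∉ Set.range fun j => conj (D.pole j)) : DifferentiableAt ℂ g k :=
  (h.diff_snd k ⟨hk, hp⟩).differentiableAt
    ((isOpen_offReal.sdiff (Set.finite_range _).isClosed).mem_nhds ⟨hk, hp⟩)

theorem IsWave.linear_comb {f g f' g' : ℂ → ℂ} (h : IsWave D f g) (h' : IsWave D f' g') (a b : ℂ) :
    IsWave D (fun k => a * f k + b * f' k) (fun k => a * g k + b * g' k) where
  diff_fst := (h.diff_fst.const_mul a).add (h'.diff_fst.const_mul b)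
  diff_snd := (h.diff_snd.const_mul a).add (h'.diff_snd.const_mul b)
  jump k hk := by
    obtain ⟨u, v, u', v', h1, h2, h3, h4, h5, h6⟩ := h.jump k hk
    obtain ⟨s, t, s', t', k1, k2, k3, k4, k5, k6⟩ := h'.jump k hk
    refine ⟨_, _, _, _, (h1.const_mul a).add (k1.const_mul b), (h2.const_mul a).add (k2.const_mul b),
      (h3.const_mul a).add (k3.const_mul b), (h4.const_mul a).add (k4.const_mul b), ?_, ?_⟩
    · rw [h5, k5]; ring
    · rw [h6, k6]; ring
  res_fst j := by
    convert! ((h.res_fst j).const_mul a).add ((h'.res_fst j).const_mul b) using 2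
    · ring
    · ring
  res_snd j := by
    convert! ((h.res_snd j).const_mul a).add ((h'.res_snd j).const_mul b) using 2
    · ring
    · ring

theorem tendsto_conj_upper (x : ℝ) :
    Tendsto (fun z : ℂ => conj z) (𝓝[{z | 0 < z.im}] (x : ℂ)) (𝓝[{z | z.im < 0}] (x : ℂ)) := by
  refine tendsto_nhdsWithin_iff.2 ⟨(Continuous.tendsto' (by fun_prop) _ _ (by simp)).mono_left
    nhdsWithin_le_nhds, ?_⟩
  filter_upwards [self_mem_nhdsWithin] with z hz
  simpa using hz

theorem tendsto_conj_lower (x : ℝ) :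
    Tendsto (fun z : ℂ => conj z) (𝓝[{z | z.im < 0}] (x : ℂ)) (𝓝[{z | 0 < z.im}] (x : ℂ)) := by
  refine tendsto_nhdsWithin_iff.2 ⟨(Continuous.tendsto' (by fun_prop) _ _ (by simp)).mono_left
    nhdsWithin_le_nhds, ?_⟩
  filter_upwards [self_mem_nhdsWithin] with z hz
  simpa using hz

theorem tendsto_conj_nhdsNE (p : ℂ) : Tendsto (fun z : ℂ => conj z) (𝓝[≠] p) (𝓝[≠] conj p) := by
  refine tendsto_nhdsWithin_iff.2 ⟨(Continuous.tendsto' (by fun_prop) _ _ rfl).mono_left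
    nhdsWithin_le_nhds, ?_⟩
  filter_upwards [self_mem_nhdsWithin] with z hz h
  exact hz ((starRingEnd ℂ).injective h)

theorem tendsto_neg_nhdsNE (p : ℂ) : Tendsto (fun z : ℂ => -z) (𝓝[≠] p) (𝓝[≠] (-p)) := by
  refine tendsto_nhdsWithin_iff.2 ⟨(Continuous.tendsto' (by fun_prop) _ _ rfl).mono_left
    nhdsWithin_le_nhds, ?_⟩
  filter_upwards [self_mem_nhdsWithin] with z hz h
  exact hz (neg_injective h)

theorem tendsto_conj_comp {l l' : Filter ℂ} {f : ℂ → ℂ} {y : ℂ}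
    (hl : Tendsto (fun z : ℂ => conj z) l l') (h : Tendsto f l' (𝓝 y)) :
    Tendsto (fun z => conj (f (conj z))) l (𝓝 (conj y)) :=
  (Complex.continuous_conj.tendsto y).comp (h.comp hl)

/-- The symmetry of waves that comes from `J` being Hermitian with determinant `1`. -/
theorem IsWave.conj {f g : ℂ → ℂ} (h : IsWave D f g) :
    IsWave D (fun k => -conj (g (conj k))) (fun k => conj (f (conj k))) where
  diff_fst := fun k hk => by
    have h1 := h.differentiableAt_snd (k := conj k) (by simpa using (show k.im ≠ 0 from hk.1)) (by
      rintro ⟨j, hj⟩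
      exact hk.2 ⟨j, (starRingEnd ℂ).injective hj⟩)
    have h2 := h1.conj_conj
    rw [Complex.conj_conj] at h2
    exact h2.neg.differentiableWithinAt
  diff_snd := fun k hk => by
    have h1 := h.differentiableAt_fst (k := conj k) (by simpa using (show k.im ≠ 0 from hk.1)) (by
      rintro ⟨j, hj⟩
      exact hk.2 ⟨j, by simp only [hj, Complex.conj_conj]⟩)
    have h2 := h1.conj_conj
    rw [Complex.conj_conj] at h2
    exact h2.differentiableWithinAt
  jump k hk := by
    obtain ⟨u, v, u', v', h1, h2, h3, h4, h5, h6⟩ := h.jump k hk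
    refine ⟨_, _, _, _, (tendsto_conj_comp (tendsto_conj_upper k) h4).neg,
      tendsto_conj_comp (tendsto_conj_upper k) h3, (tendsto_conj_comp (tendsto_conj_lower k) h2).neg,
      tendsto_conj_comp (tendsto_conj_lower k) h1, ?_, ?_⟩
    · rw [h5, h6]; simp only [map_add, map_mul, map_one, Complex.conj_conj]; ring
    · rw [h5, h6]; simp only [map_add, map_mul, map_one, Complex.conj_conj]; ring
  res_fst j := by
    convert! (tendsto_conj_comp (tendsto_conj_nhdsNE (D.pole j)) (h.res_snd j)).neg using 2
    · simp
    · simp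
  res_snd j := by
    have h1 := h.res_fst j
    have h2 := tendsto_conj_nhdsNE (conj (D.pole j))
    rw [Complex.conj_conj] at h2
    convert! tendsto_conj_comp h2 h1 using 2
    · simp
    · simp

/-- The symmetry of waves that comes from `r (-k) = conj (r k)`. -/
theorem IsWave.neg {f g : ℂ → ℂ} (h : IsWave D f g) :
    IsWave D (fun k => -g (-k)) (fun k => f (-k)) where
  diff_fst := fun k hk => by
    have h1 := h.differentiableAt_snd (k := -k) (by simpa using (show k.im ≠ 0 from hk.1)) (by
      rintro ⟨j, hj⟩
      obtain ⟨l, hl, -⟩ := D.pole_symm j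
      exact hk.2 ⟨l, by rw [hl]; exact neg_eq_iff_eq_neg.2 hj⟩)
    exact ((h1.comp k differentiableAt_id.neg).neg).differentiableWithinAt
  diff_snd := fun k hk => by
    have h1 := h.differentiableAt_fst (k := -k) (by simpa using (show k.im ≠ 0 from hk.1)) (by
      rintro ⟨j, hj⟩
      obtain ⟨l, hl, -⟩ := D.pole_symm j
      exact hk.2 ⟨l, by simp [hl, hj]⟩)
    exact (h1.comp k differentiableAt_id.neg).differentiableWithinAt
  jump k hk := by
    obtain ⟨u, v, u', v', h1, h2, h3, h4, h5, h6⟩ := h.jump (-k) (neg_ne_zero.2 hk)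
    rw [D.r_neg, Complex.conj_conj] at h5 h6
    refine ⟨_, _, _, _, (h4.comp (tendsto_neg_upper k)).neg, h3.comp (tendsto_neg_upper k),
      (h2.comp (tendsto_neg_lower k)).neg, h1.comp (tendsto_neg_lower k), ?_, ?_⟩
    · rw [h5, h6]; ring
    · rw [h5, h6]; ring
  res_fst j := by
    obtain ⟨l, hl, hγ⟩ := D.pole_symm j
    have h1 := h.res_snd l
    rw [hl, hγ, map_neg, Complex.conj_conj, Complex.conj_conj] at h1
    refine (h1.comp (tendsto_neg_nhdsNE (D.pole j))).congr fun k => ?_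
    simp only [Function.comp]
    ring
  res_snd j := by
    obtain ⟨l, hl, hγ⟩ := D.pole_symm j
    have h1 := h.res_fst l
    rw [hl, hγ] at h1
    convert! (h1.comp (tendsto_neg_nhdsNE (starRingEnd ℂ (D.pole j)))).neg using 2
    · simp only [Function.comp]; ring
    · ring

/-- The Wronskian of two waves extends holomorphically to `ℂ \ {0}`: it has no jump because
`det J = 1`, and the residue conditions make its poles cancel. -/
theorem IsWave.exists_wronskian {f g f' g' : ℂ → ℂ} (h : IsWave D f g) (h' : IsWave D f' g') :
    ∃ G : ℂ → ℂ, DifferentiableOn ℂ G {0}ᶜ ∧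
      ∀ k ∈ offReal \ D.poles, G k = f k * g' k - g k * f' k := by
  refine exists_differentiableOn_compl_zero D.finite_poles ?_ ?_ ?_
  · intro k hk
    have k1 : k ∉ Set.range D.pole := fun h => hk.2 (Or.inl h)
    have k2 : k ∉ Set.range fun j => conj (D.pole j) := fun h => hk.2 (Or.inr h)
    exact (((h.differentiableAt_fst hk.1 k1).mul (h'.differentiableAt_snd hk.1 k2)).sub
      ((h.differentiableAt_snd hk.1 k2).mul (h'.differentiableAt_fst hk.1 k1))).differentiableWithinAt
  · intro s hs
    refine ⟨poles_subset_offReal hs, ?_⟩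
    rcases hs with ⟨j, rfl⟩ | ⟨j, rfl⟩
    · have k2 : D.pole j ∉ Set.range fun j => conj (D.pole j) := by
        rintro ⟨i, hi⟩; exact conj_pole_ne_pole i j hi
      have c1 := (h.differentiableAt_snd (D.pole_im_pos j).ne' k2).continuousAt.tendsto.mono_left
        (nhdsWithin_le_nhds (s := {D.pole j}ᶜ))
      have c2 := (h'.differentiableAt_snd (D.pole_im_pos j).ne' k2).continuousAt.tendsto.mono_left
        (nhdsWithin_le_nhds (s := {D.pole j}ᶜ))
      convert! ((h.res_fst j).mul c2).sub (c1.mul (h'.res_fst j)) using 2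
      · ring
      · ring
    · have him : (conj (D.pole j)).im ≠ 0 := by simpa using (D.pole_im_pos j).ne'
      have k2 : conj (D.pole j) ∉ Set.range D.pole := by
        rintro ⟨i, hi⟩; exact conj_pole_ne_pole j i hi.symm
      have c1 := (h.differentiableAt_fst him k2).continuousAt.tendsto.mono_left
        (nhdsWithin_le_nhds (s := {conj (D.pole j)}ᶜ))
      have c2 := (h'.differentiableAt_fst him k2).continuousAt.tendsto.mono_left
        (nhdsWithin_le_nhds (s := {conj (D.pole j)}ᶜ))
      convert! (c1.mul (h'.res_snd j)).sub ((h.res_snd j).mul c2) using 2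
      · ring
      · ring
  · intro k hk
    obtain ⟨u, v, u', v', h1, h2, h3, h4, h5, h6⟩ := h.jump k hk
    obtain ⟨s, t, s', t', k1, k2, k3, k4, k5, k6⟩ := h'.jump k hk
    refine ⟨_, (h1.mul k2).sub (h2.mul k1), ?_⟩
    convert! (h3.mul k4).sub (h4.mul k3) using 2
    rw [h5, h6, k5, k6]
    ring

theorem eventually_notMem_poles_zero : ∀ᶠ k in 𝓝[offReal] (0 : ℂ), k ∈ offReal \ D.poles := by
  have h : (D.poles)ᶜ ∈ 𝓝 (0 : ℂ) := D.finite_poles.isClosed.isOpen_compl.mem_nhds fun h => by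
    have := poles_subset_offReal h
    simp [offReal] at this
  filter_upwards [self_mem_nhdsWithin, nhdsWithin_le_nhds h] with k h1 h2 using ⟨h1, h2⟩

theorem eventually_notMem_poles_infty :
    ∀ᶠ k in cocompact ℂ ⊓ 𝓟 offReal, k ∈ offReal \ D.poles := by
  rw [eventually_inf_principal]
  filter_upwards [D.finite_poles.isCompact.compl_mem_cocompact] with k h1 h2 using ⟨h2, h1⟩

/-- A Wronskian with limits at `0` and at infinity is constant. -/
theorem IsWave.wronskian_eq_const {f g f' g' : ℂ → ℂ} (h : IsWave D f g) (h' : IsWave D f' g')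
    {c₀ c : ℂ} (h0 : Tendsto (fun k => f k * g' k - g k * f' k) (𝓝[offReal] 0) (𝓝 c₀))
    (hi : Tendsto (fun k => f k * g' k - g k * f' k) (cocompact ℂ ⊓ 𝓟 offReal) (𝓝 c)) :
    ∀ k ∈ offReal \ D.poles, f k * g' k - g k * f' k = c := by
  obtain ⟨G, hG, hGe⟩ := h.exists_wronskian h'
  have t0 : Tendsto G (𝓝[offReal] 0) (𝓝 c₀) := h0.congr' <| by
    filter_upwards [eventually_notMem_poles_zero (D := D)] with k hk using (hGe k hk).symm
  have ti : Tendsto G (cocompact ℂ ⊓ 𝓟 offReal) (𝓝 c) := hi.congr' <| by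
    filter_upwards [eventually_notMem_poles_infty (D := D)] with k hk using (hGe k hk).symm
  have hd := differentiable_update_of_tendsto hG (tendsto_nhdsNE_of_tendsto_offReal
    hG.continuousOn t0)
  have hne : ∀ᶠ k in cocompact ℂ, k ≠ 0 := (isCompact_singleton (x := (0 : ℂ))).compl_mem_cocompact
  have ti' : Tendsto (Function.update G 0 c₀) (cocompact ℂ) (𝓝 c) :=
    (tendsto_cocompact_of_tendsto_offReal hG.continuousOn ti).congr' <| by
      filter_upwards [hne] with k hk using (Function.update_of_ne hk _ _).symm
  intro k hk
  rw [← hGe k hk, ← hd.apply_eq_of_tendsto_cocompact k ti', Function.update_of_ne]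
  rintro rfl
  exact hk.1 (by simp)

end SPData

/-! ### Symmetries of the solution and transfer matrices -/

namespace SPData

variable {D : SPData} {x t x' t' : ℝ} {M M' : ℂ → Matrix (Fin 2) (Fin 2) ℂ}

theorem phase_conj (x t : ℝ) (k : ℂ) : conj (phase x t (conj k)) = -phase x t k := by
  simp only [phase, map_add, map_mul, map_div₀, Complex.conj_I, Complex.conj_conj,
    Complex.conj_ofReal, map_ofNat]
  rw [mul_assoc 4, mul_assoc 4, neg_mul Complex.I k, mul_neg, div_neg]
  ring

theorem phase_neg (x t : ℝ) (k : ℂ) : phase x t (-k) = -phase x t k := by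
  simp only [phase]
  rw [mul_neg, mul_neg, div_neg]
  ring

theorem differentiableAt_phase (x t : ℝ) {k : ℂ} (hk : k ≠ 0) :
    DifferentiableAt ℂ (phase x t) k := by
  unfold phase
  refine DifferentiableAt.add (by fun_prop) (DifferentiableAt.div (by fun_prop) (by fun_prop) ?_)
  simp [hk]

theorem ne_zero_of_im_ne_zero {k : ℂ} (hk : k.im ≠ 0) : k ≠ 0 := by
  rintro rfl; simp at hk

theorem exp_two_mul_phase (x t : ℝ) (k : ℂ) :
    2 * Complex.I * (k * x - t / (4 * k)) = 2 * phase x t k := by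
  have h : (t : ℂ) / (4 * Complex.I * k) = -(Complex.I * (t / (4 * k))) := by
    rw [mul_right_comm, ← div_div, Complex.div_I]; ring
  rw [phase, h]; ring

/-- The rows of a solution, freed from the exponentials, are waves. -/
theorem IsRHSolution.isWave (hM : D.IsRHSolution x t M) (i : Fin 2) :
    IsWave D (fun k => M k i 0 * Complex.exp (-phase x t k))
      (fun k => M k i 1 * Complex.exp (phase x t k)) where
  diff_fst k hk := ((hM.differentiableOn_col_one i) k hk).mul
    (differentiableAt_phase x t (ne_zero_of_im_ne_zero hk.1)).neg.cexp.differentiableWithinAt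
  diff_snd k hk := ((hM.differentiableOn_col_two i) k hk).mul
    (differentiableAt_phase x t (ne_zero_of_im_ne_zero hk.1)).cexp.differentiableWithinAt
  jump k hk := by
    obtain ⟨P, Q, hPQ⟩ := hM.jump_rel
    obtain ⟨hP, hQ, hJ⟩ := hPQ k hk
    have hk' : (k : ℂ) ≠ 0 := by exact_mod_cast hk
    have e1 : ∀ s : Set ℂ, Tendsto (fun k => Complex.exp (phase x t k)) (𝓝[s] (k : ℂ))
        (𝓝 (Complex.exp (phase x t k))) := fun s =>
      (differentiableAt_phase x t hk').cexp.continuousAt.tendsto.mono_left nhdsWithin_le_nhds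
    have e2 : ∀ s : Set ℂ, Tendsto (fun k => Complex.exp (-phase x t k)) (𝓝[s] (k : ℂ))
        (𝓝 (Complex.exp (-phase x t k))) := fun s =>
      (differentiableAt_phase x t hk').neg.cexp.continuousAt.tendsto.mono_left nhdsWithin_le_nhds
    have entry : ∀ (l : Filter ℂ) (A : Matrix (Fin 2) (Fin 2) ℂ) (j : Fin 2), Tendsto M l (𝓝 A) →
        Tendsto (fun k => M k i j) l (𝓝 (A i j)) := fun l A j h =>
      ((continuous_id.matrix_elem i j).tendsto A).comp h
    refine ⟨_, _, _, _, (entry _ _ 0 hP).mul (e2 _), (entry _ _ 1 hP).mul (e1 _),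
      (entry _ _ 0 hQ).mul (e2 _), (entry _ _ 1 hQ).mul (e1 _), ?_, ?_⟩
    all_goals
      rw [hJ, jump, expSigma3, expSigma3, J₀]
      simp only [Matrix.mul_apply, Fin.sum_univ_two, Matrix.of_apply, Matrix.cons_val', neg_neg,
        Matrix.cons_val_zero, Matrix.cons_val_one, Matrix.cons_val_fin_one, mul_zero, zero_mul,
        add_zero, zero_add]
      try rw [← Complex.conj_mul']
      rw [Complex.exp_neg]
      have := Complex.exp_ne_zero (phase x t k)
      field_simp
  res_fst j := by
    have h1 := hM.residue_col_one j i
    have h2 : Tendsto (fun k => Complex.exp (-phase x t k)) (𝓝[≠] D.pole j)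
        (𝓝 (Complex.exp (-phase x t (D.pole j)))) :=
      (differentiableAt_phase x t
        (ne_zero_of_im_ne_zero (D.pole_im_pos j).ne')).neg.cexp.continuousAt.tendsto.mono_left
        nhdsWithin_le_nhds
    convert! h1.mul h2 using 2
    · ring
    · rw [exp_two_mul_phase, two_mul, Complex.exp_add, Complex.exp_neg]
      have := Complex.exp_ne_zero (phase x t (D.pole j))
      field_simp
  res_snd j := by
    have h1 := hM.residue_col_two j i
    have h2 : Tendsto (fun k => Complex.exp (phase x t k)) (𝓝[≠] conj (D.pole j))
        (𝓝 (Complex.exp (phase x t (conj (D.pole j))))) :=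
      (differentiableAt_phase x t (k := conj (D.pole j)) (ne_zero_of_im_ne_zero
        (by simpa using (D.pole_im_pos j).ne'))).cexp.continuousAt.tendsto.mono_left
        nhdsWithin_le_nhds
    convert! h1.mul h2 using 2
    · ring
    · rw [exp_two_mul_phase, two_mul, neg_add, Complex.exp_add, Complex.exp_neg]
      have := Complex.exp_ne_zero (phase x t (conj (D.pole j)))
      field_simp

/-- A unimodular matrix whose rows, freed from the exponentials, are waves, and which has the two
symmetries `M(k̄)* = M(k)⁻¹` and `M(-k)ᵀ = M(k)⁻¹`. Neither the behaviour at `0` nor that at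
infinity is prescribed. -/
structure IsWaveMatrix (D : SPData) (x t : ℝ) (M : ℂ → Matrix (Fin 2) (Fin 2) ℂ) : Prop where
  wave : ∀ i, IsWave D (fun k => M k i 0 * Complex.exp (-phase x t k))
    (fun k => M k i 1 * Complex.exp (phase x t k))
  det : ∀ k ∈ offReal \ D.poles, M k 0 0 * M k 1 1 - M k 0 1 * M k 1 0 = 1
  conj_symm : ∀ k ∈ offReal \ D.poles,
    conj (M (conj k) 0 0) = M k 1 1 ∧ conj (M (conj k) 0 1) = -M k 1 0
  neg_symm : ∀ k ∈ offReal \ D.poles, M (-k) 0 0 = M k 1 1 ∧ M (-k) 0 1 = -M k 1 0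

theorem tendsto_conj_offReal_zero :
    Tendsto (fun k : ℂ => conj k) (𝓝[offReal] 0) (𝓝[offReal] 0) := by
  refine tendsto_nhdsWithin_iff.2 ⟨(Continuous.tendsto' (by fun_prop) _ _ (by simp)).mono_left
    nhdsWithin_le_nhds, ?_⟩
  filter_upwards [self_mem_nhdsWithin] with z hz
  simpa [offReal] using hz

theorem tendsto_neg_offReal_zero :
    Tendsto (fun k : ℂ => -k) (𝓝[offReal] 0) (𝓝[offReal] 0) := by
  refine tendsto_nhdsWithin_iff.2 ⟨(Continuous.tendsto' (by fun_prop) _ _ (by simp)).mono_left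
    nhdsWithin_le_nhds, ?_⟩
  filter_upwards [self_mem_nhdsWithin] with z hz
  simpa [offReal] using hz

theorem tendsto_conj_offReal_infty :
    Tendsto (fun k : ℂ => conj k) (cocompact ℂ ⊓ 𝓟 offReal) (cocompact ℂ ⊓ 𝓟 offReal) := by
  refine tendsto_inf.2 ⟨(Complex.conjCLE.toHomeomorph.isClosedEmbedding.tendsto_cocompact).mono_left
    inf_le_left, tendsto_principal.2 ?_⟩
  rw [eventually_inf_principal]
  exact Eventually.of_forall fun z hz => by simpa [offReal] using hz

theorem tendsto_neg_offReal_infty :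
    Tendsto (fun k : ℂ => -k) (cocompact ℂ ⊓ 𝓟 offReal) (cocompact ℂ ⊓ 𝓟 offReal) := by
  refine tendsto_inf.2 ⟨((Homeomorph.neg ℂ).isClosedEmbedding.tendsto_cocompact).mono_left
    inf_le_left, tendsto_principal.2 ?_⟩
  rw [eventually_inf_principal]
  exact Eventually.of_forall fun z hz => by simpa [offReal] using hz

theorem tendsto_entry {l : Filter ℂ} {A : Matrix (Fin 2) (Fin 2) ℂ} (h : Tendsto M l (𝓝 A))
    (i j : Fin 2) : Tendsto (fun k => M k i j) l (𝓝 (A i j)) :=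
  ((continuous_id.matrix_elem i j).tendsto A).comp h

/-- A solution with a limit at `0` has determinant `1` and the two symmetries, by applying Liouville's
theorem to Wronskians of its rows and of their images under the symmetries of waves. -/
theorem IsRHSolution.isWaveMatrix (hM : D.IsRHSolution x t M) {M₀ : Matrix (Fin 2) (Fin 2) ℂ}
    (hM₀ : Tendsto M (𝓝[offReal] 0) (𝓝 M₀)) : IsWaveMatrix D x t M := by
  have hw := hM.isWave
  have m0 := tendsto_entry hM₀
  have mi := tendsto_entry hM.normalization
  have hexp : ∀ k, Complex.exp (phase x t k) * Complex.exp (-phase x t k) = 1 := fun k => by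
    rw [← Complex.exp_add]; simp
  have hdet : ∀ k ∈ offReal \ D.poles, M k 0 0 * M k 1 1 - M k 0 1 * M k 1 0 = 1 := by
    have e : ∀ k, M k 0 0 * Complex.exp (-phase x t k) * (M k 1 1 * Complex.exp (phase x t k)) -
        M k 0 1 * Complex.exp (phase x t k) * (M k 1 0 * Complex.exp (-phase x t k)) =
        M k 0 0 * M k 1 1 - M k 0 1 * M k 1 0 := fun k => by
      linear_combination (M k 0 0 * M k 1 1 - M k 0 1 * M k 1 0) * hexp k
    have := (hw 0).wronskian_eq_const (hw 1)
      ((((m0 0 0).mul (m0 1 1)).sub ((m0 0 1).mul (m0 1 0))).congr fun k => (e k).symm)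
      ((((mi 0 0).mul (mi 1 1)).sub ((mi 0 1).mul (mi 1 0))).congr fun k => (e k).symm)
    intro k hk
    rw [← e k, this k hk]
    simp
  have hconj : ∀ i, ∀ k ∈ offReal \ D.poles,
      M k i 0 * conj (M (conj k) 0 0) + M k i 1 * conj (M (conj k) 0 1) =
        (1 : Matrix (Fin 2) (Fin 2) ℂ) i 0 := by
    intro i
    have e : ∀ k, M k i 0 * Complex.exp (-phase x t k) *
        conj (M (conj k) 0 0 * Complex.exp (-phase x t (conj k))) -
        M k i 1 * Complex.exp (phase x t k) *
          -conj (M (conj k) 0 1 * Complex.exp (phase x t (conj k))) =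
        M k i 0 * conj (M (conj k) 0 0) + M k i 1 * conj (M (conj k) 0 1) := fun k => by
      simp only [map_mul, ← Complex.exp_conj, map_neg, phase_conj, neg_neg]
      linear_combination (M k i 0 * conj (M (conj k) 0 0) + M k i 1 * conj (M (conj k) 0 1)) *
        hexp k
    have c0 := fun j => tendsto_conj_comp tendsto_conj_offReal_zero (m0 0 j)
    have ci := fun j => tendsto_conj_comp tendsto_conj_offReal_infty (mi 0 j)
    have := (hw i).wronskian_eq_const (hw 0).conj
      ((((m0 i 0).mul (c0 0)).add ((m0 i 1).mul (c0 1))).congr fun k => (e k).symm)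
      ((((mi i 0).mul (ci 0)).add ((mi i 1).mul (ci 1))).congr fun k => (e k).symm)
    intro k hk
    rw [← e k, this k hk]
    simp
  have hneg : ∀ i, ∀ k ∈ offReal \ D.poles,
      M k i 0 * M (-k) 0 0 + M k i 1 * M (-k) 0 1 = (1 : Matrix (Fin 2) (Fin 2) ℂ) i 0 := by
    intro i
    have e : ∀ k, M k i 0 * Complex.exp (-phase x t k) *
        (M (-k) 0 0 * Complex.exp (-phase x t (-k))) -
        M k i 1 * Complex.exp (phase x t k) * -(M (-k) 0 1 * Complex.exp (phase x t (-k))) =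
        M k i 0 * M (-k) 0 0 + M k i 1 * M (-k) 0 1 := fun k => by
      simp only [phase_neg, neg_neg]
      linear_combination (M k i 0 * M (-k) 0 0 + M k i 1 * M (-k) 0 1) * hexp k
    have c0 := fun j => (m0 0 j).comp tendsto_neg_offReal_zero
    have ci := fun j => (mi 0 j).comp tendsto_neg_offReal_infty
    have := (hw i).wronskian_eq_const (hw 0).neg
      ((((m0 i 0).mul (c0 0)).add ((m0 i 1).mul (c0 1))).congr fun k => (e k).symm)
      ((((mi i 0).mul (ci 0)).add ((mi i 1).mul (ci 1))).congr fun k => (e k).symm)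
    intro k hk
    rw [← e k, this k hk]
    simp
  refine ⟨hw, hdet, fun k hk => ?_, fun k hk => ?_⟩
  · have h0 := hconj 0 k hk
    have h1 := hconj 1 k hk
    have hd := hdet k hk
    simp only [Matrix.one_apply_eq, ne_eq, one_ne_zero, not_false_eq_true,
      Matrix.one_apply_ne] at h0 h1
    constructor
    · linear_combination M k 1 1 * h0 - M k 0 1 * h1 - conj (M (conj k) 0 0) * hd
    · linear_combination -M k 1 0 * h0 + M k 0 0 * h1 - conj (M (conj k) 0 1) * hd
  · have h0 := hneg 0 k hk
    have h1 := hneg 1 k hk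
    have hd := hdet k hk
    simp only [Matrix.one_apply_eq, ne_eq, one_ne_zero, not_false_eq_true,
      Matrix.one_apply_ne] at h0 h1
    constructor
    · linear_combination M k 1 1 * h0 - M k 0 1 * h1 - M (-k) 0 0 * hd
    · linear_combination -M k 1 0 * h0 + M k 0 0 * h1 - M (-k) 0 1 * hd

theorem conj_mem_compl_poles {k : ℂ} (hk : k ∈ offReal \ D.poles) :
    conj k ∈ offReal \ D.poles :=
  ⟨by simpa [offReal] using hk.1, fun h => hk.2 (conj_mem_poles.1 h)⟩

/-- `M` multiplied on the left by the rotation with first row `(a, -b)`. -/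
noncomputable def rotate (a b : ℝ) (M : ℂ → Matrix (Fin 2) (Fin 2) ℂ) :
    ℂ → Matrix (Fin 2) (Fin 2) ℂ :=
  fun k => !![(a : ℂ), -b; (b : ℂ), a] * M k

theorem rotate_zero (a b : ℝ) (M : ℂ → Matrix (Fin 2) (Fin 2) ℂ) (k : ℂ) (j : Fin 2) :
    rotate a b M k 0 j = a * M k 0 j - b * M k 1 j := by
  simp [rotate, Matrix.mul_apply, Fin.sum_univ_two]
  ring

theorem rotate_one (a b : ℝ) (M : ℂ → Matrix (Fin 2) (Fin 2) ℂ) (k : ℂ) (j : Fin 2) :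
    rotate a b M k 1 j = b * M k 0 j + a * M k 1 j := by
  simp [rotate, Matrix.mul_apply, Fin.sum_univ_two]

theorem IsWaveMatrix.rotate (hM : IsWaveMatrix D x t M) {a b : ℝ} (hab : a ^ 2 + b ^ 2 = 1) :
    IsWaveMatrix D x t (rotate a b M) := by
  have hab' : (a : ℂ) ^ 2 + (b : ℂ) ^ 2 = 1 := by exact_mod_cast hab
  refine ⟨fun i => ?_, fun k hk => ?_, fun k hk => ?_, fun k hk => ?_⟩
  · fin_cases i
    · have := (hM.wave 0).linear_comb (hM.wave 1) a (-b)
      convert! this using 2 <;> simp only [Fin.zero_eta, rotate_zero] <;> ring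
    · have := (hM.wave 0).linear_comb (hM.wave 1) b a
      convert! this using 2 <;> simp only [Fin.mk_one, rotate_one] <;> ring
  · simp only [rotate_zero, rotate_one]
    linear_combination (a ^ 2 + b ^ 2 : ℂ) * hM.det k hk + hab'
  · obtain ⟨h1, h2⟩ := hM.conj_symm k hk
    obtain ⟨h3, h4⟩ := hM.conj_symm (conj k) (conj_mem_compl_poles hk)
    rw [Complex.conj_conj] at h3 h4
    have h5 : conj (M (conj k) 1 0) = -M k 0 1 := by
      rw [← neg_eq_iff_eq_neg, ← map_neg, ← h4, Complex.conj_conj]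
    have h6 : conj (M (conj k) 1 1) = M k 0 0 := by rw [← h3, Complex.conj_conj]
    simp only [rotate_zero, rotate_one, map_sub, map_mul, Complex.conj_ofReal]
    rw [h1, h2, h5, h6]
    constructor <;> ring
  · have hk' : -k ∈ offReal \ D.poles := by
      refine ⟨by simpa [offReal] using hk.1, fun h => hk.2 ?_⟩
      rcases h with ⟨j, hj⟩ | ⟨j, hj⟩
      · obtain ⟨l, hl, -⟩ := D.pole_symm j
        refine Or.inr ⟨l, ?_⟩
        simp [hl, hj]
      · obtain ⟨l, hl, -⟩ := D.pole_symm j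
        refine Or.inl ⟨l, ?_⟩
        rw [hl]; exact neg_eq_iff_eq_neg.2 hj
    obtain ⟨h1, h2⟩ := hM.neg_symm k hk
    obtain ⟨h3, h4⟩ := hM.neg_symm (-k) hk'
    rw [neg_neg] at h3 h4
    simp only [rotate_zero, rotate_one]
    rw [h1, h2, ← h3, ← neg_eq_iff_eq_neg.2 h4]
    constructor <;> ring

theorem eq_zero_of_eqOn_offReal {H : ℂ → ℂ} (hH : ContinuousOn H {0}ᶜ)
    (h : ∀ k ∈ offReal \ D.poles, H k = 0) {k : ℝ} (hk : k ≠ 0) : H k = 0 := by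
  have hk0 : (k : ℂ) ≠ 0 := by exact_mod_cast hk
  have hO : IsOpen (D.poles)ᶜ := D.finite_poles.isClosed.isOpen_compl
  have hkO : (k : ℂ) ∈ (D.poles)ᶜ := fun hp => by
    have := poles_subset_offReal hp
    simp [offReal] at this
  have := mem_closure_iff_nhdsWithin_neBot.1 (mem_closure_offReal_inter hO hkO)
  have h1 : Tendsto H (𝓝[(D.poles)ᶜ ∩ offReal] (k : ℂ)) (𝓝 (H k)) :=
    (hH.continuousAt (isOpen_compl_singleton.mem_nhds hk0)).continuousWithinAt
  refine tendsto_nhds_unique h1 (tendsto_const_nhds.congr' ?_)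
  filter_upwards [self_mem_nhdsWithin] with z hz using (h z ⟨hz.2, hz.1⟩).symm

/-- The entries of the transfer matrix `M'(k) e^{-δ σ₃} M(k)⁻¹`, with `δ` the difference of the
phases, extend holomorphically to `ℂ \ {0}`. On the real axis this matrix is unitary. -/
theorem IsWaveMatrix.exists_transfer (hM' : IsWaveMatrix D x' t' M') (hM : IsWaveMatrix D x t M) :
    ∃ G : Fin 2 → Fin 2 → ℂ → ℂ, (∀ i j, DifferentiableOn ℂ (G i j) {0}ᶜ) ∧
      (∀ k ∈ offReal \ D.poles, ∀ i,
        G i 0 k = M' k i 0 * Complex.exp (-(phase x' t' k - phase x t k)) * M k 1 1 -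
          M' k i 1 * Complex.exp (phase x' t' k - phase x t k) * M k 1 0 ∧
        G i 1 k = -(M' k i 0 * Complex.exp (-(phase x' t' k - phase x t k)) * M k 0 1) +
          M' k i 1 * Complex.exp (phase x' t' k - phase x t k) * M k 0 0) ∧
      ∀ k : ℝ, k ≠ 0 → ∀ i j, ‖G i j k‖ ≤ 1 := by
  -- multiplying by `M⁻¹ = adj M` turns the entries into Wronskians with the rows of `M`
  choose A hA hAe using fun i => (hM'.wave i).exists_wronskian (hM.wave 1)
  choose B hB hBe using fun i => (hM'.wave i).exists_wronskian (hM.wave 0)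
  have e1 : ∀ k, Complex.exp (-(phase x' t' k - phase x t k)) =
      Complex.exp (-phase x' t' k) * Complex.exp (phase x t k) := fun k => by
    rw [← Complex.exp_add]; congr 1; ring
  have e2 : ∀ k, Complex.exp (phase x' t' k - phase x t k) =
      Complex.exp (phase x' t' k) * Complex.exp (-phase x t k) := fun k => by
    rw [← Complex.exp_add]; congr 1
  have hA' : ∀ k ∈ offReal \ D.poles, ∀ i,
      A i k = M' k i 0 * Complex.exp (-(phase x' t' k - phase x t k)) * M k 1 1 -
        M' k i 1 * Complex.exp (phase x' t' k - phase x t k) * M k 1 0 := fun k hk i => by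
    rw [hAe i k hk, e1, e2]; ring
  obtain ⟨C, hC, hC'⟩ : ∃ C : Fin 2 → ℂ → ℂ, (∀ i, DifferentiableOn ℂ (C i) {0}ᶜ) ∧
      ∀ k ∈ offReal \ D.poles, ∀ i,
        C i k = -(M' k i 0 * Complex.exp (-(phase x' t' k - phase x t k)) * M k 0 1) +
          M' k i 1 * Complex.exp (phase x' t' k - phase x t k) * M k 0 0 :=
    ⟨fun i k => -B i k, fun i => (hB i).neg, fun k hk i => by
      simp only [hBe i k hk, e1, e2]; ring⟩
  -- the relations that make the matrix an element of `SU(2)` on the real axis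
  have hsymm : ∀ k : ℝ, k ≠ 0 → conj (A 0 k) = C 1 k ∧ conj (C 0 k) = -A 1 k ∧
      A 0 k * C 1 k - C 0 k * A 1 k = 1 := by
    intro k hk
    have cA := fun i => (hA i).continuousOn
    have cC := fun i => (hC i).continuousOn
    have cc : ∀ f : ℂ → ℂ, ContinuousOn f {0}ᶜ → ContinuousOn (fun z => conj (f (conj z))) {0}ᶜ :=
      fun f hf => Complex.continuous_conj.comp_continuousOn
        (hf.comp Complex.continuous_conj.continuousOn fun z hz => by simpa using hz)
    have hp : ∀ z : ℂ, Complex.exp (-(phase x' t' z - phase x t z)) =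
        conj (Complex.exp (phase x' t' (conj z) - phase x t (conj z))) := fun z => by
      rw [← Complex.exp_conj, map_sub, phase_conj, phase_conj]; congr 1; ring
    have hq : ∀ z : ℂ, Complex.exp (phase x' t' z - phase x t z) =
        conj (Complex.exp (-(phase x' t' (conj z) - phase x t (conj z)))) := fun z => by
      rw [← Complex.exp_conj, map_neg, map_sub, phase_conj, phase_conj]; congr 1; ring
    have hall : ∀ (N : ℂ → Matrix (Fin 2) (Fin 2) ℂ) (y s : ℝ), IsWaveMatrix D y s N →
        ∀ z ∈ offReal \ D.poles, conj (N (conj z) 0 0) = N z 1 1 ∧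
          conj (N (conj z) 0 1) = -N z 1 0 ∧ conj (N (conj z) 1 0) = -N z 0 1 ∧
          conj (N (conj z) 1 1) = N z 0 0 := fun N y s hN z hz => by
      obtain ⟨h1, h2⟩ := hN.conj_symm z hz
      obtain ⟨h3, h4⟩ := hN.conj_symm (conj z) (conj_mem_compl_poles hz)
      rw [Complex.conj_conj] at h3 h4
      refine ⟨h1, h2, ?_, ?_⟩
      · rw [← neg_eq_iff_eq_neg, ← map_neg, ← h4, Complex.conj_conj]
      · rw [← h3, Complex.conj_conj]
    refine ⟨?_, ?_, ?_⟩
    · have := eq_zero_of_eqOn_offReal (D := D)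
        (H := fun z => conj (A 0 (conj z)) - C 1 z) ((cc _ (cA 0)).sub (cC 1)) (fun z hz => ?_) hk
      · exact sub_eq_zero.1 (by simpa using this)
      · have hz' := conj_mem_compl_poles hz
        obtain ⟨p1, p2, p3, p4⟩ := hall M' x' t' hM' z hz
        obtain ⟨q1, q2, q3, q4⟩ := hall M x t hM z hz
        simp only [hA' _ hz', hC' z hz, map_sub, map_mul, ← hp, ← hq, p1, p2, q3, q4]
        ring
    · have := eq_zero_of_eqOn_offReal (D := D)
        (H := fun z => conj (C 0 (conj z)) - -A 1 z) ((cc _ (cC 0)).sub (cA 1).neg)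
        (fun z hz => ?_) hk
      · exact sub_eq_zero.1 (by simpa using this)
      · have hz' := conj_mem_compl_poles hz
        obtain ⟨p1, p2, p3, p4⟩ := hall M' x' t' hM' z hz
        obtain ⟨q1, q2, q3, q4⟩ := hall M x t hM z hz
        simp only [hC' _ hz', hA' z hz, map_add, map_neg, map_mul, ← hp, ← hq, p1, p2,
          q1, q2]
        ring
    · have := eq_zero_of_eqOn_offReal (D := D)
        (H := fun z => A 0 z * C 1 z - C 0 z * A 1 z - 1) ((((cA 0).mul (cC 1)).sub
        ((cC 0).mul (cA 1))).sub (continuousOn_const (c := (1 : ℂ)))) (fun z hz => ?_) hk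
      · exact sub_eq_zero.1 (by simpa using this)
      · have hz' := hM.det z hz
        have hz'' := hM'.det z hz
        have hee : Complex.exp (phase x' t' z - phase x t z) *
          Complex.exp (-(phase x' t' z - phase x t z)) = 1 := by rw [← Complex.exp_add]; simp
        simp only [hC' z hz, hA' z hz]
        linear_combination (M' z 0 0 * M' z 1 1 - M' z 0 1 * M' z 1 0) *
          (M z 0 0 * M z 1 1 - M z 0 1 * M z 1 0) * hee +
          (M' z 0 0 * M' z 1 1 - M' z 0 1 * M' z 1 0) * hz' + hz''
  refine ⟨fun i j => if j = 0 then A i else C i, fun i j => ?_, fun k hk i => ?_,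
    fun k hk => ?_⟩
  · by_cases hj : j = 0
    · simpa [hj] using hA i
    · simpa [hj] using hC i
  · simp only [if_true, one_ne_zero, if_false]
    exact ⟨hA' k hk i, hC' k hk i⟩
  · obtain ⟨h1, h2, h3⟩ := hsymm k hk
    have h4 : A 1 k = -conj (C 0 k) := by rw [h2, neg_neg]
    have h5 : ‖A 0 k‖ ^ 2 + ‖C 0 k‖ ^ 2 = 1 := by
      rw [h4, ← h1, mul_neg, sub_neg_eq_add, Complex.mul_conj', Complex.mul_conj'] at h3
      exact_mod_cast h3
    have h6 : ‖C 1 k‖ = ‖A 0 k‖ := by rw [← h1, Complex.norm_conj]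
    have h7 : ‖A 1 k‖ = ‖C 0 k‖ := by rw [h4, norm_neg, Complex.norm_conj]
    have h8 : ‖A 0 k‖ ≤ 1 := by nlinarith [norm_nonneg (A 0 k), sq_nonneg ‖C 0 k‖]
    have h9 : ‖C 0 k‖ ≤ 1 := by nlinarith [norm_nonneg (C 0 k), sq_nonneg ‖A 0 k‖]
    intro i j
    fin_cases i <;> fin_cases j
    · simpa using h8
    · simpa using h9
    · simpa using h7.trans_le h9
    · simpa using h6.trans_le h8

end SPData

/-! ### Solutions as frames, and their values at zero -/

/-- A row of functions on `ℂ \ {0}` bounded by `1` on the real axis, with limits `c` at `0`, that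
relates two functions normalized at infinity is an entire row in the sense of `IsTransfer`. -/
theorem isTransfer_update {N : ℂ → Matrix (Fin 2) (Fin 2) ℂ} {R₀ h : ℝ} (hN : IsFrame N R₀)
    {G n : Fin 2 → ℂ → ℂ} {c ℓ : Fin 2 → ℂ} (hG : ∀ j, DifferentiableOn ℂ (G j) {0}ᶜ)
    (hreal : ∀ k : ℝ, k ≠ 0 → ∀ j, ‖G j k‖ ≤ 1)
    (h0 : ∀ j, Tendsto (G j) (𝓝[SPData.offReal] 0) (𝓝 (c j)))
    (hn : ∀ j, Tendsto (n j) (cocompact ℂ ⊓ 𝓟 SPData.offReal) (𝓝 (ℓ j)))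
    (hrel : ∀ᶠ z in cocompact ℂ ⊓ 𝓟 SPData.offReal,
      G 0 z = n 0 z * Complex.exp (-(Complex.I * z * h)) * N z 1 1 -
        n 1 z * Complex.exp (Complex.I * z * h) * N z 1 0 ∧
      G 1 z = -(n 0 z * Complex.exp (-(Complex.I * z * h)) * N z 0 1) +
        n 1 z * Complex.exp (Complex.I * z * h) * N z 0 0) :
    IsTransfer N h (Function.update (G 0) 0 (c 0)) (Function.update (G 1) 0 (c 1)) (ℓ 0) (ℓ 1) := by
  have hE : ∀ j, Differentiable ℂ (Function.update (G j) 0 (c j)) := fun j =>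
    differentiable_update_of_tendsto (hG j)
      (tendsto_nhdsNE_of_tendsto_offReal (hG j).continuousOn (h0 j))
  have hEr : ∀ j, ∀ k : ℝ, ‖Function.update (G j) 0 (c j) k‖ ≤ 1 := by
    intro j
    have hc : Continuous fun k : ℝ => ‖Function.update (G j) 0 (c j) k‖ :=
      ((hE j).continuous.comp Complex.continuous_ofReal).norm
    have hne : ∀ k : ℝ, k ≠ 0 → ‖Function.update (G j) 0 (c j) k‖ ≤ 1 := fun k hk => by
      rw [Function.update_of_ne (by exact_mod_cast hk)]
      exact hreal k hk j
    intro k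
    rcases eq_or_ne k 0 with rfl | hk
    · refine le_of_tendsto ((hc.tendsto 0).mono_left (nhdsWithin_le_nhds (s := {0}ᶜ))) ?_
      filter_upwards [self_mem_nhdsWithin] with k hk using hne k hk
    · exact hne k hk
  have hnb : ∀ᶠ z in cocompact ℂ ⊓ 𝓟 SPData.offReal, ∀ j, ‖n j z‖ ≤ ‖ℓ j‖ + 1 := by
    rw [eventually_all]; intro j
    exact ((hn j).norm.eventually (gt_mem_nhds (lt_add_one _))).mono fun z hz => hz.le
  obtain ⟨R₁, -, hR₁⟩ := exists_forall_of_eventually_offReal (hnb.and hrel)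
  obtain ⟨R₂, hR₂, hN1⟩ := hN.exists_norm_sub_le one_pos
  have hN2 : ∀ z : ℂ, z.im ≠ 0 → R₂ ≤ ‖z‖ → ∀ i j, ‖N z i j‖ ≤ 2 := fun z h1 h2 i j => by
    have h3 := hN1 z h1 h2 i j
    have h4 := norm_le_norm_sub_add (N z i j) ((1 : Matrix (Fin 2) (Fin 2) ℂ) i j)
    have h5 : ‖(1 : Matrix (Fin 2) (Fin 2) ℂ) i j‖ ≤ 1 := by
      rw [Matrix.one_apply]; split_ifs <;> simp
    linarith
  set C : ℝ := (‖ℓ 0‖ + 1) * 2 + (‖ℓ 1‖ + 1) * 2 with hC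
  have hexp : ∀ z : ℂ, ‖Complex.exp (Complex.I * z * h)‖ ≤ Real.exp (|h| * |z.im|) ∧
      ‖Complex.exp (-(Complex.I * z * h))‖ ≤ Real.exp (|h| * |z.im|) := fun z => by
    have h1 : |z.im * h| = |h| * |z.im| := by rw [abs_mul, mul_comm]
    obtain ⟨h2, h3⟩ := abs_le.1 h1.le
    constructor <;> rw [Complex.norm_exp, Real.exp_le_exp] <;> simp <;> linarith
  have hbound : ∀ z : ℂ, z.im ≠ 0 → max R₁ R₂ ≤ ‖z‖ → ∀ j,
      ‖G j z‖ ≤ C * Real.exp (|h| * |z.im|) := by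
    intro z h1 h2 j
    obtain ⟨h3, h4, h5⟩ := hR₁ z h1 ((le_max_left _ _).trans h2)
    have h6 := hN2 z h1 ((le_max_right _ _).trans h2)
    obtain ⟨h7, h8⟩ := hexp z
    have hprod : ∀ a b d : ℂ, ∀ p : ℝ, ‖a‖ ≤ p → ‖b‖ ≤ Real.exp (|h| * |z.im|) → ‖d‖ ≤ 2 →
        ‖a * b * d‖ ≤ p * 2 * Real.exp (|h| * |z.im|) := fun a b d p ha hb hd => by
      have hp : 0 ≤ p := (norm_nonneg _).trans ha
      rw [norm_mul, norm_mul]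
      calc ‖a‖ * ‖b‖ * ‖d‖ ≤ p * Real.exp (|h| * |z.im|) * 2 := by gcongr
        _ = _ := by ring
    fin_cases j
    · simp only [Fin.zero_eta, h4]
      refine (norm_sub_le _ _).trans ?_
      rw [hC, add_mul]
      exact add_le_add (hprod _ _ _ _ (h3 0) h8 (h6 1 1)) (hprod _ _ _ _ (h3 1) h7 (h6 1 0))
    · simp only [Fin.mk_one, h5]
      refine (norm_add_le _ _).trans ?_
      rw [norm_neg, hC, add_mul]
      exact add_le_add (hprod _ _ _ _ (h3 0) h8 (h6 0 1)) (hprod _ _ _ _ (h3 1) h7 (h6 0 0))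
  have hEb : ∀ j z, ‖Function.update (G j) 0 (c j) z‖ ≤ Real.exp (|h| * |z.im|) := fun j z =>
    norm_le_exp_of_norm_le_one_on_real (hE j) (hEr j) (fun z h1 h2 => by
      rw [Function.update_of_ne (by rintro rfl; simp at h1)]
      exact hbound z h1 h2 j) z
  have hdet : ∀ᶠ z in cocompact ℂ ⊓ 𝓟 SPData.offReal,
      N z 0 0 * N z 1 1 - N z 0 1 * N z 1 0 = 1 ∧ z ≠ 0 := by
    rw [eventually_inf_principal]
    have h1 : ∀ᶠ z : ℂ in cocompact ℂ, R₀ < ‖z‖ := tendsto_norm_cocompact_atTop.eventually_gt_atTop _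
    filter_upwards [h1] with z h2 h3
    exact ⟨hN.det z h3 h2, by rintro rfl; simp [SPData.offReal] at h3⟩
  refine ⟨hE 0, hE 1, hEb 0, hEb 1, (hn 0).congr' ?_, (hn 1).congr' ?_⟩
  all_goals
    filter_upwards [hrel, hdet] with z ⟨h1, h2⟩ ⟨h3, h4⟩
    rw [Function.update_of_ne h4, Function.update_of_ne h4, h1, h2, Complex.exp_neg]
    have := Complex.exp_ne_zero (Complex.I * z * h)
    field_simp
  · linear_combination (-(n 0 z)) * h3
  · linear_combination (-(n 1 z * Complex.exp (Complex.I * z * h) ^ 2)) * h3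

theorem tendsto_inv_upper {x : ℝ} (hx : x ≠ 0) :
    Tendsto (fun z : ℂ => z⁻¹) (𝓝[{z | 0 < z.im}] (x : ℂ))
      (𝓝[{z | z.im < 0}] ((x⁻¹ : ℝ) : ℂ)) := by
  have hx' : (x : ℂ) ≠ 0 := by exact_mod_cast hx
  refine tendsto_nhdsWithin_iff.2 ⟨?_, ?_⟩
  · rw [Complex.ofReal_inv]
    exact (continuousAt_inv₀ hx').tendsto.mono_left nhdsWithin_le_nhds
  · filter_upwards [self_mem_nhdsWithin] with z hz
    have hz' : 0 < z.im := hz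
    have h0 : z ≠ 0 := by rintro rfl; simp at hz'
    simpa [Complex.inv_im] using div_neg_of_neg_of_pos (neg_lt_zero.2 hz') (Complex.normSq_pos.2 h0)

theorem tendsto_inv_lower {x : ℝ} (hx : x ≠ 0) :
    Tendsto (fun z : ℂ => z⁻¹) (𝓝[{z | z.im < 0}] (x : ℂ))
      (𝓝[{z | 0 < z.im}] ((x⁻¹ : ℝ) : ℂ)) := by
  have hx' : (x : ℂ) ≠ 0 := by exact_mod_cast hx
  refine tendsto_nhdsWithin_iff.2 ⟨?_, ?_⟩
  · rw [Complex.ofReal_inv]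
    exact (continuousAt_inv₀ hx').tendsto.mono_left nhdsWithin_le_nhds
  · filter_upwards [self_mem_nhdsWithin] with z hz
    have hz' : z.im < 0 := hz
    have h0 : z ≠ 0 := by rintro rfl; simp at hz'
    simpa [Complex.inv_im] using div_pos (neg_pos.2 hz') (Complex.normSq_pos.2 h0)

theorem inv_mem_offReal {z : ℂ} : z⁻¹ ∈ SPData.offReal ↔ z ∈ SPData.offReal := by
  simp only [SPData.offReal, Set.mem_ofPred_eq, Complex.inv_im]
  rcases eq_or_ne z 0 with rfl | h
  · simp
  · simp [h]

theorem tendsto_inv_offReal_infty :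
    Tendsto (fun z : ℂ => z⁻¹) (cocompact ℂ ⊓ 𝓟 SPData.offReal) (𝓝[SPData.offReal] 0) := by
  refine tendsto_nhdsWithin_iff.2 ⟨tendsto_inv_cocompact.mono_left inf_le_left, ?_⟩
  rw [eventually_inf_principal]
  exact Eventually.of_forall fun z hz => inv_mem_offReal.2 hz

theorem tendsto_inv_offReal_zero :
    Tendsto (fun z : ℂ => z⁻¹) (𝓝[SPData.offReal] 0) (cocompact ℂ ⊓ 𝓟 SPData.offReal) := by
  refine tendsto_inf.2 ⟨?_, tendsto_principal.2 ?_⟩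
  · rw [← Metric.cobounded_eq_cocompact]
    refine tendsto_inv₀_nhdsNE_zero.mono_left (nhdsWithin_mono _ fun z hz => ?_)
    rintro rfl
    exact hz (by simp)
  · filter_upwards [self_mem_nhdsWithin] with z hz using inv_mem_offReal.2 hz

namespace SPData

variable {D : SPData} {x t x' t' : ℝ} {M M' : ℂ → Matrix (Fin 2) (Fin 2) ℂ}

instance nhdsWithin_offReal_neBot : (𝓝[offReal] (0 : ℂ)).NeBot := by
  rw [← mem_closure_iff_nhdsWithin_neBot]
  simpa using mem_closure_offReal_inter isOpen_univ (Set.mem_univ (0 : ℂ))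

theorem exists_norm_poles_le (D : SPData) : ∃ R, 0 ≤ R ∧ ∀ p ∈ D.poles, ‖p‖ ≤ R ∧ ‖p⁻¹‖ ≤ R := by
  obtain ⟨R, hR⟩ := (D.finite_poles.image fun p => ‖p‖).bddAbove
  obtain ⟨R', hR'⟩ := (D.finite_poles.image fun p => ‖p⁻¹‖).bddAbove
  refine ⟨max 0 (max R R'), le_max_left _ _, fun p hp => ⟨?_, ?_⟩⟩
  · exact (hR ⟨p, hp, rfl⟩).trans ((le_max_left _ _).trans (le_max_right _ _))
  · exact (hR' ⟨p, hp, rfl⟩).trans ((le_max_right _ _).trans (le_max_right _ _))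

theorem tendsto_exp_phase {k : ℂ} (hk : k ≠ 0) (s : Set ℂ) :
    Tendsto (fun k => Complex.exp (phase x t k)) (𝓝[s] k) (𝓝 (Complex.exp (phase x t k))) ∧
    Tendsto (fun k => Complex.exp (-phase x t k)) (𝓝[s] k) (𝓝 (Complex.exp (-phase x t k))) :=
  ⟨(differentiableAt_phase x t hk).cexp.continuousAt.tendsto.mono_left nhdsWithin_le_nhds,
    (differentiableAt_phase x t hk).neg.cexp.continuousAt.tendsto.mono_left nhdsWithin_le_nhds⟩

theorem IsWaveMatrix.differentiableAt (hM : IsWaveMatrix D x t M) {k : ℂ}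
    (hk : k ∈ offReal \ D.poles) (i j : Fin 2) : DifferentiableAt ℂ (fun k => M k i j) k := by
  have hp := differentiableAt_phase x t (ne_zero_of_im_ne_zero hk.1)
  fin_cases j
  · have h1 := ((hM.wave i).differentiableAt_fst hk.1 fun h => hk.2 (Or.inl h)).mul hp.cexp
    refine h1.congr_of_eventuallyEq (Eventually.of_forall fun z => ?_)
    simp [mul_assoc, ← Complex.exp_add]
  · have h1 := ((hM.wave i).differentiableAt_snd hk.1 fun h => hk.2 (Or.inr h)).mul hp.neg.cexp
    refine h1.congr_of_eventuallyEq (Eventually.of_forall fun z => ?_)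
    simp [mul_assoc, ← Complex.exp_add]

theorem IsWaveMatrix.exists_limits (hM : IsWaveMatrix D x t M) {k : ℝ} (hk : k ≠ 0)
    (i j : Fin 2) : (∃ u, Tendsto (fun k => M k i j) (𝓝[{z | 0 < z.im}] (k : ℂ)) (𝓝 u)) ∧
      ∃ u, Tendsto (fun k => M k i j) (𝓝[{z | z.im < 0}] (k : ℂ)) (𝓝 u) := by
  have hk' : (k : ℂ) ≠ 0 := by exact_mod_cast hk
  have he := fun s => tendsto_exp_phase (x := x) (t := t) hk' s
  obtain ⟨u, v, u', v', h1, h2, h3, h4, -, -⟩ := (hM.wave i).jump k hk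
  fin_cases j
  · refine ⟨⟨_, (h1.mul (he _).1).congr fun z => ?_⟩, ⟨_, (h3.mul (he _).1).congr fun z => ?_⟩⟩ <;>
      simp [mul_assoc, ← Complex.exp_add]
  · refine ⟨⟨_, (h2.mul (he _).2).congr fun z => ?_⟩, ⟨_, (h4.mul (he _).2).congr fun z => ?_⟩⟩ <;>
      simp [mul_assoc, ← Complex.exp_add]

theorem IsWaveMatrix.isFrame (hM : IsWaveMatrix D x t M)
    (hi : Tendsto M (cocompact ℂ ⊓ 𝓟 offReal) (𝓝 1)) : ∃ R₀, IsFrame M R₀ := by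
  obtain ⟨R, hR, hRp⟩ := D.exists_norm_poles_le
  have hk : ∀ z : ℂ, z.im ≠ 0 → R < ‖z‖ → z ∈ offReal \ D.poles := fun z h1 h2 =>
    ⟨h1, fun h => absurd (hRp z h).1 (not_le.2 h2)⟩
  have h0 : ∀ x : ℝ, R < |x| → x ≠ 0 := fun x hx => by
    rintro rfl; rw [abs_zero] at hx; linarith
  exact ⟨R, hR, fun i j => ⟨fun z h1 h2 => hM.differentiableAt (hk z h1 h2) i j,
    fun x hx => (hM.exists_limits (h0 x hx) i j).1, fun x hx => (hM.exists_limits (h0 x hx) i j).2,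
    tendsto_entry hi i j⟩, fun z h1 h2 => hM.det z (hk z h1 h2)⟩

theorem IsWaveMatrix.isFrame_inv (hM : IsWaveMatrix D x t M)
    (h0 : Tendsto M (𝓝[offReal] 0) (𝓝 1)) : ∃ R₀, IsFrame (fun z => M z⁻¹) R₀ := by
  obtain ⟨R, hR, hRp⟩ := D.exists_norm_poles_le
  have hk : ∀ z : ℂ, z.im ≠ 0 → R < ‖z‖ → z⁻¹ ∈ offReal \ D.poles := fun z h1 h2 =>
    ⟨inv_mem_offReal.2 h1, fun h => absurd (hRp _ h).2 (by rw [inv_inv]; exact not_le.2 h2)⟩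
  have hx0 : ∀ x : ℝ, R < |x| → x ≠ 0 := fun x hx => by
    rintro rfl; rw [abs_zero] at hx; linarith
  refine ⟨R, hR, fun i j => ⟨fun z h1 h2 => ?_, fun x hx => ?_, fun x hx => ?_, ?_⟩,
    fun z h1 h2 => hM.det _ (hk z h1 h2)⟩
  · exact DifferentiableAt.comp z (hM.differentiableAt (hk z h1 h2) i j)
      (differentiableAt_inv (ne_zero_of_im_ne_zero h1))
  · obtain ⟨u, hu⟩ := (hM.exists_limits (inv_ne_zero (hx0 x hx)) i j).2
    exact ⟨u, hu.comp (tendsto_inv_upper (hx0 x hx))⟩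
  · obtain ⟨u, hu⟩ := (hM.exists_limits (inv_ne_zero (hx0 x hx)) i j).1
    exact ⟨u, hu.comp (tendsto_inv_lower (hx0 x hx))⟩
  · exact (tendsto_entry h0 i j).comp tendsto_inv_offReal_infty

/-- The two symmetries and `det M = 1` make the limit at `0` a real rotation. -/
theorem IsWaveMatrix.exists_eq_rotation (hM : IsWaveMatrix D x t M) {M₀ : Matrix (Fin 2) (Fin 2) ℂ}
    (hM₀ : Tendsto M (𝓝[offReal] 0) (𝓝 M₀)) :
    ∃ α β : ℝ, α ^ 2 + β ^ 2 = 1 ∧ M₀ = !![(α : ℂ), (β : ℂ); -(β : ℂ), (α : ℂ)] := by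
  have m0 := tendsto_entry hM₀
  have hev := eventually_notMem_poles_zero (D := D)
  have c0 : conj (M₀ 0 0) = M₀ 1 1 := tendsto_nhds_unique
    (tendsto_conj_comp tendsto_conj_offReal_zero (m0 0 0)) ((m0 1 1).congr' <| by
      filter_upwards [hev] with k hk using (hM.conj_symm k hk).1.symm)
  have c1 : conj (M₀ 0 1) = -M₀ 1 0 := tendsto_nhds_unique
    (tendsto_conj_comp tendsto_conj_offReal_zero (m0 0 1)) ((m0 1 0).neg.congr' <| by
      filter_upwards [hev] with k hk using (hM.conj_symm k hk).2.symm)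
  have n0 : M₀ 0 0 = M₀ 1 1 := tendsto_nhds_unique
    ((m0 0 0).comp tendsto_neg_offReal_zero) ((m0 1 1).congr' <| by
      filter_upwards [hev] with k hk using (hM.neg_symm k hk).1.symm)
  have n1 : M₀ 0 1 = -M₀ 1 0 := tendsto_nhds_unique
    ((m0 0 1).comp tendsto_neg_offReal_zero) ((m0 1 0).neg.congr' <| by
      filter_upwards [hev] with k hk using (hM.neg_symm k hk).2.symm)
  have hd : M₀ 0 0 * M₀ 1 1 - M₀ 0 1 * M₀ 1 0 = 1 := tendsto_nhds_unique
    (((m0 0 0).mul (m0 1 1)).sub ((m0 0 1).mul (m0 1 0))) (tendsto_const_nhds.congr' <| by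
      filter_upwards [hev] with k hk using (hM.det k hk).symm)
  obtain ⟨α, hα⟩ := Complex.conj_eq_iff_real.1 (c0.trans n0.symm)
  obtain ⟨β, hβ⟩ := Complex.conj_eq_iff_real.1 (c1.trans n1.symm)
  have h10 : M₀ 1 0 = -β := by rw [← hβ, n1, neg_neg]
  refine ⟨α, β, ?_, ?_⟩
  · rw [← n0, h10, hα, hβ] at hd
    have : (α : ℂ) ^ 2 + (β : ℂ) ^ 2 = 1 := by linear_combination hd
    exact_mod_cast this
  · ext i j
    fin_cases i <;> fin_cases j
    · simpa using hα
    · simpa using hβ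
    · simpa using h10
    · simpa using n0.symm.trans hα

/-- The two symmetries make the coefficient of order `k` at `0` real, symmetric and traceless. -/
theorem IsWaveMatrix.exists_eq_symmetric (hM : IsWaveMatrix D x t M) {F : Matrix (Fin 2) (Fin 2) ℂ}
    (hF : Tendsto (fun k : ℂ => (Complex.I / k) • (M k - 1)) (𝓝[offReal] 0) (𝓝 F)) :
    ∃ f₁ f₂ : ℝ, F = !![(f₁ : ℂ), (f₂ : ℂ); (f₂ : ℂ), -(f₁ : ℂ)] := by
  have hev := eventually_notMem_poles_zero (D := D)
  have m : ∀ i j, Tendsto (fun k => Complex.I / k * (M k i j - (1 : Matrix (Fin 2) (Fin 2) ℂ) i j))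
      (𝓝[offReal] 0) (𝓝 (F i j)) := fun i j => tendsto_entry hF i j
  have m00 := m 0 0
  have m01 := m 0 1
  have m10 := m 1 0
  have m11 := m 1 1
  simp only [Matrix.one_apply_eq, ne_eq, one_ne_zero, zero_ne_one, not_false_eq_true,
    Matrix.one_apply_ne, sub_zero] at m00 m01 m10 m11
  have c0 : -conj (F 0 0) = F 1 1 := tendsto_nhds_unique
    (tendsto_conj_comp tendsto_conj_offReal_zero m00).neg (m11.congr' <| by
      filter_upwards [hev] with k hk
      rw [map_mul, map_sub, (hM.conj_symm k hk).1, map_div₀]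
      simp; ring)
  have c1 : conj (F 0 1) = F 1 0 := tendsto_nhds_unique
    (tendsto_conj_comp tendsto_conj_offReal_zero m01) (m10.congr' <| by
      filter_upwards [hev] with k hk
      rw [map_mul, (hM.conj_symm k hk).2, map_div₀]
      simp; ring)
  have n0 : -F 0 0 = F 1 1 := tendsto_nhds_unique
    (m00.comp tendsto_neg_offReal_zero).neg (m11.congr' <| by
      filter_upwards [hev] with k hk
      simp only [Function.comp, (hM.neg_symm k hk).1]
      rw [div_neg]; ring)
  have n1 : F 0 1 = F 1 0 := tendsto_nhds_unique
    (m01.comp tendsto_neg_offReal_zero) (m10.congr' <| by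
      filter_upwards [hev] with k hk
      simp only [Function.comp, (hM.neg_symm k hk).2]
      rw [div_neg]; ring)
  obtain ⟨f₁, h1⟩ := Complex.conj_eq_iff_real.1 (neg_injective (c0.trans n0.symm))
  obtain ⟨f₂, h2⟩ := Complex.conj_eq_iff_real.1 (c1.trans n1.symm)
  refine ⟨f₁, f₂, ?_⟩
  ext i j
  fin_cases i <;> fin_cases j
  · simpa using h1
  · simpa using h2
  · simpa using n1.symm.trans h2
  · simpa [h1] using n0.symm

end SPData

/-! ### Expansions at zero -/

/-- `f` has the expansion `f k = a + b k + o(k)` as `k → 0` off the real axis. -/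
def HasJet (f : ℂ → ℂ) (a b : ℂ) : Prop :=
  Tendsto (fun k => (f k - a) / k) (𝓝[SPData.offReal] 0) (𝓝 b)

theorem eventually_ne_zero_offReal : ∀ᶠ k in 𝓝[SPData.offReal] (0 : ℂ), k ≠ 0 := by
  filter_upwards [self_mem_nhdsWithin] with k hk
  rintro rfl
  exact hk (by simp)

namespace HasJet

variable {f g : ℂ → ℂ} {a b a' b' : ℂ}

theorem tendsto (hf : HasJet f a b) : Tendsto f (𝓝[SPData.offReal] 0) (𝓝 a) := by
  have h0 : Tendsto (fun k : ℂ => k) (𝓝[SPData.offReal] 0) (𝓝 0) := nhdsWithin_le_nhds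
  have h := (h0.mul hf).add_const a
  rw [zero_mul, zero_add] at h
  refine h.congr' ?_
  filter_upwards [eventually_ne_zero_offReal] with k hk
  field_simp
  ring

theorem mul (hf : HasJet f a b) (hg : HasJet g a' b') :
    HasJet (fun k => f k * g k) (a * a') (b * a' + a * b') := by
  refine (((Tendsto.mul hf hg.tendsto).add (Tendsto.const_mul a hg))).congr fun k => ?_
  ring

theorem add (hf : HasJet f a b) (hg : HasJet g a' b') :
    HasJet (fun k => f k + g k) (a + a') (b + b') :=
  (Tendsto.add hf hg).congr fun k => by ring

theorem sub (hf : HasJet f a b) (hg : HasJet g a' b') :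
    HasJet (fun k => f k - g k) (a - a') (b - b') :=
  (Tendsto.sub hf hg).congr fun k => by ring

theorem const_mul (c : ℂ) (hf : HasJet f a b) : HasJet (fun k => c * f k) (c * a) (c * b) :=
  (Tendsto.const_mul c hf).congr fun k => by ring

theorem of_hasDerivAt (hf : HasDerivAt f b 0) : HasJet f (f 0) b := by
  have h := (hasDerivAt_iff_tendsto_slope.1 hf).mono_left
    (nhdsWithin_mono 0 (t := {0}ᶜ) fun k (hk : k ∈ SPData.offReal) => by
      rintro rfl
      exact hk (by simp))
  refine h.congr fun k => ?_
  rw [slope_def_field, sub_zero]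

theorem exp (h : ℝ) : HasJet (fun k => Complex.exp (Complex.I * k * h)) 1 (Complex.I * h) := by
  have h1 : HasDerivAt (fun k : ℂ => Complex.exp (Complex.I * k * h))
      (Complex.exp (Complex.I * 0 * h) * (Complex.I * 1 * h)) 0 :=
    (((hasDerivAt_id (0 : ℂ)).const_mul Complex.I).mul_const (h : ℂ)).cexp
  simpa using of_hasDerivAt h1

theorem congr (hf : HasJet f a b) (h : ∀ᶠ k in 𝓝[SPData.offReal] 0, f k = g k) : HasJet g a b :=
  Tendsto.congr' (h.mono fun k hk => by rw [hk]) hf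

/-- An entire function has only one expansion at `0`. -/
theorem eq_deriv (hf : HasJet f a b) (hd : Differentiable ℂ f) (h0 : f 0 = a) : deriv f 0 = b := by
  subst h0
  exact tendsto_nhds_unique (of_hasDerivAt (hd 0).hasDerivAt) hf

end HasJet

namespace SPData

variable {D : SPData} {x t x' t' : ℝ} {M M' : ℂ → Matrix (Fin 2) (Fin 2) ℂ}
  {α β f₁ f₂ α' β' f₁' f₂' : ℝ}

/-- `M` has the properties of a solution at `(x, t)` on which the differential equations rest: it
is a wave matrix that tends to the identity at infinity, and, with the rotation
`M₀ = !![α, β; -β, α]`, one has `M₀⁻¹ M(k) = 1 - i k F + o(k)` at `0`, where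
`F = !![f₁, f₂; f₂, -f₁]`. -/
structure IsExpandedWaveMatrix (D : SPData) (x t : ℝ) (M : ℂ → Matrix (Fin 2) (Fin 2) ℂ)
    (α β f₁ f₂ : ℝ) : Prop where
  wave : IsWaveMatrix D x t M
  infty : Tendsto M (cocompact ℂ ⊓ 𝓟 offReal) (𝓝 1)
  sq_add_sq : α ^ 2 + β ^ 2 = 1
  expansion : Tendsto (fun k : ℂ => (Complex.I / k) • (SPData.rotate α β M k - 1)) (𝓝[offReal] 0)
    (𝓝 !![(f₁ : ℂ), (f₂ : ℂ); (f₂ : ℂ), -(f₁ : ℂ)])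

theorem rotation_inv (hab : α ^ 2 + β ^ 2 = 1) :
    (!![(α : ℂ), (β : ℂ); -(β : ℂ), (α : ℂ)])⁻¹ = !![(α : ℂ), -(β : ℂ); (β : ℂ), (α : ℂ)] := by
  have h : (α : ℂ) ^ 2 + (β : ℂ) ^ 2 = 1 := by exact_mod_cast hab
  refine Matrix.inv_eq_left_inv ?_
  ext i j
  fin_cases i <;> fin_cases j <;> simp [Matrix.mul_apply, Fin.sum_univ_two] <;>
    first | linear_combination h | ring

theorem IsRHSolution.isExpandedWaveMatrix (hM : D.IsRHSolution x t M)
    {M₀ F : Matrix (Fin 2) (Fin 2) ℂ} (hM₀ : Tendsto M (𝓝[offReal] 0) (𝓝 M₀))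
    (hF : Tendsto (fun k : ℂ => (Complex.I / k) • (M₀⁻¹ * M k - 1)) (𝓝[offReal] 0) (𝓝 F)) :
    ∃ α β f₁ f₂ : ℝ, M₀ = !![(α : ℂ), (β : ℂ); -(β : ℂ), (α : ℂ)] ∧
      F = !![(f₁ : ℂ), (f₂ : ℂ); (f₂ : ℂ), -(f₁ : ℂ)] ∧
      IsExpandedWaveMatrix D x t M α β f₁ f₂ := by
  have hW := hM.isWaveMatrix hM₀
  obtain ⟨α, β, hab, h0⟩ := hW.exists_eq_rotation hM₀
  have hF' : Tendsto (fun k : ℂ => (Complex.I / k) • (SPData.rotate α β M k - 1)) (𝓝[offReal] 0)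
      (𝓝 F) := by
    refine hF.congr fun k => ?_
    rw [h0, rotation_inv hab, SPData.rotate]
  obtain ⟨f₁, f₂, h1⟩ := (hW.rotate hab).exists_eq_symmetric hF'
  exact ⟨α, β, f₁, f₂, h0, h1, hW, hM.normalization, hab, h1 ▸ hF'⟩

namespace IsExpandedWaveMatrix

theorem hasJet_rotate (hM : IsExpandedWaveMatrix D x t M α β f₁ f₂) (i j : Fin 2) :
    HasJet (fun k => SPData.rotate α β M k i j) ((1 : Matrix (Fin 2) (Fin 2) ℂ) i j)
      (-Complex.I * !![(f₁ : ℂ), (f₂ : ℂ); (f₂ : ℂ), -(f₁ : ℂ)] i j) := by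
  refine ((tendsto_entry hM.expansion i j).const_mul (-Complex.I)).congr fun k => ?_
  simp only [Matrix.smul_apply, Matrix.sub_apply, smul_eq_mul]
  linear_combination (-(SPData.rotate α β M k i j - (1 : Matrix (Fin 2) (Fin 2) ℂ) i j) / k) *
    Complex.I_sq

theorem rotate_tendsto (hM : IsExpandedWaveMatrix D x t M α β f₁ f₂) :
    Tendsto (SPData.rotate α β M) (𝓝[offReal] 0) (𝓝 1) :=
  tendsto_pi_nhds.2 fun i => tendsto_pi_nhds.2 fun j => (hM.hasJet_rotate i j).tendsto

theorem rotate_tendsto_infty (hM : IsExpandedWaveMatrix D x t M α β f₁ f₂) :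
    Tendsto (SPData.rotate α β M) (cocompact ℂ ⊓ 𝓟 offReal)
      (𝓝 !![(α : ℂ), -(β : ℂ); (β : ℂ), (α : ℂ)]) := by
  have h := (tendsto_const_nhds (x := !![(α : ℂ), -(β : ℂ); (β : ℂ), (α : ℂ)])).mul hM.infty
  rw [mul_one] at h
  exact h

theorem hasJet (hM : IsExpandedWaveMatrix D x t M α β f₁ f₂) :
    HasJet (fun k => M k 0 0) α (-Complex.I * (α * f₁ + β * f₂)) ∧
    HasJet (fun k => M k 0 1) β (-Complex.I * (α * f₂ - β * f₁)) ∧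
    HasJet (fun k => M k 1 0) (-β) (-Complex.I * (α * f₂ - β * f₁)) ∧
    HasJet (fun k => M k 1 1) α (Complex.I * (α * f₁ + β * f₂)) := by
  have hab : (α : ℂ) ^ 2 + (β : ℂ) ^ 2 = 1 := by exact_mod_cast hM.sq_add_sq
  have r0 : ∀ k j, α * SPData.rotate α β M k 0 j + β * SPData.rotate α β M k 1 j = M k 0 j := by
    intro k j
    rw [rotate_zero, rotate_one]
    linear_combination M k 0 j * hab
  have r1 : ∀ k j, α * SPData.rotate α β M k 1 j - β * SPData.rotate α β M k 0 j = M k 1 j := by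
    intro k j
    rw [rotate_zero, rotate_one]
    linear_combination M k 1 j * hab
  have j00 := hM.hasJet_rotate 0 0
  have j01 := hM.hasJet_rotate 0 1
  have j10 := hM.hasJet_rotate 1 0
  have j11 := hM.hasJet_rotate 1 1
  refine ⟨?_, ?_, ?_, ?_⟩
  · convert ((j00.const_mul α).add (j10.const_mul β)).congr (.of_forall fun k => r0 k 0) using 1 <;>
      (simp <;> ring)
  · convert ((j01.const_mul α).add (j11.const_mul β)).congr (.of_forall fun k => r0 k 1) using 1 <;>
      (simp <;> ring)
  · convert ((j10.const_mul α).sub (j00.const_mul β)).congr (.of_forall fun k => r1 k 0) using 1 <;>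
      (simp <;> ring)
  · convert ((j11.const_mul α).sub (j01.const_mul β)).congr (.of_forall fun k => r1 k 1) using 1 <;>
      (simp <;> ring)

/-- For two solutions at the same time, the first row of `M₀(x')⁻¹ M(x') e^{-i k h σ₃} M(x)⁻¹`, with
`h = x' - x`, and its expansion at `0`. -/
theorem exists_transfer_space (hM' : IsExpandedWaveMatrix D x' t M' α' β' f₁' f₂')
    (hM : IsExpandedWaveMatrix D x t M α β f₁ f₂) :
    ∃ E₀ E₁ ℓ₀ ℓ₁, IsTransfer M (x' - x) E₀ E₁ ℓ₀ ℓ₁ ∧ E₀ 0 = α ∧ E₁ 0 = -β ∧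
      deriv E₀ 0 = -Complex.I * (((f₁' - f₁ + (x' - x)) * α + (f₂' - f₂) * β : ℝ) : ℂ) ∧
      deriv E₁ 0 = -Complex.I * ((-((f₁' - f₁ + (x' - x)) * β) + (f₂' - f₂) * α : ℝ) : ℂ) := by
  obtain ⟨R₀, hN⟩ := hM.wave.isFrame hM.infty
  obtain ⟨G, hG, hrel, hb⟩ := (hM'.wave.rotate hM'.sq_add_sq).exists_transfer hM.wave
  have hph : ∀ k, phase x' t k - phase x t k = Complex.I * k * ((x' - x : ℝ) : ℂ) := fun k => by
    simp only [phase]; push_cast; ring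
  simp only [hph] at hrel
  obtain ⟨j00, j01, j10, j11⟩ := hM.hasJet
  have m0 := hM'.hasJet_rotate 0 0
  have m1 := hM'.hasJet_rotate 0 1
  have ep := HasJet.exp (x' - x)
  have em : HasJet (fun k => Complex.exp (-(Complex.I * k * ((x' - x : ℝ) : ℂ)))) 1
      (-(Complex.I * ((x' - x : ℝ) : ℂ))) := by
    have := HasJet.exp (-(x' - x))
    push_cast at this ⊢
    simpa only [mul_neg] using this
  have hev := eventually_notMem_poles_zero (D := D)
  have g0 := (((m0.mul em).mul j11).sub ((m1.mul ep).mul j10)).congr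
    (hev.mono fun k hk => (hrel k hk 0).1.symm)
  have g1 := (((m1.mul ep).mul j00).sub ((m0.mul em).mul j01)).congr (g := G 0 1)
    (hev.mono fun k hk => by rw [(hrel k hk 0).2]; ring)
  simp only [Matrix.one_apply_eq, ne_eq, zero_ne_one, not_false_eq_true, Matrix.one_apply_ne,
    Matrix.of_apply, Matrix.cons_val', Matrix.cons_val_zero,
    Matrix.cons_val_one, Matrix.cons_val_fin_one, one_mul, zero_mul, mul_one, sub_zero,
    add_zero, zero_sub] at g0 g1
  have hE := isTransfer_update (c := ![(α : ℂ), -(β : ℂ)]) (ℓ := ![(α' : ℂ), -(β' : ℂ)])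
    (n := fun j k => SPData.rotate α' β' M' k 0 j) hN (fun j => hG 0 j)
    (fun k hk j => hb k hk 0 j)
    (by intro j; fin_cases j
        · exact g0.tendsto
        · exact g1.tendsto)
    (by intro j
        have := tendsto_entry hM'.rotate_tendsto_infty 0 j
        fin_cases j <;> exact this)
    (eventually_notMem_poles_infty (D := D) |>.mono fun k hk => hrel k hk 0)
  have hup : ∀ (j : Fin 2) (c : ℂ), ∀ᶠ k in 𝓝[offReal] (0 : ℂ), G 0 j k =
      Function.update (G 0 j) 0 c k := fun j c => eventually_ne_zero_offReal.mono fun k hk => by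
    rw [Function.update_of_ne hk]
  refine ⟨_, _, _, _, hE, by simp, by simp, ?_, ?_⟩
  · exact ((g0.congr (hup 0 α)).eq_deriv hE.diff₀ (by simp)).trans (by push_cast; ring)
  · exact ((g1.congr (hup 1 (-β))).eq_deriv hE.diff₁ (by simp)).trans (by push_cast; ring)

/-- For two solutions at the same `x`, the second row of
`M₀(t')⁻¹ M(t') e^{-i z h σ₃} (M₀(t)⁻¹ M(t))⁻¹`, with `h = -(t' - t) / 4`, as a function of
`z = 1 / k`. -/
theorem exists_transfer_time (hM' : IsExpandedWaveMatrix D x t' M' α' β' f₁' f₂')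
    (hM : IsExpandedWaveMatrix D x t M α β f₁ f₂) :
    ∃ E₀ E₁, IsTransfer (fun z => SPData.rotate α β M z⁻¹) (-(t' - t) / 4) E₀ E₁ 0 1 ∧
      E₀ 0 = ((β' * α - α' * β : ℝ) : ℂ) ∧ E₁ 0 = ((α * α' + β * β' : ℝ) : ℂ) := by
  obtain ⟨R₀, hN⟩ := (hM.wave.rotate hM.sq_add_sq).isFrame_inv hM.rotate_tendsto
  obtain ⟨G, hG, hrel, hb⟩ := (hM'.wave.rotate hM'.sq_add_sq).exists_transfer
    (hM.wave.rotate hM.sq_add_sq)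
  have hph : ∀ k, phase x t' k - phase x t k =
      Complex.I * k⁻¹ * ((-(t' - t) / 4 : ℝ) : ℂ) := fun k => by
    simp only [phase]; push_cast
    rw [div_mul_eq_div_div, div_mul_eq_div_div, div_mul_eq_div_div, div_mul_eq_div_div,
      div_right_comm (t' : ℂ), div_right_comm (t : ℂ), Complex.div_I, Complex.div_I]
    ring
  simp only [hph] at hrel
  have n := tendsto_entry hM'.rotate_tendsto_infty
  have m := tendsto_entry hM.rotate_tendsto_infty
  have hz : Tendsto (fun k : ℂ => k⁻¹) (cocompact ℂ ⊓ 𝓟 offReal) (𝓝 0) :=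
    tendsto_inv_cocompact.mono_left inf_le_left
  have ep : Tendsto (fun k : ℂ => Complex.exp (Complex.I * k⁻¹ * ((-(t' - t) / 4 : ℝ) : ℂ)))
      (cocompact ℂ ⊓ 𝓟 offReal) (𝓝 1) := by
    have := ((hz.const_mul Complex.I).mul_const ((-(t' - t) / 4 : ℝ) : ℂ)).cexp
    simpa using this
  have em : Tendsto (fun k : ℂ => Complex.exp (-(Complex.I * k⁻¹ * ((-(t' - t) / 4 : ℝ) : ℂ))))
      (cocompact ℂ ⊓ 𝓟 offReal) (𝓝 1) := by
    have := ((hz.const_mul Complex.I).mul_const ((-(t' - t) / 4 : ℝ) : ℂ)).neg.cexp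
    simpa using this
  have hev := eventually_notMem_poles_infty (D := D)
  have g0 := ((((n 1 0).mul em).mul (m 1 1)).sub (((n 1 1).mul ep).mul (m 1 0))).congr'
    (hev.mono fun k hk => (hrel k hk 1).1.symm)
  have g1 := ((((n 1 0).mul em).mul (m 0 1)).neg.add (((n 1 1).mul ep).mul (m 0 0))).congr'
    (hev.mono fun k hk => (hrel k hk 1).2.symm)
  have hE := isTransfer_update (G := fun j z => G 1 j z⁻¹)
    (c := ![((β' * α - α' * β : ℝ) : ℂ), ((α * α' + β * β' : ℝ) : ℂ)]) (ℓ := ![0, 1])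
    (n := fun j z => SPData.rotate α' β' M' z⁻¹ 1 j) (h := -(t' - t) / 4) hN
    (fun j => (hG 1 j).comp (fun z hz => (differentiableAt_inv hz).differentiableWithinAt)
      fun z hz => inv_ne_zero hz)
    (fun k hk j => by
      have := hb k⁻¹ (inv_ne_zero hk) 1 j
      rwa [Complex.ofReal_inv] at this)
    (by intro j; fin_cases j
        · refine (g0.comp tendsto_inv_offReal_zero).congr' ?_ |>.mono_right (le_of_eq ?_)
          · exact Eventually.of_forall fun z => rfl
          · congr 1; simp
        · refine (g1.comp tendsto_inv_offReal_zero).congr' ?_ |>.mono_right (le_of_eq ?_)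
          · exact Eventually.of_forall fun z => rfl
          · congr 1; simp; ring)
    (by intro j
        have := (tendsto_entry hM'.rotate_tendsto 1 j).comp tendsto_inv_offReal_infty
        fin_cases j
        · exact this
        · exact this)
    (by
      have h2 : ∀ᶠ z in cocompact ℂ ⊓ 𝓟 offReal, z⁻¹ ∈ offReal \ D.poles :=
        tendsto_inv_offReal_infty.eventually (eventually_notMem_poles_zero (D := D))
      filter_upwards [h2] with z hz
      have := hrel z⁻¹ hz 1
      rwa [inv_inv] at this)
  exact ⟨_, _, hE, by simp, by simp⟩

theorem hasExpansion (hM : IsExpandedWaveMatrix D x t M α β f₁ f₂) :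
    HasExpansion (fun z => SPData.rotate α β M z⁻¹)
      (-Complex.I • !![(f₁ : ℂ), (f₂ : ℂ); (f₂ : ℂ), -(f₁ : ℂ)]) := fun i j =>
  (Tendsto.comp (hM.hasJet_rotate i j) tendsto_inv_offReal_infty).congr fun z => by
    simp only [Function.comp, div_inv_eq_mul]
    ring

end IsExpandedWaveMatrix

end SPData

/-! ### The differential equations -/

theorem hasDerivWithinAt_of_eventually_abs_le {g : ℝ → ℝ} {d t : ℝ} {T : Set ℝ}
    (h : ∀ ε > 0, ∀ᶠ s in 𝓝[≠] t, s ∈ T → |g s - g t - (s - t) * d| ≤ ε * |s - t|) :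
    HasDerivWithinAt g d T t := by
  rw [hasDerivWithinAt_iff_isLittleO, Asymptotics.isLittleO_iff]
  intro ε hε
  have h1 := eventually_nhdsWithin_iff.1 (h ε hε)
  refine eventually_nhdsWithin_iff.2 (h1.mono fun s hs hsT => ?_)
  rcases eq_or_ne s t with rfl | hst
  · simp
  · exact hs hst hsT

theorem tendsto_affine_nhdsNE (c t : ℝ) (hc : c ≠ 0) :
    Tendsto (fun s : ℝ => c * (s - t)) (𝓝[≠] t) (𝓝[≠] 0) := by
  refine tendsto_nhdsWithin_iff.2
    ⟨(Continuous.tendsto' (by fun_prop) t 0 (by simp)).mono_left nhdsWithin_le_nhds, ?_⟩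
  filter_upwards [self_mem_nhdsWithin] with s hs
  exact mul_ne_zero hc (sub_ne_zero.2 hs)

namespace SPData

variable {D : SPData} {T : Set ℝ} {M : ℝ → ℝ → ℂ → Matrix (Fin 2) (Fin 2) ℂ}
  {α β f₁ f₂ : ℝ → ℝ → ℝ}

/-- The derivatives in `x` say that `E'(0) = -i h E(0) σ₃ + o(h)` for the transfer matrix `E`. -/
theorem hasDerivAt_space {t : ℝ}
    (h : ∀ x, IsExpandedWaveMatrix D x t (M x t) (α x t) (β x t) (f₁ x t) (f₂ x t)) (x : ℝ) :
    HasDerivAt (fun y => y + f₁ y t) (α x t ^ 2 - β x t ^ 2) x ∧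
      HasDerivAt (fun y => f₂ y t) (2 * α x t * β x t) x := by
  obtain ⟨R₀, hN⟩ := (h x).wave.isFrame (h x).infty
  have key : ∀ ε > 0, ∀ᶠ y in 𝓝[≠] x,
      |(y + f₁ y t) - (x + f₁ x t) - (y - x) * (α x t ^ 2 - β x t ^ 2)| ≤ ε * |y - x| ∧
      |f₂ y t - f₂ x t - (y - x) * (2 * α x t * β x t)| ≤ ε * |y - x| := by
    intro ε hε
    have ht : Tendsto (fun y : ℝ => y - x) (𝓝[≠] x) (𝓝[≠] 0) := by
      simpa using tendsto_affine_nhdsNE 1 x one_ne_zero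
    have htn : Tendsto (fun y : ℝ => -(y - x)) (𝓝[≠] x) (𝓝[≠] 0) := by
      simpa using tendsto_affine_nhdsNE (-1) x (by norm_num)
    filter_upwards [ht.eventually (hN.eventually_norm_deriv_le (half_pos hε)),
      htn.eventually (hN.flip.eventually_norm_deriv_le (half_pos hε))] with y h0 h1
    obtain ⟨E₀, E₁, ℓ₀, ℓ₁, hE, e0, e1, d0, d1⟩ := (h y).exists_transfer_space (h x)
    have b0 := h0 E₀ E₁ ℓ₀ ℓ₁ hE
    have b1 := h1 E₁ E₀ ℓ₁ ℓ₀ hE.flip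
    have hab := (h x).sq_add_sq
    set a := α x t
    set b := β x t
    set δ₁ := f₁ y t - f₁ x t + (y - x)
    set δ₂ := f₂ y t - f₂ x t
    set S₀ := δ₁ * a + δ₂ * b - (y - x) * a with hS₀
    set S₁ := -(δ₁ * b) + δ₂ * a - (y - x) * b with hS₁
    have c0 : |S₀| ≤ ε / 2 * |y - x| := by
      rw [d0, e0] at b0
      convert b0 using 1
      rw [← Real.norm_eq_abs, ← Complex.norm_real, ← one_mul ‖(S₀ : ℂ)‖, ← Complex.norm_I,
        ← norm_mul, ← norm_neg, hS₀]
      congr 1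
      push_cast
      ring
    have c1 : |S₁| ≤ ε / 2 * |y - x| := by
      rw [d1, e1, abs_neg] at b1
      convert b1 using 1
      rw [← Real.norm_eq_abs, ← Complex.norm_real, ← one_mul ‖(S₁ : ℂ)‖, ← Complex.norm_I,
        ← norm_mul, ← norm_neg, hS₁]
      congr 1
      push_cast
      ring
    have ha : |a| ≤ 1 := abs_le_one_iff_mul_self_le_one.2 (by nlinarith)
    have hb : |b| ≤ 1 := abs_le_one_iff_mul_self_le_one.2 (by nlinarith)
    have hmul : ∀ u v : ℝ, |u| ≤ 1 → |v| ≤ ε / 2 * |y - x| → |u * v| ≤ ε / 2 * |y - x| :=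
      fun u v hu hv => by
        rw [abs_mul]
        exact (mul_le_of_le_one_left (abs_nonneg _) hu).trans hv
    constructor
    · have : y + f₁ y t - (x + f₁ x t) - (y - x) * (a ^ 2 - b ^ 2) = a * S₀ - b * S₁ := by
        simp only [hS₀, hS₁, δ₁]
        linear_combination (-(f₁ y t - f₁ x t + (y - x))) * hab
      rw [this]
      have := abs_sub (a * S₀) (b * S₁)
      linarith [hmul a S₀ ha c0, hmul b S₁ hb c1]
    · have : δ₂ - (y - x) * (2 * a * b) = b * S₀ + a * S₁ := by
        simp only [hS₀, hS₁]
        linear_combination (-δ₂) * hab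
      rw [this]
      have := abs_add_le (b * S₀) (a * S₁)
      linarith [hmul b S₀ hb c0, hmul a S₁ ha c1]
  simp only [← hasDerivWithinAt_univ]
  exact ⟨hasDerivWithinAt_of_eventually_abs_le fun ε hε => (key ε hε).mono fun y hy _ => hy.1,
    hasDerivWithinAt_of_eventually_abs_le fun ε hε => (key ε hε).mono fun y hy _ => hy.2⟩

/-- The second row of the transfer matrix at `k = ∞`, which consists of the sine and the cosine of
the angle between the rotations `M₀` at the two times, is `(s f₂ / 2, 1) + o(s)`. -/
theorem hasDerivWithinAt_time {x : ℝ}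
    (h : ∀ t ∈ T, IsExpandedWaveMatrix D x t (M x t) (α x t) (β x t) (f₁ x t) (f₂ x t)) {t : ℝ}
    (ht : t ∈ T) :
    HasDerivWithinAt (fun s => α x s ^ 2 - β x s ^ 2) (-(2 * α x t * β x t * f₂ x t)) T t := by
  have hab := (h t ht).sq_add_sq
  obtain ⟨R₀, hN⟩ := ((h t ht).wave.rotate hab).isFrame_inv (h t ht).rotate_tendsto
  have hP := (h t ht).hasExpansion
  have t1 : Tendsto (fun s : ℝ => -(s - t) / 4) (𝓝[≠] t) (𝓝[≠] 0) :=
    (tendsto_affine_nhdsNE (-1 / 4) t (by norm_num)).congr fun s => by ring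
  have t2 : Tendsto (fun s : ℝ => -(-(s - t) / 4)) (𝓝[≠] t) (𝓝[≠] 0) :=
    (tendsto_affine_nhdsNE (1 / 4) t (by norm_num)).congr fun s => by ring
  have habs : ∀ s : ℝ, |-(s - t) / 4| ≤ |s - t| := fun s => by
    rw [abs_div, abs_neg, abs_of_pos (by norm_num : (0 : ℝ) < 4)]
    linarith [abs_nonneg (s - t)]
  have hS : HasDerivWithinAt (fun s => β x s * α x t - α x s * β x t) (f₂ x t / 2) T t := by
    refine hasDerivWithinAt_of_eventually_abs_le fun ε hε => ?_
    filter_upwards [t1.eventually (hN.eventually_norm_apply_zero_sub_le hP hε 0 1)] with s hs hsT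
    obtain ⟨E₀, E₁, hE, e0, -⟩ := (h s hsT).exists_transfer_time (h t ht)
    refine le_trans ?_ ((hs E₀ E₁ hE).trans (mul_le_mul_of_nonneg_left (habs s) hε.le))
    rw [e0, ← Real.norm_eq_abs, ← Complex.norm_real]
    refine le_of_eq (congrArg _ ?_)
    simp only [Matrix.smul_apply, Matrix.of_apply, Matrix.cons_val', Matrix.cons_val_zero,
      Matrix.cons_val_one, Matrix.cons_val_fin_one, smul_eq_mul]
    push_cast
    linear_combination (-((s : ℂ) - t) * f₂ x t / 2) * Complex.I_sq
  have hC : HasDerivWithinAt (fun s => α x t * α x s + β x t * β x s) 0 T t := by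
    refine hasDerivWithinAt_of_eventually_abs_le fun ε hε => ?_
    filter_upwards [t2.eventually (hN.flip.eventually_norm_apply_zero_sub_le hP.flip hε 1 0)]
      with s hs hsT
    obtain ⟨E₀, E₁, hE, -, e1⟩ := (h s hsT).exists_transfer_time (h t ht)
    refine le_trans ?_ ((hs E₁ E₀ hE.flip).trans
      (mul_le_mul_of_nonneg_left ((abs_neg _).trans_le (habs s)) hε.le))
    rw [e1, ← Real.norm_eq_abs, ← Complex.norm_real]
    refine le_of_eq (congrArg _ ?_)
    have hab' : (α x t : ℂ) ^ 2 + (β x t : ℂ) ^ 2 = 1 := by exact_mod_cast hab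
    push_cast
    linear_combination -hab'
  -- recover `α` and `β` at the time `s` from the angle
  have hα : HasDerivWithinAt (fun s => α x s) (-(f₂ x t / 2 * β x t)) T t := by
    refine (((hC.const_mul (α x t)).sub (hS.const_mul (β x t))).congr_deriv (by ring)).congr_of_eventuallyEq
      (.of_forall fun s => ?_) ?_
    · simp only [Pi.sub_apply]
      linear_combination (-α x s) * hab
    · simp only [Pi.sub_apply]
      linear_combination (-α x t) * hab
  have hβ : HasDerivWithinAt (fun s => β x s) (f₂ x t / 2 * α x t) T t := by
    refine (((hC.const_mul (β x t)).add (hS.const_mul (α x t))).congr_deriv (by ring)).congr_of_eventuallyEq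
      (.of_forall fun s => ?_) ?_
    · simp only [Pi.add_apply]
      linear_combination (-β x s) * hab
    · simp only [Pi.add_apply]
      linear_combination (-β x t) * hab
  exact ((hα.pow 2).sub (hβ.pow 2)).congr_deriv (by push_cast; ring)

end SPData

theorem theorem3p2 (D : SPData) (T : Set ℝ)
    (M : ℝ → ℝ → ℂ → Matrix (Fin 2) (Fin 2) ℂ)
    (hM : ∀ x : ℝ, ∀ t ∈ T, D.IsUniqueRHSolution x t (M x t))
    -- the value `M(x,t,0)` and the limit that defines `f₁`, `f₂`
    (M₀ F : ℝ → ℝ → Matrix (Fin 2) (Fin 2) ℂ)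
    (hM₀ : ∀ x : ℝ, ∀ t ∈ T, Tendsto (M x t) (𝓝[SPData.offReal] 0) (𝓝 (M₀ x t)))
    (hF : ∀ x : ℝ, ∀ t ∈ T,
      Tendsto (fun k : ℂ => (Complex.I / k) • ((M₀ x t)⁻¹ * M x t k - 1))
        (𝓝[SPData.offReal] 0) (𝓝 (F x t))) :
    ∃ α β f₁ f₂ : ℝ → ℝ → ℝ,
      (∀ x : ℝ, ∀ t ∈ T,
        M₀ x t = !![(α x t : ℂ), (β x t : ℂ); -(β x t : ℂ), (α x t : ℂ)] ∧
        F x t = !![(f₁ x t : ℂ), (f₂ x t : ℂ); (f₂ x t : ℂ), -(f₁ x t : ℂ)]) ∧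
      -- the three equations wherever `q̂` and `ŵ` are defined
      (∀ x : ℝ, ∀ t ∈ T, α x t ^ 2 ≠ β x t ^ 2 →
        HasDerivAt (fun y => y + f₁ y t) (1 / qHat α β x t) x ∧
        HasDerivAt (fun y => f₂ y t) (wHat α β x t / qHat α β x t) x ∧
        HasDerivWithinAt (fun s => qHat α β x s)
          (f₂ x t * qHat α β x t * wHat α β x t) T t) ∧
      -- the same equations without denominators, at all points
      (∀ x : ℝ, ∀ t ∈ T,
        HasDerivAt (fun y => y + f₁ y t) (α x t ^ 2 - β x t ^ 2) x ∧
        HasDerivAt (fun y => f₂ y t) (2 * α x t * β x t) x ∧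
        HasDerivWithinAt (fun s => α x s ^ 2 - β x s ^ 2)
          (-(2 * α x t * β x t * f₂ x t)) T t) := by
  have hex : ∀ x t, ∃ α β f₁ f₂ : ℝ, t ∈ T →
      M₀ x t = !![(α : ℂ), (β : ℂ); -(β : ℂ), (α : ℂ)] ∧
      F x t = !![(f₁ : ℂ), (f₂ : ℂ); (f₂ : ℂ), -(f₁ : ℂ)] ∧
      SPData.IsExpandedWaveMatrix D x t (M x t) α β f₁ f₂ := by
    intro x t
    by_cases ht : t ∈ T
    · obtain ⟨α, β, f₁, f₂, h⟩ :=
        (hM x t ht).1.isExpandedWaveMatrix (hM₀ x t ht) (hF x t ht)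
      exact ⟨α, β, f₁, f₂, fun _ => h⟩
    · exact ⟨0, 0, 0, 0, fun h => absurd h ht⟩
  choose α β f₁ f₂ h using hex
  have hx := fun x t (ht : t ∈ T) => SPData.hasDerivAt_space (fun y => (h y t ht).2.2) x
  have ht := fun x t (ht : t ∈ T) => SPData.hasDerivWithinAt_time (fun s hs => (h x s hs).2.2) ht
  refine ⟨α, β, f₁, f₂, fun x t ht => ⟨(h x t ht).1, (h x t ht).2.1⟩, fun x t hT hne => ?_,
    fun x t hT => ⟨(hx x t hT).1, (hx x t hT).2, ht x t hT⟩⟩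
  have hne' : α x t ^ 2 - β x t ^ 2 ≠ 0 := sub_ne_zero.2 hne
  refine ⟨(hx x t hT).1.congr_deriv ?_, (hx x t hT).2.congr_deriv ?_, ?_⟩
  · rw [qHat, one_div_one_div]
  · rw [qHat, wHat]; field_simp
  · have := (ht x t hT).fun_inv hne'
    simp only [qHat, one_div]
    refine this.congr_deriv ?_
    rw [wHat]; field_simp
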